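/- **Setting.** Let $k\ge 2$, let $\mathcal A_1,\dots,\mathcal A_k$ be finite alphabets with maps $\pi_i:\mathcal A_i\to\mathcal A_{i+1}$, let $X_i=\mathcal A_i^{\mathbb N}$ with the shift $T_i$, and let $\Pi_{i,j}=\pi_{j-1}\circ\cdots\circ\pi_i$ ($i\le j$) and $\Pi_i=\Pi_{1,i}$, acting on letters and, letter by letter, on infinite words. For a finite nonzero Borel measure $\nu$ on $X_i$ let $\hat\nu=\nu/\nu(X_i)$ and $\dim_e(\nu)=\lim_{n\to\infty}-\frac1n\sum_{u\in\mathcal A_i^n}\hat\nu([u])\log\hat\nu([u])$ whenever the limit exists; for $T_i$-invariant probability measures this is the entropy $h_\nu(T_i)$. Let $\gamma_1,\dots,\gamma_k>0$ and $\Gamma_i=\gamma_1+\cdots+\gamma_i$. *Random set.* Let $(A(u))_{u\in\mathcal A_1^*}$ be independent copies, indexed by the finite words over $\mathcal A_1$, of a random subset $A$ of $\mathcal A_1$ with $\mathbb E(\#A)>1$, and let $K=\{x\in X_1:\ x_{n+1}\in A(x_1\cdots x_n)\text{ for all }n\ge 0\}$. *Mandelbrot measures.* Let $((A(u),W(u)))_{u}$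 be independent copies of $(A,W)$, where $W=(W_a)_{a\in\mathcal A_1}$ is a random vector with $W_a\ge 0$, $\{W_a>0\}\subset\{a\in A\}$ almost surely and $\mathbb E\sum_aW_a=1$. Put $Q^u(v)=\prod_{j=1}^{|v|}W_{v_j}(u v_1\cdots v_{j-1})$, $Q=Q^{\epsilon}$, and let $Y(u)$ be the almost sure limit of the martingale $\sum_{|v|=n}Q^u(v)$. The Mandelbrot measure $\mu$ generated by $W$ is the random measure on $X_1$ with $\mu([u])=Q(u)Y(u)$ for all finite words $u$; such a $\mu$ is said to be supported on $K$. It is positive if $\mathbb P(\mu\ne0)>0$. For a positive $\mu$, $\dim_e^{\vec\gamma}(\mu)$ denotes the (deterministic) value taken by $\sum_{i=1}^k\gamma_i\dim_e(\Pi_i\mu)$ almost surely on $\{\mu\neq0\}$, where $\Pi_i\mu$ is the image of $\mu$ under $\Pi_i$. *Pressures.* For $b\in\mathcal A_i$ let $N^{(i)}_b=\#\{a\in A:\Pi_i(a)=b\}$, and let $\widetilde{\mathcal A}_i=\{b\in\mathcal A_i:\mathbb E(N^{(i)}_b)>0\}$. For $2\le i\le k$ and $\theta\in\mathbb R$ let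 $$P_i(\theta)=\sup_\nu\Big\{\theta\,\Gamma_i\int\log\mathbb E(N^{(i)}_{x_1})\,d\nu(x)+\Gamma_i\,h_\nu(T_i)+\sum_{j=i+1}^k\gamma_j\,h_{\Pi_{i,j}\nu}(T_j)\Big\},$$ the supremum being over the $T_i$-invariant Borel probability measures $\nu$ on $X_i$ carried by $\widetilde{\mathcal A}_i^{\,\mathbb N}$. A measure attaining the supremum is called an equilibrium state of $P_i$ at $\theta$. Let $P_{k+1}=P_k$ and $\widetilde\theta_i=\Gamma_{i-1}/\Gamma_i$. Let $i_0$ be the smallest $i\in\{2,\dots,k\}$ with $P_i'(1)\ge0$, and $i_0=k+1$ if there is none. Let $\theta_{i_0}=\min\{\theta\in[\widetilde\theta_{i_0},1]:P'_{i_0}(\theta)\ge0\}$ if $i_0\le k$, and $\theta_{i_0}=1$ if $i_0=k+1$. **Theorem.** The functions $P_i$ ($2\le i\le k$) are differentiable, and $\dim_e^{\vec\gamma}(\mu)$ is well defined for every positive Mandelbrot measure $\mu$ supported on $K$. The maximum $$M^{\vec\gamma}=\max\{\dim_e^{\vec\gamma}(\mu):\ \mu\text{ is a positive Mandelbrot measure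 supported on }K\}$$ exists and $$M^{\vec\gamma}=\begin{cases}P_{i_0}(\theta_{i_0})&\text{if }i_0\le k,\\ P_k(1)&\text{if }i_0=k+1.\end{cases}$$ There is exactly one equilibrium state $\nu$ of $P_{i_0}$ at $\theta_{i_0}$; it is a Bernoulli product measure on $X_i$, where $i=\min(i_0,k)$. The maximum is attained at the Mandelbrot measure $\mu_{\nu}$ generated by the vector $$W_a=\begin{cases}\nu([b])/\mathbb E(N^{(i)}_{b})&\text{if }a\in A,\\0&\text{if }a\notin A,\end{cases}\qquad b=\Pi_i(a)$$ (where $0/0=0$), which is a positive Mandelbrot measure supported on $K$; and every positive Mandelbrot measure $\mu$ supported on $K$ with $\dim_e^{\vec\gamma}(\mu)=M^{\vec\gamma}$ is almost surely equal to $\mu_{\nu}$. -/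

import Mathlib

open MeasureTheory ProbabilityTheory Filter Topology
open scoped NNReal ENNReal

/-! The layers of the sponge are indexed from `0` to `m` with `m = k - 1 ≥ 1`:  the alphabet `𝒜 i`, the
map `π i : 𝒜 i → 𝒜 (i + 1)` and the number `γ i` are what is written `𝒜_{i+1}`, `π_{i+1}`, `γ_{i+1}` when
the layers are numbered from `1` to `k`.  Layers of index greater than `m` play no role. -/

noncomputable section

namespace Sponge

universe u v

/-! ### Symbolic spaces -/

section Symbolic

variable {α : Type u}

/-- The one-sided shift on `α^ℕ`. -/
def shift (x : ℕ → α) : ℕ → α := fun n => x (n + 1)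

/-- The prefix of length `n` of an infinite word. -/
def pre (x : ℕ → α) (n : ℕ) : List α := List.ofFn (fun i : Fin n => x i)

/-- The cylinder `[w]`: the infinite words having `w` as prefix. -/
def cyl (w : List α) : Set (ℕ → α) := {x | pre x w.length = w}

/-- The entropy `-∑_{|w| = n} ν[w] log ν[w]` of the partition into cylinders of generation `n`. -/
def blockEntropy [Fintype α] [MeasurableSpace α] (ν : Measure (ℕ → α)) (n : ℕ) : ℝ :=
  ∑ w : Fin n → α, Real.negMulLog (ν.real (cyl (List.ofFn w)))

/-- The nonzero finite measure `ν` has entropy dimension `d`: the limit of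
`-(1/n) ∑_{|w| = n} ν[w] log ν[w]`, computed for the normalisation of `ν` to a probability measure,
exists and equals `d`. -/
def HasEntropyDim [Fintype α] [MeasurableSpace α] (ν : Measure (ℕ → α)) (d : ℝ) : Prop :=
  Tendsto (fun n : ℕ => blockEntropy ((ν Set.univ)⁻¹ • ν) n / n) atTop (𝓝 d)

/-- The entropy of a shift-invariant probability measure with respect to the shift. The partition into
cylinders of generation `1` is generating, and the limit exists by subadditivity. -/
def shiftEntropy [Fintype α] [MeasurableSpace α] (ν : Measure (ℕ → α)) : ℝ :=
  limUnder atTop (fun n : ℕ => blockEntropy ν n / n)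

/-- `ν` is a shift-invariant Borel probability measure carried by the words with letters in `S`. -/
structure IsInvariantOn [MeasurableSpace α] (S : Set α) (ν : Measure (ℕ → α)) : Prop where
  prob : IsProbabilityMeasure ν
  invariant : MeasurePreserving shift ν ν
  carried : ∀ᵐ x ∂ν, ∀ n, x n ∈ S

/-- `ν` is a Bernoulli product measure. -/
def IsBernoulli [MeasurableSpace α] (ν : Measure (ℕ → α)) : Prop :=
  ∃ ρ : Measure α, ∃ _ : IsProbabilityMeasure ρ, ν = Measure.infinitePi (fun _ : ℕ => ρ)

end Symbolic

/-! ### Factor maps -/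

section Factor

variable {𝒜 : ℕ → Type u} (π : ∀ i, 𝒜 i → 𝒜 (i + 1))

/-- The letter map `Π_{i,j} : 𝒜 i → 𝒜 j` for `i ≤ j`, the composition of `π i, …, π (j - 1)`. -/
def letterMap {i j : ℕ} (h : i ≤ j) : 𝒜 i → 𝒜 j := Nat.leRecOn h (fun {n} => π n)

/-- The one-block factor map `Π_{i,j} : X_i → X_j`. -/
def factorMap {i j : ℕ} (h : i ≤ j) (x : ℕ → 𝒜 i) : ℕ → 𝒜 j := fun n => letterMap π h (x n)

end Factor

/-! ### The random set and the Mandelbrot measures -/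

section Tree

variable {α : Type u}

/-- The set `K` built from the sets of surviving letters: `x ∈ K` if and only if for all `n` the letter
`x_{n+1}` survives below the prefix of length `n` of `x`. -/
def sponge (c : List α → α → Bool) : Set (ℕ → α) := {x | ∀ n, c (pre x n) (x n) = true}

/-- `Q^u(v) = ∏_{j ≤ |v|} W_{v_j}(u v_1 ⋯ v_{j-1})`. -/
def Q (W : List α → α → ℝ≥0) : List α → List α → ℝ≥0
  | _, [] => 1
  | u, a :: v => W u a * Q W (u ++ [a]) v

/-- The support of the Mandelbrot measure: the infinite words all of whose prefixes have `Q > 0`. -/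
def weightSupport (W : List α → α → ℝ≥0) : Set (ℕ → α) := {x | ∀ n, 0 < Q W [] (pre x n)}

/-- `Y_n(u) = ∑_{|v| = n} Q^u(v)`. -/
def Yn [Fintype α] (W : List α → α → ℝ≥0) (u : List α) (n : ℕ) : ℝ≥0∞ :=
  ∑ v : Fin n → α, (Q W u (List.ofFn v) : ℝ≥0∞)

/-- `Y(u)`, the (almost sure) limit of the martingale `Y_n(u)`. -/
def Y [Fintype α] (W : List α → α → ℝ≥0) (u : List α) : ℝ≥0∞ := limsup (Yn W u) atTop

open Classical in
/-- The Mandelbrot measure of a realisation `W` of the weights: the unique finite Borel measure on `α^ℕ`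
with `μ[u] = Q(u) Y(u)` for every finite word `u`. It exists almost surely; it is set to be `0` if it
does not exist. -/
def mandelbrotMeasure [Fintype α] [MeasurableSpace α] (W : List α → α → ℝ≥0) : Measure (ℕ → α) :=
  if h : ∃ μ : Measure (ℕ → α), IsFiniteMeasure μ ∧ ∀ u, μ (cyl u) = Q W [] u * Y W u
  then h.choose else 0

variable {Ω : Type v} [MeasurableSpace Ω]

/-- `(A(u))_u` are independent copies of a random subset `A` of `α` with `𝔼(#A) > 1`; here `A(u)` is the
random set of the letters `a` with `c u ω a = true`. -/
structure IsPercolation [Fintype α] (P : Measure Ω) (c : List α → Ω → α → Bool) : Prop where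
  measurable : ∀ u, Measurable (c u)
  indep : iIndepFun c P
  ident : ∀ u, IdentDistrib (c u) (c []) P P
  supercritical : 1 < ∫ ω, (Nat.card {a : α // c [] ω a = true} : ℝ) ∂P

/-- `W` is a family of weights generating a Mandelbrot measure on `K`, jointly constructed with `K`:
`(A(u), W(u))_u` are independent copies of `(A, W)`, where `W_a ≥ 0`, `{W_a > 0} ⊆ {a ∈ A}` up to a null
event, and `𝔼 (∑_a W_a) = 1`. -/
structure IsMandelbrotOn [Fintype α] (P : Measure Ω) (c : List α → Ω → α → Bool)
    (W : List α → Ω → α → ℝ≥0) : Prop where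
  measurable : ∀ u, Measurable (W u)
  indep : iIndepFun (fun u ω => (c u ω, W u ω)) P
  ident : ∀ u, IdentDistrib (fun ω => (c u ω, W u ω)) (fun ω => (c [] ω, W [] ω)) P P
  supported : ∀ a, ∀ᵐ ω ∂P, 0 < W [] ω a → c [] ω a = true
  normalised : ∫⁻ ω, ∑ a, (W [] ω a : ℝ≥0∞) ∂P = 1

/-- The random Mandelbrot measure generated by the family `W`. -/
def randomMeasure [Fintype α] [MeasurableSpace α] (W : List α → Ω → α → ℝ≥0) (ω : Ω) :
    Measure (ℕ → α) :=
  mandelbrotMeasure (fun u => W u ω)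

/-- The Mandelbrot measure is positive (non-degenerate): `ℙ(μ ≠ 0) > 0`. -/
def IsPositive [Fintype α] [MeasurableSpace α] (P : Measure Ω) (W : List α → Ω → α → ℝ≥0) : Prop :=
  0 < P {ω | randomMeasure W ω ≠ 0}

theorem Q_append_singleton (W : List α → α → ℝ≥0) (u v : List α) (a : α) :
    Q W u (v ++ [a]) = Q W u v * W (u ++ v) a := by
  induction v generalizing u with
  | nil => simp [Q]
  | cons b v ih => simp [Q, ih, mul_assoc]

theorem pre_succ (x : ℕ → α) (n : ℕ) : pre x (n + 1) = pre x n ++ [x n] := by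
  rw [pre, List.ofFn_succ_last]; rfl

/-- The measures under consideration are supported on `K`: almost surely `K_μ ⊆ K`. -/
theorem IsMandelbrotOn.ae_weightSupport_subset [Fintype α] {P : Measure Ω}
    {c : List α → Ω → α → Bool} {W : List α → Ω → α → ℝ≥0} (h : IsMandelbrotOn P c W) :
    ∀ᵐ ω ∂P, weightSupport (fun u => W u ω) ⊆ sponge (fun u => c u ω) := by
  have key : ∀ u : List α, ∀ a : α, ∀ᵐ ω ∂P, 0 < W u ω a → c u ω a = true := by
    intro u a
    have hm : MeasurableSet {p : (α → Bool) × (α → ℝ≥0) | 0 < p.2 a → p.1 a = true} := by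
      have h1 : MeasurableSet {p : (α → Bool) × (α → ℝ≥0) | 0 < p.2 a} :=
        measurableSet_lt measurable_const ((measurable_pi_apply a).comp measurable_snd)
      have h2 : MeasurableSet {p : (α → Bool) × (α → ℝ≥0) | p.1 a = true} :=
        ((measurable_pi_apply a).comp (measurable_fst (α := α → Bool) (β := α → ℝ≥0)))
          (measurableSet_singleton true)
      exact h1.imp h2
    exact (h.ident u).symm.ae_snd hm (h.supported a)
  have key' : ∀ᵐ ω ∂P, ∀ u : List α, ∀ a : α, 0 < W u ω a → c u ω a = true := by
    rw [ae_all_iff]; intro u; rw [ae_all_iff]; exact key u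
  filter_upwards [key'] with ω hω x hx n
  apply hω
  have := hx (n + 1)
  rw [pre_succ, Q_append_singleton] at this
  exact pos_of_mul_pos_right this zero_le

end Tree

/-! ### Weighted entropies and pressures -/

section Pressure

variable {𝒜 : ℕ → Type u} [∀ i, Fintype (𝒜 i)] [∀ i, MeasurableSpace (𝒜 i)]
  (π : ∀ i, 𝒜 i → 𝒜 (i + 1)) (γ : ℕ → ℝ) (m : ℕ)

/-- The nonzero finite measure `μ` on `X_0` has weighted entropy dimension
`∑_i γ_i dim_e(Π_i μ) = D`, all the entropy dimensions `dim_e(Π_i μ)` being well defined. -/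
def HasWeightedEntropyDim (μ : Measure (ℕ → 𝒜 0)) (D : ℝ) : Prop :=
  ∃ d : ℕ → ℝ, (∀ i ≤ m, HasEntropyDim (μ.map (factorMap π (Nat.zero_le i))) (d i)) ∧
    D = ∑ i ∈ Finset.range (m + 1), γ i * d i

/-- The weighted entropy `∑_{j = i}^{m} β_j h(Π_{i,j} ν)` of an invariant measure on `X_i`. -/
def weightedEntropy (β : ℕ → ℝ) (i : ℕ) (ν : Measure (ℕ → 𝒜 i)) : ℝ :=
  ∑ j : Finset.Icc i m,
    β j * shiftEntropy (ν.map (factorMap π (Finset.mem_Icc.1 j.2).1))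

/-- The weighted pressure of `φ`: the supremum of `ν(φ) + h^β_ν` over the invariant probability measures
on the sub-alphabet `S` of `𝒜 i`. -/
def weightedPressure (β : ℕ → ℝ) (i : ℕ) (S : Set (𝒜 i)) (φ : (ℕ → 𝒜 i) → ℝ) : ℝ :=
  sSup {r | ∃ ν : Measure (ℕ → 𝒜 i), IsInvariantOn S ν ∧
    r = ∫ x, φ x ∂ν + weightedEntropy π m β i ν}

/-- `γ_0 + ⋯ + γ_i`. -/
def cumWeight (i : ℕ) : ℝ := ∑ j ∈ Finset.range (i + 1), γ j

/-- The vector `γ^i = (γ_0 + ⋯ + γ_i, γ_{i+1}, …, γ_m)`, indexed by `i, …, m`. -/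
def gammaVec (i : ℕ) : ℕ → ℝ := fun j => if j = i then cumWeight γ i else γ j

/-- `𝔼(N_b^{(i)})`, where `N_b^{(i)}` is the number of letters of `A` sent to `b ∈ 𝒜 i` by `Π_i`. -/
def meanCount {Ω : Type v} [MeasurableSpace Ω] (P : Measure Ω)
    (c : List (𝒜 0) → Ω → 𝒜 0 → Bool) (i : ℕ) (b : 𝒜 i) : ℝ :=
  ∫ ω, (Nat.card {a : 𝒜 0 // c [] ω a = true ∧ letterMap π (Nat.zero_le i) a = b} : ℝ) ∂P

/-! From here on `N i b` stands for the numbers `𝔼(N_b^{(i)})`. -/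

variable (N : ∀ i, 𝒜 i → ℝ)

/-- The sub-alphabet of the letters `b ∈ 𝒜 i` with `𝔼(N_b^{(i)}) > 0`. -/
def liveLetters (i : ℕ) : Set (𝒜 i) := {b | 0 < N i b}

/-- The potential `φ_i(x) = (γ_0 + ⋯ + γ_i) log 𝔼(N_{x_1}^{(i)})`. -/
def potential (i : ℕ) (x : ℕ → 𝒜 i) : ℝ := cumWeight γ i * Real.log (N i (x 0))

/-- `P_i(θ)`, the weighted pressure of `θ φ_i`. -/
def pressure (i : ℕ) (θ : ℝ) : ℝ :=
  weightedPressure π m (gammaVec γ i) i (liveLetters N i) (fun x => θ * potential γ N i x)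

/-- `ν` is an equilibrium state of `P_i` at `θ`: an invariant measure attaining the supremum that
defines `P_i(θ)`. -/
def IsEquilibriumState (i : ℕ) (θ : ℝ) (ν : Measure (ℕ → 𝒜 i)) : Prop :=
  IsInvariantOn (liveLetters N i) ν ∧
    ∫ x, θ * potential γ N i x ∂ν + weightedEntropy π m (gammaVec γ i) i ν = pressure π γ m N i θ

/-- The smallest `i ∈ {1, …, m}` with `P_i'(1) ≥ 0`, or `m + 1` if there is none. -/
def criticalIndex : ℕ :=
  sInf ({i | 1 ≤ i ∧ i ≤ m ∧ 0 ≤ deriv (pressure π γ m N i) 1} ∪ {m + 1})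

/-- `(γ_0 + ⋯ + γ_{i-1}) / (γ_0 + ⋯ + γ_i)`. -/
def thetaTilde (i : ℕ) : ℝ := (∑ j ∈ Finset.range i, γ j) / cumWeight γ i

/-- With `i₀` the critical index: the smallest `θ` between `thetaTilde i₀` and `1` with `P_{i₀}'(θ) ≥ 0`
if `i₀ ≤ m`, and `1` otherwise. -/
def criticalTheta : ℝ :=
  let i₀ := criticalIndex π γ m N
  if i₀ ≤ m then
    sInf {θ | θ ∈ Set.Icc (thetaTilde γ i₀) 1 ∧ 0 ≤ deriv (pressure π γ m N i₀) θ}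
  else 1

/-- The weights `ν[b] / 𝔼(N_b^{(i)})` if `a ∈ A(u)` and `0` otherwise, with `b = Π_i(a)`: they generate
the Mandelbrot measure `μ_ν` associated with a Bernoulli product measure `ν` on `X_i`. -/
def bernoulliWeights {Ω : Type v} (c : List (𝒜 0) → Ω → 𝒜 0 → Bool) (i : ℕ)
    (ν : Measure (ℕ → 𝒜 i)) (u : List (𝒜 0)) (ω : Ω) (a : 𝒜 0) : ℝ≥0 :=
  let b := letterMap π (Nat.zero_le i) a
  if c u ω a = true then (ν (cyl [b])).toNNReal / (N i b).toNNReal else 0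

end Pressure

end Sponge

end

/-!
The weights `W u`, indexed by finite words, form a tree whose law is a product measure, and such a tree
splits at its root into a vector of weights and independent copies of itself.  Expectations of sums over
the words of a given length are computed by this recursion at the root (`treeLaw`).

*The dimensions of a Mandelbrot measure.*  Let `μ` be a positive Mandelbrot measure, let `h` be the
entropy `E ∑ -W_a log W_a` of its weights, and let `H_i` be the entropy of the image `q^i` on the `i`-th
alphabet of the probability vector `E W`.  Almost surely on `μ ≠ 0` the image of `μ` on the `i`-th layer
has entropy dimension `min h H_i`.

* For the upper bound, Gibbs' inequality compares the masses of cylinders with products of truncated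
  weights, or of truncated entries of `q^i`; the deviation of the Birkhoff sums that appear is controlled
  by a first moment bound, which costs arbitrarily little.  This also shows that `W log W` is integrable.
* For the lower bound no moment beyond `E ∑ W_a |log W_a|` is available.  One samples a word along the
  weights (the spine) and bounds the expected mass of the words with the same projected prefix of length
  `n` (the many-to-one formula, applied twice).  The strong law of large numbers along the spine shows
  that this mass is at most `C exp (-n d)` for all `n` when `d < min h H_i`, outside of an event of small
  probability.  Hence almost no mass is carried by projected cylinders of mass above `exp (-n d)`.  The
  same estimate with `n = 0` gives uniform integrability of the martingale of total masses when `h > 0`,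
  thus the positivity of the measure.

*The pressures.*  A shift-invariant measure has at most the entropy of the Bernoulli measure with the same
one-letter marginals, with equality only for that Bernoulli measure, so `P_i(θ)` is the maximum over
probability vectors `q` of
`θ Γ_i ∑ q log N^i + Γ_i H(q) + ∑_{j > i} γ_j H(Π_{i,j} q)`.
This is strictly concave in `q`, so that the maximiser `q_θ` is unique, is continuous in `θ`, and
`P_i'(θ) = Γ_i ∑ q_θ log N^i`.

*The optimisation.*  Gibbs' inequality for the weights, against `q^i_b / N^i_b` on the letters of `A`, gives
`h ≤ H_i + ∑ q^i log N^i`, with equality only for `W_a = q^i_b / N^i_b` on `a ∈ A`.  For `θ` between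
`Γ_{i-1} / Γ_i` and `1`, bounding `min h H_j` by `h` for `j < i`, by a convex combination of `h` and `H_i`
for `j = i`, and by `H_j` for `j > i`, gives `∑ γ_j min h H_j ≤ P_i(θ)`.  At the critical pair
`(i₀, θ₀)` the weights given by the maximiser `q_θ` realise equality.  Either `P_i'(θ) = 0`, which means
`h = H_i`; or `θ = Γ_{i-1} / Γ_i` is the left end point, where `P_i(θ) = P_{i-1}(1)` and
`P_{i-1}'(1) < 0` (or `N^{i-1} ≤ 1`, if `i - 1` is the level of `μ` itself) give
`H_i ≤ h ≤ H_{i-1}`; or `i` is the last level, `θ = 1`, and `h ≤ H_i`.  The equality cases identify the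
optimal weights, and `h > 0` there because `P_i(θ) > 0`, as the normalised vector `N^i` shows.
-/

noncomputable section

set_option linter.unusedSectionVars false

namespace Sponge

/-! ### Sums over words and trees of weights -/

section Words

variable {α : Type*} [Fintype α] {M : Type*} [AddCommMonoid M]

/-- The sum of `g` over the words of length `n`. -/
def wsum (n : ℕ) (g : List α → M) : M := ∑ v : Fin n → α, g (List.ofFn v)

@[simp] lemma wsum_zero (g : List α → M) : wsum 0 g = g [] := by simp [wsum]

lemma wsum_succ (n : ℕ) (g : List α → M) :
    wsum (n + 1) g = ∑ a, wsum n (fun v => g (a :: v)) := by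
  unfold wsum
  rw [← (Fin.consEquiv (fun _ : Fin (n + 1) => α)).sum_comp, Fintype.sum_prod_type]
  simp [Fin.consEquiv, List.ofFn_succ]

lemma wsum_congr {n : ℕ} {g g' : List α → M} (h : ∀ v, v.length = n → g v = g' v) :
    wsum n g = wsum n g' :=
  Finset.sum_congr rfl fun v _ => h _ (by simp)

lemma wsum_add (n k : ℕ) (g : List α → M) :
    wsum (n + k) g = wsum n (fun u => wsum k fun v => g (u ++ v)) := by
  induction n generalizing g with
  | zero => simp
  | succ n ih => simp [show n + 1 + k = n + k + 1 by omega, wsum_succ, ih]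

lemma wsum_le {n : ℕ} {g g' : List α → ℝ≥0∞} (h : ∀ v, v.length = n → g v ≤ g' v) :
    wsum n g ≤ wsum n g' :=
  Finset.sum_le_sum fun v _ => h _ (by simp)

lemma mul_wsum {R : Type*} [NonUnitalNonAssocSemiring R] (n : ℕ) (c : R) (g : List α → R) :
    c * wsum n g = wsum n (fun v => c * g v) := Finset.mul_sum _ _ _

lemma wsum_mul {R : Type*} [NonUnitalNonAssocSemiring R] (n : ℕ) (c : R) (g : List α → R) :
    wsum n g * c = wsum n (fun v => g v * c) := Finset.sum_mul _ _ _

lemma wsum_add_distrib (n : ℕ) (g g' : List α → M) :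
    wsum n (fun v => g v + g' v) = wsum n g + wsum n g' := Finset.sum_add_distrib

lemma wsum_sum_comm {ι : Type*} (s : Finset ι) (n : ℕ) (g : ι → List α → M) :
    wsum n (fun v => ∑ i ∈ s, g i v) = ∑ i ∈ s, wsum n (g i) := Finset.sum_comm

lemma measurable_wsum {Ω : Type*} [MeasurableSpace Ω] {n : ℕ} {g : Ω → List α → ℝ≥0∞}
    (h : ∀ v, Measurable fun ω => g ω v) : Measurable fun ω => wsum n (g ω) :=
  Finset.measurable_fun_sum _ fun _ _ => h _

lemma lintegral_wsum {Ω : Type*} [MeasurableSpace Ω] (μ : Measure Ω) {n : ℕ}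
    {g : Ω → List α → ℝ≥0∞} (h : ∀ v, Measurable fun ω => g ω v) :
    ∫⁻ ω, wsum n (g ω) ∂μ = wsum n fun v => ∫⁻ ω, g ω v ∂μ :=
  lintegral_finsetSum _ fun _ _ => h _

end Words

section Trees

variable {α : Type*}

/-- The subtree of a tree of weights below the node `u`. -/
def sub (t : List α → α → ℝ≥0) (u : List α) : List α → α → ℝ≥0 := fun v => t (u ++ v)

@[simp] lemma sub_nil (t : List α → α → ℝ≥0) : sub t [] = t := rfl

lemma sub_sub (t : List α → α → ℝ≥0) (u v : List α) : sub (sub t u) v = sub t (u ++ v) := by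
  funext w; simp [sub]

/-- The tree of weights with root `w` and with the trees `s a` below the nodes of the first
generation. -/
def node (w : α → ℝ≥0) (s : α → List α → α → ℝ≥0) : List α → α → ℝ≥0
  | [] => w
  | a :: v => s a v

@[simp] lemma node_nil (w : α → ℝ≥0) (s : α → List α → α → ℝ≥0) : node w s [] = w := rfl

@[simp] lemma sub_node (w : α → ℝ≥0) (s : α → List α → α → ℝ≥0) (a : α) :
    sub (node w s) [a] = s a := rfl

lemma sub_node_cons (w : α → ℝ≥0) (s : α → List α → α → ℝ≥0) (a : α) (v : List α) :
    sub (node w s) (a :: v) = sub (s a) v := rfl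

/-- The product along the word `v`, read from the root of `t`, of weights `V` computed from the
weights of the tree. For `V w a = w a` this is `Q^ε(v)`. -/
def wt (V : (α → ℝ≥0) → α → ℝ≥0∞) : (List α → α → ℝ≥0) → List α → ℝ≥0∞
  | _, [] => 1
  | t, a :: v => V (t []) a * wt V (sub t [a]) v

/-- `Q^ε(v)`, with values in `[0, ∞]`. -/
abbrev Qt : (List α → α → ℝ≥0) → List α → ℝ≥0∞ := wt fun w a => (w a : ℝ≥0∞)

lemma Q_eq_sub (t : List α → α → ℝ≥0) (u v : List α) : Q t u v = Q (sub t u) [] v := by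
  induction v generalizing u t with
  | nil => rfl
  | cons a v ih =>
    simp only [Q, sub, List.append_nil, List.nil_append]
    rw [ih t (u ++ [a]), ih (sub t u) [a], sub_sub]

lemma Qt_eq (t : List α → α → ℝ≥0) (v : List α) : Qt t v = (Q t [] v : ℝ≥0∞) := by
  induction v generalizing t with
  | nil => simp [wt, Q]
  | cons a v ih =>
    have := ih (sub t [a])
    simp only [Qt, wt, Q, List.nil_append] at this ⊢
    rw [this, ← Q_eq_sub]; push_cast; rfl

lemma wt_append (V : (α → ℝ≥0) → α → ℝ≥0∞) (t : List α → α → ℝ≥0) (u v : List α) :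
    wt V t (u ++ v) = wt V t u * wt V (sub t u) v := by
  induction u generalizing t with
  | nil => simp [wt]
  | cons a u ih => simp [wt, ih, mul_assoc, sub_sub]

variable [Fintype α]

lemma Yn_eq (t : List α → α → ℝ≥0) (u : List α) (n : ℕ) : Yn t u n = wsum n (Qt (sub t u)) := by
  unfold Yn wsum
  refine Finset.sum_congr rfl fun v _ => ?_
  rw [Qt_eq, Q_eq_sub]

lemma Y_eq_sub (t : List α → α → ℝ≥0) (u : List α) : Y t u = Y (sub t u) [] := by
  unfold Y; congr 1; funext n; simp [Yn_eq]

lemma measurable_sub (u : List α) : Measurable fun t : List α → α → ℝ≥0 => sub t u := by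
  unfold sub; fun_prop

lemma measurable_wt {V : (α → ℝ≥0) → α → ℝ≥0∞} (hV : ∀ a, Measurable fun w => V w a)
    (v : List α) : Measurable fun t => wt V t v := by
  induction v with
  | nil => exact measurable_const
  | cons a v ih =>
    exact ((hV a).comp (measurable_pi_apply [])).mul (ih.comp (measurable_sub [a]))

lemma measurable_Qt (v : List α) : Measurable fun t => Qt t v :=
  measurable_wt (fun a => by fun_prop) v

lemma measurable_Yn (u : List α) (n : ℕ) : Measurable fun t : List α → α → ℝ≥0 => Yn t u n := by
  simp only [Yn_eq]
  exact measurable_wsum fun v => (measurable_Qt v).comp (measurable_sub u)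

lemma measurable_Y (u : List α) : Measurable fun t : List α → α → ℝ≥0 => Y t u :=
  Measurable.limsup fun n => measurable_Yn u n

lemma measurable_node :
    Measurable fun p : (α → ℝ≥0) × (α → List α → α → ℝ≥0) => node p.1 p.2 := by
  refine measurable_pi_iff.2 fun v => ?_
  cases v with
  | nil => exact measurable_fst
  | cons a v => simp only [node]; fun_prop

/-- The law of a tree of independent weight vectors of law `ρ`. -/
def treeLaw (ρ : Measure (α → ℝ≥0)) [IsProbabilityMeasure ρ] : Measure (List α → α → ℝ≥0) :=
  Measure.infinitePi fun _ : List α => ρ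

variable (ρ : Measure (α → ℝ≥0)) [IsProbabilityMeasure ρ]

instance : IsProbabilityMeasure (treeLaw ρ) := by unfold treeLaw; infer_instance

/-- Branching property: the root and the subtrees below the first generation are independent, and
the subtrees have the law of the whole tree. -/
lemma map_node :
    (ρ.prod (Measure.pi fun _ : α => treeLaw ρ)).map (fun p => node p.1 p.2) = treeLaw ρ := by
  classical
  refine Measure.eq_infinitePi _ fun s t ht => ?_
  rw [Measure.map_apply measurable_node (.pi s.countable_toSet fun i _ => ht i)]
  have inj : ∀ a : α, Function.Injective (fun v : List α => a :: v) := fun a v v' h => by simpa using h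
  -- a cylinder over a finite set of nodes splits according to the first letters of the nodes
  have h1 : (fun p : (α → ℝ≥0) × (α → List α → α → ℝ≥0) => node p.1 p.2) ⁻¹'
      ((s : Set (List α)).pi t) = (if [] ∈ s then t [] else Set.univ) ×ˢ
        (Set.univ.pi fun a => Set.pi (s.preimage (fun v => a :: v) (inj a).injOn)
          fun v => t (a :: v)) := by
    ext ⟨w, x⟩
    simp only [Set.mem_preimage, Set.mem_pi, Set.mem_prod, Set.mem_univ, true_imp_iff,
      Finset.coe_preimage, SetLike.mem_coe]
    constructor
    · intro h
      refine ⟨?_, fun a v hv => h (a :: v) hv⟩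
      split_ifs with h0
      · exact h [] h0
      · trivial
    · rintro ⟨h0, h⟩ v hv
      cases v with
      | nil => simpa [hv] using h0
      | cons a v => exact h a v hv
  rw [h1, Measure.prod_prod, Measure.pi_pi]
  have h2 : ρ (if [] ∈ s then t [] else Set.univ) = ∏ i ∈ s.filter (· = []), ρ (t i) := by
    split_ifs with h0
    · rw [show s.filter (· = []) = {[]} by ext v; simp; rintro rfl; exact h0]; simp
    · rw [show s.filter (· = []) = ∅ by ext v; simp; rintro h rfl; exact h0 h]; simp
  have h3 : ∏ a, treeLaw ρ (Set.pi (s.preimage (fun v => a :: v) (inj a).injOn)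
      fun v => t (a :: v)) = ∏ i ∈ s.filter (¬ · = []), ρ (t i) := by
    have : ∀ a, treeLaw ρ (Set.pi (s.preimage (fun v => a :: v) (inj a).injOn)
      fun v => t (a :: v)) = ∏ v ∈ s.preimage (fun v => a :: v) (inj a).injOn, ρ (t (a :: v)) :=
      fun a => Measure.infinitePi_pi _ fun i _ => ht _
    simp only [this]
    rw [Finset.prod_sigma']
    refine Finset.prod_bij (fun p _ => p.1 :: p.2) ?_ ?_ ?_ ?_
    · rintro ⟨a, v⟩ h; simpa using h
    · rintro ⟨a, v⟩ _ ⟨a', v'⟩ _ h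
      simp only [List.cons.injEq] at h
      obtain ⟨rfl, rfl⟩ := h; rfl
    · intro u hu
      cases u with
      | nil => simp at hu
      | cons a v => exact ⟨⟨a, v⟩, by simpa using hu, rfl⟩
    · intros; rfl
  rw [h2, h3, Finset.prod_filter_mul_prod_filter_not]

lemma lintegral_treeLaw {F : (List α → α → ℝ≥0) → ℝ≥0∞} (hF : Measurable F) :
    ∫⁻ t, F t ∂treeLaw ρ =
      ∫⁻ w, ∫⁻ s, F (node w s) ∂(Measure.pi fun _ : α => treeLaw ρ) ∂ρ := by
  conv_lhs => rw [← map_node ρ]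
  rw [lintegral_map hF measurable_node]
  exact lintegral_prod _ (hF.comp measurable_node).aemeasurable

lemma lintegral_pi_eval {F : (List α → α → ℝ≥0) → ℝ≥0∞} (hF : Measurable F) (a : α) :
    ∫⁻ s, F (s a) ∂(Measure.pi fun _ : α => treeLaw ρ) = ∫⁻ t, F t ∂treeLaw ρ := by
  have := (measurePreserving_eval (fun _ : α => treeLaw ρ) a)
  rw [← this.lintegral_comp hF]

lemma map_sub (u : List α) : (treeLaw ρ).map (fun t => sub t u) = treeLaw ρ :=
  Measure.map_infinitePi_infinitePi_of_inj (P := fun _ : List α => ρ)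
    (f := fun v => u ++ v) (List.append_right_injective u)

/-- The many-to-one formula for multiplicative functionals: sums of products of weights along the
words of length `n` grow, in mean, exactly like `κ ^ n` with `κ = ∫ ∑_a V_a`. -/
lemma lintegral_wsum_wt {V : (α → ℝ≥0) → α → ℝ≥0∞} (hV : ∀ a, Measurable fun w => V w a)
    {Φ : (List α → α → ℝ≥0) → ℝ≥0∞} (hΦ : Measurable Φ) (n : ℕ) :
    ∫⁻ t, wsum n (fun u => wt V t u * Φ (sub t u)) ∂treeLaw ρ =
      (∫⁻ w, ∑ a, V w a ∂ρ) ^ n * ∫⁻ t, Φ t ∂treeLaw ρ := by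
  induction n with
  | zero => simp [wt]
  | succ n ih =>
    have hm : ∀ n, Measurable fun t : List α → α → ℝ≥0 => wsum n (fun u => wt V t u * Φ (sub t u)) :=
      fun n => measurable_wsum fun v => (measurable_wt hV v).mul (hΦ.comp (measurable_sub v))
    rw [lintegral_treeLaw ρ (hm _)]
    have : ∀ w, ∫⁻ s, wsum (n + 1) (fun u => wt V (node w s) u * Φ (sub (node w s) u))
        ∂(Measure.pi fun _ : α => treeLaw ρ) = (∑ a, V w a) *
        ∫⁻ t, wsum n (fun u => wt V t u * Φ (sub t u)) ∂treeLaw ρ := by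
      intro w
      simp only [wsum_succ, wt, node_nil, sub_node_cons, sub_nil, mul_assoc, ← mul_wsum]
      rw [lintegral_finsetSum, Finset.sum_mul]
      · refine Finset.sum_congr rfl fun a _ => ?_
        rw [← lintegral_pi_eval ρ (hm n) a]
        exact lintegral_const_mul _ ((hm n).comp (measurable_pi_apply a))
      · exact fun a _ => ((hm n).comp (measurable_pi_apply a)).const_mul _
    simp only [this]
    rw [lintegral_mul_const _ (Finset.measurable_fun_sum _ fun a _ => hV a), ih, pow_succ']
    ring

end Trees

/-! ### Growth rates and convergence of the total masses -/

section Convergence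

variable {α : Type*} [Fintype α] (ρ : Measure (α → ℝ≥0)) [IsProbabilityMeasure ρ]

/-- Almost surely, sums of products of weights grow at most at the exponential rate of their
means. -/
lemma eventually_wsum_wt_le {V : (α → ℝ≥0) → α → ℝ≥0∞} (hV : ∀ a, Measurable fun w => V w a)
    {Φ : (List α → α → ℝ≥0) → ℝ≥0∞} (hΦ : Measurable Φ) (hΦ1 : ∫⁻ t, Φ t ∂treeLaw ρ ≤ 1)
    {κ : ℝ≥0∞} (hκ : ∫⁻ w, ∑ a, V w a ∂ρ < κ) (hκ' : κ ≠ ∞) :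
    ∀ᵐ t ∂treeLaw ρ, ∀ᶠ n in atTop, wsum n (fun u => wt V t u * Φ (sub t u)) ≤ κ ^ n := by
  have hκ0 : κ ≠ 0 := (bot_le.trans_lt hκ).ne'
  have hm : ∀ n, Measurable fun t : List α → α → ℝ≥0 => wsum n (fun u => wt V t u * Φ (sub t u)) :=
    fun n => measurable_wsum fun v => (measurable_wt hV v).mul (hΦ.comp (measurable_sub v))
  set k := ∫⁻ w, ∑ a, V w a ∂ρ
  have hlt : k / κ < 1 := by
    rw [ENNReal.div_lt_iff (Or.inl hκ0) (Or.inl hκ')]; simpa using hκ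
  have h1 : ∫⁻ t, ∑' n, wsum n (fun u => wt V t u * Φ (sub t u)) / κ ^ n ∂treeLaw ρ ≠ ∞ := by
    rw [lintegral_tsum fun n => ((hm n).div_const _).aemeasurable]
    have : ∀ n, ∫⁻ t, wsum n (fun u => wt V t u * Φ (sub t u)) / κ ^ n ∂treeLaw ρ ≤ (k / κ) ^ n := by
      intro n
      simp only [div_eq_mul_inv]
      rw [lintegral_mul_const _ (hm n), lintegral_wsum_wt ρ hV hΦ n, mul_pow, ENNReal.inv_pow]
      gcongr
      exact mul_le_of_le_one_right' hΦ1
    refine ne_top_of_le_ne_top ?_ (ENNReal.tsum_le_tsum this)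
    rw [ENNReal.tsum_geometric]
    exact ENNReal.inv_ne_top.2 (tsub_pos_iff_lt.2 hlt).ne'
  filter_upwards [ae_lt_top (Measurable.tsum fun n => (hm n).div_const _) h1] with t ht
  have := ENNReal.tendsto_atTop_zero_of_tsum_ne_top ht.ne
  filter_upwards [this.eventually_le_const (show (0 : ℝ≥0∞) < 1 by simp)] with n hn
  rwa [ENNReal.div_le_iff (pow_ne_zero _ hκ0) (ENNReal.pow_ne_top hκ'), one_mul] at hn

/-- The filtration of the generations of the tree. -/
def treeFiltration : Filtration ℕ (inferInstance : MeasurableSpace (List α → α → ℝ≥0)) where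
  seq n := ⨆ v ∈ {v : List α | v.length < n},
    MeasurableSpace.comap (fun t : List α → α → ℝ≥0 => t v) inferInstance
  mono' i _ hij := biSup_mono fun v (hv : v.length < i) => hv.trans_le hij
  le' _ := iSup₂_le fun v _ => (measurable_pi_apply v).comap_le

lemma measurable_Qt_filtration {n : ℕ} (u v : List α) (h : u.length + v.length ≤ n) :
    Measurable[treeFiltration (α := α) n] fun t : List α → α → ℝ≥0 => Qt (sub t u) v := by
  induction v generalizing u with
  | nil => exact @measurable_const _ _ _ (treeFiltration n) _
  | cons a v ih =>
    have h1 : Measurable[treeFiltration (α := α) n] fun t : List α → α → ℝ≥0 => t u := by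
      refine Measurable.mono (comap_measurable fun t : List α → α → ℝ≥0 => t u) ?_ le_rfl
      exact le_biSup (fun v => MeasurableSpace.comap (fun t : List α → α → ℝ≥0 => t v) inferInstance)
        (show u ∈ {v : List α | v.length < n} by simp at h ⊢; omega)
    have h2 := ih (u ++ [a]) (by simp at h ⊢; omega)
    have h3 : Measurable fun w : α → ℝ≥0 => (w a : ℝ≥0∞) := by fun_prop
    simp only [Qt, wt, sub_sub] at h2 ⊢
    have h4 := h3.comp h1
    simp only [sub, List.append_nil] at h4 ⊢
    exact @Measurable.mul _ _ _ _ _ _ _ _ h4 h2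

/-- One step of the martingale property: the weights at a node of generation `n` are independent of the
earlier generations. -/
lemma setLIntegral_Yn_succ (hρ : ∫⁻ w, ∑ a, (w a : ℝ≥0∞) ∂ρ = 1) (n : ℕ)
    {s : Set (List α → α → ℝ≥0)} (hs : MeasurableSet[treeFiltration (α := α) n] s) :
    ∫⁻ t in s, Yn t [] (n + 1) ∂treeLaw ρ = ∫⁻ t in s, Yn t [] n ∂treeLaw ρ := by
  have hs' := (treeFiltration (α := α)).le n s hs
  simp only [Yn_eq, sub_nil, wsum_add n 1, wsum_succ, wsum_zero]
  rw [lintegral_wsum, lintegral_wsum]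
  rotate_left
  · exact fun v => measurable_Qt v
  · exact fun v => Finset.measurable_fun_sum _ fun a _ => measurable_Qt _
  refine wsum_congr fun u hu => ?_
  have hsplit : ∀ t : List α → α → ℝ≥0, ∑ a, Qt t (u ++ [a]) = Qt t u * ∑ a, (t u a : ℝ≥0∞) := by
    intro t
    rw [Finset.mul_sum]
    refine Finset.sum_congr rfl fun a _ => ?_
    rw [Qt, wt_append]; simp [wt, sub]
  simp only [hsplit]
  rw [← lintegral_indicator hs', ← lintegral_indicator hs']
  have hind : Indep (treeFiltration (α := α) n)
      (MeasurableSpace.comap (fun t : List α → α → ℝ≥0 => t u) inferInstance) (treeLaw ρ) := by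
    have h1 : iIndepFun (fun (v : List α) (t : List α → α → ℝ≥0) => t v) (treeLaw ρ) :=
      iIndepFun_infinitePi (P := fun _ : List α => ρ) (X := fun _ x => x) (fun _ => measurable_id)
    have h2 := indep_iSup_of_disjoint (fun v => (measurable_pi_apply v).comap_le) h1
      (S := {v : List α | v.length < n}) (T := {u}) (by
        rw [Set.disjoint_singleton_right]; simp [hu])
    simpa [treeFiltration] using h2
  have hf : Measurable[treeFiltration (α := α) n] (s.indicator fun t => Qt t u) := by
    refine @Measurable.indicator _ _ _ _ (treeFiltration n) _ _ ?_ hs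
    simpa using measurable_Qt_filtration (n := n) [] u (by simp [hu])
  have hg : Measurable[MeasurableSpace.comap (fun t : List α → α → ℝ≥0 => t u) inferInstance]
      fun t => ∑ a, (t u a : ℝ≥0∞) := by
    have h3 : Measurable fun w : α → ℝ≥0 => ∑ a, (w a : ℝ≥0∞) := by fun_prop
    exact h3.comp (comap_measurable _)
  have := lintegral_mul_eq_lintegral_mul_lintegral_of_independent_measurableSpace
    ((treeFiltration (α := α)).le n) (measurable_pi_apply u).comap_le hind hf hg
  have h5 : ∫⁻ t : List α → α → ℝ≥0, ∑ a, (t u a : ℝ≥0∞) ∂treeLaw ρ = 1 := by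
    have h3 : Measurable fun w : α → ℝ≥0 => ∑ a, (w a : ℝ≥0∞) := by fun_prop
    rw [← hρ]
    exact (measurePreserving_eval_infinitePi (fun _ : List α => ρ) u).lintegral_comp h3
  rw [h5, mul_one] at this
  rw [← this]
  refine lintegral_congr fun t => ?_
  by_cases ht : t ∈ s <;> simp [ht]

lemma lintegral_Yn (hρ : ∫⁻ w, ∑ a, (w a : ℝ≥0∞) ∂ρ = 1) (n : ℕ) :
    ∫⁻ t, Yn t [] n ∂treeLaw ρ = 1 := by
  have := lintegral_wsum_wt ρ (V := fun w a => (w a : ℝ≥0∞)) (fun a => by fun_prop)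
    (Φ := fun _ => 1) measurable_const n
  simpa [Yn_eq, hρ, Qt] using this

lemma Yn_ne_top (t : List α → α → ℝ≥0) (u : List α) (n : ℕ) : Yn t u n ≠ ∞ := by
  simp [Yn]

/-- The masses below every node converge to finite limits. -/
def Regular (t : List α → α → ℝ≥0) : Prop :=
  ∀ u, Tendsto (Yn t u) atTop (𝓝 (Y t u)) ∧ Y t u ≠ ∞

/-- The martingale convergence theorem at the root, transported to every node by `map_sub`. -/
lemma ae_regular (hρ : ∫⁻ w, ∑ a, (w a : ℝ≥0∞) ∂ρ = 1) : ∀ᵐ t ∂treeLaw ρ, Regular t := by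
  have hint : ∀ n, Integrable (fun t : List α → α → ℝ≥0 => (Yn t [] n).toReal) (treeLaw ρ) :=
    fun n => integrable_toReal_of_lintegral_ne_top (measurable_Yn [] n).aemeasurable
      (by rw [lintegral_Yn ρ hρ]; simp)
  have hadapt : ∀ n, StronglyMeasurable[treeFiltration (α := α) n]
      fun t : List α → α → ℝ≥0 => (Yn t [] n).toReal := by
    intro n
    refine Measurable.stronglyMeasurable ?_
    refine ENNReal.measurable_toReal.comp ?_
    simp only [Yn_eq, sub_nil, wsum]
    refine Finset.measurable_fun_sum _ fun v _ => ?_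
    simpa using measurable_Qt_filtration (n := n) [] (List.ofFn v) (by simp)
  have hmart : Martingale (fun n (t : List α → α → ℝ≥0) => (Yn t [] n).toReal) treeFiltration
      (treeLaw ρ) := by
    refine martingale_nat hadapt hint fun n => ?_
    refine ae_eq_condExp_of_forall_setIntegral_eq ((treeFiltration (α := α)).le n) (hint (n + 1))
      (fun s _ _ => (hint n).integrableOn) ?_ (hadapt n).aestronglyMeasurable
    intro s hs _
    rw [integral_toReal (measurable_Yn [] n).aemeasurable (.of_forall fun t => (Yn_ne_top t _ _).lt_top),
      integral_toReal (measurable_Yn [] _).aemeasurable (.of_forall fun t => (Yn_ne_top t _ _).lt_top),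
      setLIntegral_Yn_succ ρ hρ n hs]
  have hbdd : ∀ n, eLpNorm (fun t : List α → α → ℝ≥0 => (Yn t [] n).toReal) 1 (treeLaw ρ)
      ≤ (1 : ℝ≥0) := by
    intro n
    rw [eLpNorm_one_eq_lintegral_enorm, ENNReal.coe_one, ← lintegral_Yn ρ hρ n]
    refine lintegral_mono fun t => ?_
    rw [Real.enorm_eq_ofReal ENNReal.toReal_nonneg, ENNReal.ofReal_toReal (Yn_ne_top _ _ _)]
  have hroot : ∀ᵐ t ∂treeLaw ρ, Tendsto (Yn t []) atTop (𝓝 (Y t [])) ∧ Y t [] ≠ ∞ := by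
    filter_upwards [hmart.submartingale.exists_ae_tendsto_of_bdd hbdd] with t ⟨c, hc⟩
    have h1 : Tendsto (Yn t []) atTop (𝓝 (ENNReal.ofReal c)) := by
      refine (ENNReal.tendsto_ofReal hc).congr fun n => ?_
      rw [ENNReal.ofReal_toReal (Yn_ne_top _ _ _)]
    have h2 : Y t [] = ENNReal.ofReal c := h1.limsup_eq
    rw [h2]; exact ⟨h1, ENNReal.ofReal_ne_top⟩
  refine ae_all_iff.2 fun u => ?_
  have h3 := hroot
  rw [← map_sub ρ u] at h3
  have h4 := ae_of_ae_map (measurable_sub u).aemeasurable h3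
  filter_upwards [h4] with t ht
  rw [Y_eq_sub]
  refine ⟨ht.1.congr fun n => ?_, ht.2⟩
  simp [Yn_eq]

/-- By Fatou's lemma, the limit mass has mean at most `1`. -/
lemma lintegral_Y_le (hρ : ∫⁻ w, ∑ a, (w a : ℝ≥0∞) ∂ρ = 1) : ∫⁻ t, Y t [] ∂treeLaw ρ ≤ 1 := by
  calc ∫⁻ t, Y t [] ∂treeLaw ρ = ∫⁻ t, liminf (Yn t []) atTop ∂treeLaw ρ := by
        refine lintegral_congr_ae ?_
        filter_upwards [ae_regular ρ hρ] with t ht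
        exact (ht []).1.liminf_eq.symm
    _ ≤ liminf (fun n => ∫⁻ t, Yn t [] n ∂treeLaw ρ) atTop :=
        lintegral_liminf_le fun n => measurable_Yn [] n
    _ = 1 := by simp [lintegral_Yn ρ hρ]

lemma Yn_succ (t : List α → α → ℝ≥0) (u : List α) (n : ℕ) :
    Yn t u (n + 1) = ∑ a, (t u a : ℝ≥0∞) * Yn t (u ++ [a]) n := by
  simp only [Yn_eq, wsum_succ, mul_wsum, wt, sub_sub]
  simp [sub]

lemma Regular.Y_eq {t : List α → α → ℝ≥0} (h : Regular t) (u : List α) :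
    Y t u = ∑ a, (t u a : ℝ≥0∞) * Y t (u ++ [a]) := by
  refine tendsto_nhds_unique ((tendsto_add_atTop_iff_nat 1).2 (h u).1) ?_
  simp only [Yn_succ]
  exact tendsto_finsetSum _ fun a _ => ENNReal.Tendsto.const_mul (h _).1 (Or.inr (by simp))

lemma Regular.mass_eq {t : List α → α → ℝ≥0} (h : Regular t) (u : List α) :
    Qt t u * Y t u = ∑ a, Qt t (u ++ [a]) * Y t (u ++ [a]) := by
  rw [h.Y_eq u, Finset.mul_sum]
  refine Finset.sum_congr rfl fun a _ => ?_
  rw [Qt, wt_append]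
  simp [wt, sub, mul_assoc]

end Convergence

/-! ### Measures with given masses of cylinders -/

section Extension

variable {α : Type*}

/-- The prefixes of the infinite word obtained by following, from each finite word `u`, the letter
`ξ u`. -/
def follow (ξ : List α → α) : ℕ → List α
  | 0 => []
  | n + 1 => follow ξ n ++ [ξ (follow ξ n)]

lemma pre_follow (ξ : List α → α) (n : ℕ) : pre (fun k => ξ (follow ξ k)) n = follow ξ n := by
  induction n with
  | zero => simp [pre, follow]
  | succ n ih => rw [pre_succ, ih]; rfl

lemma cyl_nil : cyl ([] : List α) = Set.univ := by ext; simp [cyl, pre]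

variable [Fintype α] [MeasurableSpace α] [MeasurableSingletonClass α]

lemma measurable_pre (n : ℕ) (u : List α) : MeasurableSet {x : ℕ → α | pre x n = u} := by
  have : {x : ℕ → α | pre x n = u} =
      (fun x : ℕ → α => fun i : Fin n => x i) ⁻¹' {y | List.ofFn y = u} := rfl
  rw [this]
  exact measurableSet_preimage (by fun_prop) (Set.toFinite _).measurableSet

lemma measurableSet_cyl (u : List α) : MeasurableSet (cyl u) := measurable_pre _ _

lemma measurableSet_follow (n : ℕ) (u : List α) :
    MeasurableSet {ξ : List α → α | follow ξ n = u} := by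
  induction n generalizing u with
  | zero => by_cases h : [] = u <;> simp [follow, h]
  | succ n ih =>
    have : {ξ : List α → α | follow ξ (n + 1) = u} =
        ⋃ v : List α, {ξ | follow ξ n = v} ∩ ((fun ξ => ξ v) ⁻¹' {a | v ++ [a] = u}) := by
      ext ξ; simp [follow]
    rw [this]
    exact .iUnion fun v => (ih v).inter
      (measurableSet_preimage (measurable_pi_apply v) (Set.toFinite _).measurableSet)

lemma measurable_follow : Measurable fun (ξ : List α → α) (k : ℕ) => ξ (follow ξ k) := by
  refine measurable_pi_iff.2 fun k => measurable_to_countable' fun a => ?_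
  have : (fun ξ : List α → α => ξ (follow ξ k)) ⁻¹' {a} =
      ⋃ v : List α, {ξ | follow ξ k = v} ∩ ((fun ξ => ξ v) ⁻¹' {a}) := by
    ext ξ; simp
  rw [this]
  exact .iUnion fun v => (measurableSet_follow k v).inter
    (measurableSet_preimage (measurable_pi_apply v) (measurableSet_singleton a))

/-- Consistent masses of the cylinders extend to a finite measure: it is the law of the word
obtained by choosing, independently at every node `u`, a letter with the conditional probabilities
`m (u a) / m u`. -/
lemma exists_measure_cyl (m : List α → ℝ≥0∞) (h0 : m [] ≠ ∞) (hm : ∀ u, m u = ∑ a, m (u ++ [a])) :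
    ∃ μ : Measure (ℕ → α), IsFiniteMeasure μ ∧ ∀ u, μ (cyl u) = m u := by
  classical
  have hle : ∀ u, m u ≤ m [] := by
    intro u
    induction u using List.reverseRecOn with
    | nil => rfl
    | append_singleton u a ih =>
      refine le_trans ?_ ih
      rw [hm u]
      exact Finset.single_le_sum (f := fun a => m (u ++ [a])) (fun _ _ => zero_le) (Finset.mem_univ a)
  by_cases hz : m [] = 0
  · refine ⟨0, inferInstance, fun u => ?_⟩
    have := hle u
    rw [hz] at this
    simp [le_antisymm this zero_le]
  have hne : Nonempty α := by
    by_contra h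
    rw [not_nonempty_iff] at h
    exact hz (by rw [hm]; simp)
  have hfin : ∀ u, m u ≠ ∞ := fun u => ne_top_of_le_ne_top h0 (hle u)
  let κ : List α → Measure α := fun u => if m u = 0 then Measure.dirac (Classical.arbitrary α) else
    ∑ a, (m (u ++ [a]) / m u) • Measure.dirac a
  have hκ1 : ∀ u, m u ≠ 0 → ∀ a, κ u {a} = m (u ++ [a]) / m u := by
    intro u hu a
    simp only [κ, hu, if_false, Measure.coe_finsetSum, Finset.sum_apply, Measure.smul_apply,
      smul_eq_mul, Measure.dirac_apply' _ (measurableSet_singleton a)]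
    rw [Finset.sum_eq_single a]
    · simp
    · intro b _ hb; simp [hb]
    · simp
  have hκ2 : ∀ u, IsProbabilityMeasure (κ u) := by
    intro u
    by_cases hu : m u = 0
    · simp only [κ, hu, if_true]; infer_instance
    · refine ⟨?_⟩
      simp only [κ, hu, if_false, Measure.coe_finsetSum, Finset.sum_apply, Measure.smul_apply,
        smul_eq_mul, measure_univ, mul_one, div_eq_mul_inv]
      rw [← Finset.sum_mul, ← hm u, ENNReal.mul_inv_cancel hu (hfin u)]
  -- following the choices leads to `u` when finitely many of them, at the proper prefixes of `u`, are
  -- prescribed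
  have key : ∀ u : List α, ∃ s : Finset (List α), ∃ t : List α → Set α,
      (∀ v ∈ s, v.length < u.length) ∧ (∀ v, MeasurableSet (t v)) ∧
      {ξ : List α → α | follow ξ u.length = u} = Set.pi s t ∧
      m [] * ∏ v ∈ s, κ v (t v) = m u := by
    intro u
    induction u using List.reverseRecOn with
    | nil => exact ⟨∅, fun _ => Set.univ, by simp, by simp, by simp [follow], by simp⟩
    | append_singleton u a ih =>
      obtain ⟨s, t, h1, h2, h3, h4⟩ := ih
      have hus : u ∉ s := fun h => lt_irrefl _ (h1 u h)
      refine ⟨insert u s, Function.update t u {a}, ?_, ?_, ?_, ?_⟩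
      · intro v hv
        rcases Finset.mem_insert.1 hv with rfl | hv
        · simp
        · have := h1 v hv; simp; omega
      · intro v
        by_cases hv : v = u
        · subst hv; simp
        · simpa [hv] using h2 v
      · have e1 : Set.pi ((insert u s : Finset (List α)) : Set (List α)) (Function.update t u {a}) =
            {ξ | ξ u = a} ∩ Set.pi s t := by
          rw [Finset.coe_insert, Set.insert_pi]
          congr 1
          · ext; simp
          · refine Set.pi_congr rfl fun v hv => ?_
            have : v ≠ u := fun h => hus (h ▸ hv)
            simp [this]
        rw [e1, ← h3]
        ext ξ
        simp only [List.length_append, List.length_singleton, follow, Set.mem_ofPred_eq,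
          Set.mem_inter_iff]
        constructor
        · intro h
          have := List.append_inj' h rfl
          refine ⟨?_, this.1⟩
          have h2 := this.2
          rw [this.1] at h2
          simpa using h2
        · rintro ⟨h, h'⟩
          rw [h', h]
      · rw [Finset.prod_insert hus, Function.update_self]
        have : ∏ v ∈ s, κ v (Function.update t u {a} v) = ∏ v ∈ s, κ v (t v) := by
          refine Finset.prod_congr rfl fun v hv => ?_
          have : v ≠ u := fun h => hus (h ▸ hv)
          simp [this]
        rw [this, mul_left_comm, h4]
        by_cases hu : m u = 0
        · have : m (u ++ [a]) ≤ m u := by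
            rw [hm u]
            exact Finset.single_le_sum (f := fun a => m (u ++ [a])) (fun _ _ => zero_le)
              (Finset.mem_univ a)
          rw [hu] at this ⊢
          simp [le_antisymm this zero_le]
        · rw [hκ1 u hu, ENNReal.div_mul_cancel hu (hfin u)]
  refine ⟨m [] • (Measure.infinitePi κ).map fun ξ k => ξ (follow ξ k), ?_, fun u => ?_⟩
  · have : IsProbabilityMeasure ((Measure.infinitePi κ).map fun ξ k => ξ (follow ξ k)) :=
      Measure.isProbabilityMeasure_map measurable_follow.aemeasurable
    exact ⟨by simpa using h0.lt_top⟩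
  · obtain ⟨s, t, h1, h2, h3, h4⟩ := key u
    rw [Measure.smul_apply, Measure.map_apply measurable_follow (measurableSet_cyl u)]
    have : (fun (ξ : List α → α) (k : ℕ) => ξ (follow ξ k)) ⁻¹' cyl u =
        {ξ | follow ξ u.length = u} := by
      ext ξ; simp [cyl, pre_follow]
    rw [this, h3, Measure.infinitePi_pi _ fun v _ => h2 v, smul_eq_mul, h4]

lemma Regular.mandelbrotMeasure_spec {t : List α → α → ℝ≥0} (h : Regular t) :
    IsFiniteMeasure (mandelbrotMeasure t) ∧
      ∀ u, mandelbrotMeasure t (cyl u) = Qt t u * Y t u := by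
  have : ∃ μ : Measure (ℕ → α), IsFiniteMeasure μ ∧ ∀ u, μ (cyl u) = Q t [] u * Y t u := by
    simp only [← Qt_eq]
    refine exists_measure_cyl (fun u => Qt t u * Y t u) ?_ h.mass_eq
    simpa [wt] using (h []).2
  simp only [Qt_eq]
  rw [mandelbrotMeasure, dif_pos this]
  exact this.choose_spec

end Extension

open scoped Classical

/-! ### Gibbs' inequality -/

section Gibbs

lemma negMulLog_le_of_pos {p r : ℝ} (hp : 0 ≤ p) (hr : 0 < r) :
    Real.negMulLog p ≤ -(p * Real.log r) + r - p := by
  rcases hp.eq_or_lt with rfl | hp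
  · simp [Real.negMulLog, hr.le]
  · have h := Real.log_le_sub_one_of_pos (div_pos hr hp)
    rw [Real.log_div hr.ne' hp.ne'] at h
    have h2 : p * (Real.log r - Real.log p) ≤ p * (r / p - 1) := mul_le_mul_of_nonneg_left h hp.le
    have h3 : p * (r / p - 1) = r - p := by field_simp
    rw [Real.negMulLog]; linarith

lemma eq_of_negMulLog_eq {p r : ℝ} (hp : 0 ≤ p) (hr : 0 < r)
    (h : Real.negMulLog p = -(p * Real.log r) + r - p) : p = r := by
  rcases hp.eq_or_lt with rfl | hp
  · simp [Real.negMulLog] at h; linarith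
  · by_contra hne
    have hne' : r / p ≠ 1 := by
      rw [Ne, div_eq_one_iff_eq hp.ne']; exact fun h => hne h.symm
    have h' := Real.log_lt_sub_one_of_pos (div_pos hr hp) hne'
    rw [Real.log_div hr.ne' hp.ne'] at h'
    have h2 : p * (Real.log r - Real.log p) < p * (r / p - 1) := mul_lt_mul_of_pos_left h' hp
    have h3 : p * (r / p - 1) = r - p := by field_simp
    rw [Real.negMulLog] at h; linarith

variable {ι : Type*}

/-- Gibbs' inequality for unnormalised comparison weights. -/
lemma sum_negMulLog_le {s : Finset ι} {p r : ι → ℝ} (hp : ∀ i ∈ s, 0 ≤ p i)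
    (hp1 : ∑ i ∈ s, p i = 1) (hr : ∀ i ∈ s, 0 < r i) :
    ∑ i ∈ s, Real.negMulLog (p i) ≤ -∑ i ∈ s, p i * Real.log (r i) + Real.log (∑ i ∈ s, r i) := by
  have hne : s.Nonempty := by
    by_contra h
    rw [Finset.not_nonempty_iff_eq_empty] at h
    simp [h] at hp1
  set R := ∑ i ∈ s, r i
  have hR : 0 < R := Finset.sum_pos hr hne
  have h1 : ∀ i ∈ s, Real.negMulLog (p i) ≤
      -(p i * Real.log (r i)) + p i * Real.log R + r i / R - p i := by
    intro i hi
    have := negMulLog_le_of_pos (hp i hi) (div_pos (hr i hi) hR)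
    rw [Real.log_div (hr i hi).ne' hR.ne'] at this
    linarith
  refine (Finset.sum_le_sum h1).trans ?_
  rw [Finset.sum_sub_distrib, Finset.sum_add_distrib, Finset.sum_add_distrib, ← Finset.sum_mul, hp1,
    ← Finset.sum_div, div_self hR.ne', Finset.sum_neg_distrib]
  linarith

/-- Gibbs' inequality for two probability vectors, with its equality case. -/
lemma sum_negMulLog_le_of_sum_eq_one [Fintype ι] {p r : ι → ℝ} (hp : ∀ i, 0 ≤ p i)
    (hr : ∀ i, 0 ≤ r i) (hp1 : ∑ i, p i = 1) (hr1 : ∑ i, r i = 1) (hpr : ∀ i, r i = 0 → p i = 0) :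
    ∑ i, Real.negMulLog (p i) ≤ -∑ i, p i * Real.log (r i) ∧
      (∑ i, Real.negMulLog (p i) = -∑ i, p i * Real.log (r i) → p = r) := by
  have h1 : ∀ i, Real.negMulLog (p i) ≤ -(p i * Real.log (r i)) + r i - p i := by
    intro i
    rcases (hr i).eq_or_lt with h | h
    · simp [hpr i h.symm, ← h]
    · exact negMulLog_le_of_pos (hp i) h
  have h2 : ∑ i, (-(p i * Real.log (r i)) + r i - p i) = -∑ i, p i * Real.log (r i) := by
    rw [Finset.sum_sub_distrib, Finset.sum_add_distrib, hp1, hr1, Finset.sum_neg_distrib]; ring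
  refine ⟨h2 ▸ Finset.sum_le_sum fun i _ => h1 i, fun h => funext fun i => ?_⟩
  rw [← h2] at h
  have h3 := (Finset.sum_eq_sum_iff_of_le fun i _ => h1 i).1 h i (Finset.mem_univ i)
  rcases (hr i).eq_or_lt with h | h
  · rw [hpr i h.symm, ← h]
  · exact eq_of_negMulLog_eq (hp i) h h3

/-- Jensen's inequality for the exponential. -/
lemma sum_mul_le_log_sum_mul_exp {s : Finset ι} {p x : ι → ℝ} (hp : ∀ i ∈ s, 0 ≤ p i)
    (hp1 : ∑ i ∈ s, p i = 1) :
    ∑ i ∈ s, p i * x i ≤ Real.log (∑ i ∈ s, p i * Real.exp (x i)) := by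
  set R := ∑ i ∈ s, p i * Real.exp (x i) with hRdef
  have hR : 0 < R := by
    have h0 : ∃ i ∈ s, 0 < p i := by
      by_contra! h
      have : ∑ i ∈ s, p i ≤ 0 := Finset.sum_nonpos h
      linarith
    exact Finset.sum_pos' (fun i hi => mul_nonneg (hp i hi) (Real.exp_pos _).le)
      (h0.imp fun i hi => ⟨hi.1, mul_pos hi.2 (Real.exp_pos _)⟩)
  have h1 : ∀ i ∈ s, p i * (x i - Real.log R + 1) ≤ p i * Real.exp (x i) / R := by
    intro i hi
    rw [mul_div_assoc]
    refine mul_le_mul_of_nonneg_left ?_ (hp i hi)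
    have := Real.add_one_le_exp (x i - Real.log R)
    rwa [Real.exp_sub, Real.exp_log hR] at this
  have h2 := Finset.sum_le_sum h1
  rw [← Finset.sum_div, ← hRdef, div_self hR.ne'] at h2
  have h3 : ∑ i ∈ s, p i * (x i - Real.log R + 1) = ∑ i ∈ s, p i * x i - Real.log R + 1 := by
    calc _ = ∑ i ∈ s, (p i * x i + p i * (1 - Real.log R)) :=
          Finset.sum_congr rfl fun i _ => by ring
      _ = _ := by rw [Finset.sum_add_distrib, ← Finset.sum_mul, hp1]; ring
  linarith

/-- Entropy does not increase when atoms are merged. -/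
lemma negMulLog_sum_le {s : Finset ι} {p : ι → ℝ} (hp : ∀ i ∈ s, 0 ≤ p i) :
    Real.negMulLog (∑ i ∈ s, p i) ≤ ∑ i ∈ s, Real.negMulLog (p i) := by
  rw [Real.negMulLog, ← Finset.sum_neg_distrib, Finset.sum_mul]
  refine Finset.sum_le_sum fun i hi => ?_
  rw [Real.negMulLog]
  rcases (hp i hi).eq_or_lt with h | h
  · simp [← h]
  · have : Real.log (p i) ≤ Real.log (∑ i ∈ s, p i) :=
      Real.log_le_log h (Finset.single_le_sum hp hi)
    nlinarith

end Gibbs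

/-! ### Entropy of the generations of a Mandelbrot measure -/

section BlockEntropy

variable {α β : Type*} [Fintype α] [Fintype β]

/-- The normalised mass of the cylinder of `u`. -/
def prob (t : List α → α → ℝ≥0) (u : List α) : ℝ := (Qt t u * Y t u / Y t []).toReal

/-- The normalised mass of the cylinder of the word `w` for the projection by the letter map `f`. -/
def projProb (f : α → β) (n : ℕ) (t : List α → α → ℝ≥0) (w : List β) : ℝ :=
  wsum n fun u => if u.map f = w then prob t u else 0

/-- The entropy of the projection by `f` of the partition into cylinders of generation `n`. -/
def projEntropy (f : α → β) (n : ℕ) (t : List α → α → ℝ≥0) : ℝ :=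
  wsum n fun w => Real.negMulLog (projProb f n t w)

lemma prob_nonneg (t : List α → α → ℝ≥0) (u : List α) : 0 ≤ prob t u := ENNReal.toReal_nonneg

lemma projProb_nonneg (f : α → β) (n : ℕ) (t : List α → α → ℝ≥0) (w : List β) :
    0 ≤ projProb f n t w :=
  Finset.sum_nonneg fun u _ => by dsimp only; split_ifs <;> simp [prob_nonneg]

lemma wsum_fiber {M : Type*} [AddCommMonoid M] (f : α → β) (n : ℕ) (g : List α → M) :
    wsum n (fun w : List β => wsum n fun u => if u.map f = w then g u else 0) = wsum n g := by
  unfold wsum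
  rw [Finset.sum_comm]
  refine Finset.sum_congr rfl fun u _ => ?_
  rw [Finset.sum_eq_single (f ∘ u)]
  · simp [List.map_ofFn]
  · intro w _ hw
    dsimp only
    rw [if_neg]
    intro h
    rw [List.map_ofFn] at h
    exact hw (List.ofFn_injective h).symm
  · simp

lemma wsum_projProb_mul (f : α → β) (n : ℕ) (t : List α → α → ℝ≥0) (g : List β → ℝ) :
    wsum n (fun w => projProb f n t w * g w) = wsum n fun u => prob t u * g (u.map f) := by
  rw [← wsum_fiber f n (fun u => prob t u * g (u.map f))]
  refine wsum_congr fun w _ => ?_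
  rw [projProb, wsum_mul]
  refine wsum_congr fun u _ => ?_
  split_ifs with h
  · rw [h]
  · simp

lemma Regular.wsum_mass {t : List α → α → ℝ≥0} (h : Regular t) (n : ℕ) :
    wsum n (fun u => Qt t u * Y t u) = Y t [] := by
  induction n with
  | zero => simp [wt]
  | succ n ih =>
    rw [wsum_add n 1, ← ih]
    refine wsum_congr fun u _ => ?_
    rw [wsum_succ]; simp only [wsum_zero]
    exact (h.mass_eq u).symm

lemma Regular.mass_ne_top {t : List α → α → ℝ≥0} (h : Regular t) (u : List α) :
    Qt t u * Y t u ≠ ∞ := by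
  refine ENNReal.mul_ne_top ?_ (h u).2
  rw [Qt_eq]; simp

variable {t : List α → α → ℝ≥0} (h : Regular t) (hY : Y t [] ≠ 0)
include h hY

lemma Regular.wsum_prob (n : ℕ) : wsum n (prob t) = 1 := by
  have h1 := h.wsum_mass n
  have h2 : wsum n (fun u => Qt t u * Y t u / Y t []) = 1 := by
    simp only [div_eq_mul_inv]
    rw [← wsum_mul, h1, ENNReal.mul_inv_cancel hY (h []).2]
  have h3 : (wsum n (fun u => Qt t u * Y t u / Y t [])).toReal = wsum n (prob t) := by
    unfold wsum prob
    rw [ENNReal.toReal_sum]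
    exact fun u _ => ENNReal.div_ne_top (h.mass_ne_top _) hY
  rw [← h3, h2]; simp

lemma Regular.wsum_projProb (f : α → β) (n : ℕ) : wsum n (projProb f n t) = 1 := by
  have := wsum_projProb_mul f n t (fun _ => 1)
  simp only [mul_one] at this
  rw [this]; exact h.wsum_prob hY n

lemma Regular.projProb_le_one (f : α → β) {n : ℕ} {w : List β} (hw : w.length = n) :
    projProb f n t w ≤ 1 := by
  rw [← h.wsum_projProb hY f n]
  subst hw
  have := Finset.single_le_sum (f := fun v : Fin w.length → β => projProb f w.length t (List.ofFn v))
    (fun v _ => projProb_nonneg _ _ _ _) (Finset.mem_univ w.get)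
  simpa [wsum] using this

lemma Regular.projEntropy_nonneg (f : α → β) (n : ℕ) : 0 ≤ projEntropy f n t :=
  Finset.sum_nonneg fun _ _ => Real.negMulLog_nonneg (projProb_nonneg _ _ _ _)
    (h.projProb_le_one hY f (by simp))

lemma Regular.projEntropy_le (f : α → β) (n : ℕ) {r : List β → ℝ} (hr : ∀ w, 0 < r w) :
    projEntropy f n t ≤ -wsum n (fun u => prob t u * Real.log (r (u.map f))) +
      Real.log (wsum n r) := by
  rw [← wsum_projProb_mul f n t fun w => Real.log (r w)]
  exact sum_negMulLog_le (fun _ _ => projProb_nonneg _ _ _ _) (h.wsum_projProb hY f n)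
    fun _ _ => hr _

omit h hY in
lemma projEntropy_le_id (f : α → β) (n : ℕ) (t : List α → α → ℝ≥0) :
    projEntropy f n t ≤ projEntropy id n t := by
  have h1 : projEntropy id n t = wsum n fun u => Real.negMulLog (prob t u) := by
    refine wsum_congr fun u hu => ?_
    congr 1
    subst hu
    simp only [projProb, List.map_id, wsum]
    rw [Finset.sum_eq_single u.get]
    · simp
    · intro v _ hv
      rw [if_neg]
      intro hh
      refine hv (List.ofFn_injective ?_)
      rw [hh]; simp
    · simp
  rw [h1, ← wsum_fiber f n (fun u => Real.negMulLog (prob t u))]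
  refine Finset.sum_le_sum fun w _ => (negMulLog_sum_le fun u _ => ?_).trans
    (Finset.sum_le_sum fun u _ => ?_)
  · dsimp only; split_ifs <;> simp [prob_nonneg]
  · dsimp only; split_ifs <;> simp

end BlockEntropy

/-! ### Upper bounds for the entropy dimensions -/

section Upper

variable {α β : Type*} [Fintype α] [Fintype β]

/-- The sum of the values of `g` at the weights and letters met along the word `v`. -/
def gsum (g : (α → ℝ≥0) → α → ℝ) : (List α → α → ℝ≥0) → List α → ℝ
  | _, [] => 0
  | t, a :: v => g (t []) a + gsum g (sub t [a]) v

lemma wt_mul_exp (V : (α → ℝ≥0) → α → ℝ≥0∞) (g : (α → ℝ≥0) → α → ℝ) (t : List α → α → ℝ≥0)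
    (u : List α) : wt (fun w a => V w a * ENNReal.ofReal (Real.exp (g w a))) t u =
      wt V t u * ENNReal.ofReal (Real.exp (gsum g t u)) := by
  induction u generalizing t with
  | nil => simp [wt, gsum]
  | cons a u ih =>
    simp only [wt, gsum, ih, Real.exp_add]
    rw [ENNReal.ofReal_mul (Real.exp_pos _).le]
    ring

lemma wt_one (t : List α → α → ℝ≥0) (u : List α) : wt (fun _ _ => 1) t u = 1 := by
  induction u generalizing t with
  | nil => rfl
  | cons a u ih => simp [wt, ih]

lemma gsum_mul (c : ℝ) (g : (α → ℝ≥0) → α → ℝ) (t : List α → α → ℝ≥0) (u : List α) :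
    gsum (fun w a => c * g w a) t u = c * gsum g t u := by
  induction u generalizing t with
  | nil => simp [gsum]
  | cons a u ih => simp only [gsum, ih]; ring

variable (ρ : Measure (α → ℝ≥0)) [IsProbabilityMeasure ρ]

/-- The mean entropy `𝔼 ∑ -W_a log W_a` of weights of law `ρ`; it is the entropy dimension of the
Mandelbrot measures themselves, before projection. -/
def weightEntropy : ℝ := ∫ w, ∑ a, Real.negMulLog (w a) ∂ρ

/-- The mean weight of the letters sent to `b` by `f`. -/
def marginal (f : α → β) (b : β) : ℝ := ∫ w, ∑ a, (if f a = b then (w a : ℝ) else 0) ∂ρ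

variable (hρ : ∫⁻ w, ∑ a, (w a : ℝ≥0∞) ∂ρ = 1)
include hρ

lemma integrable_weight (a : α) : Integrable (fun w : α → ℝ≥0 => (w a : ℝ)) ρ := by
  have h1 : Integrable (fun w : α → ℝ≥0 => (w a : ℝ≥0∞).toReal) ρ := by
    refine integrable_toReal_of_lintegral_ne_top (Measurable.aemeasurable (by fun_prop)) ?_
    refine ne_top_of_le_ne_top ENNReal.one_ne_top (hρ ▸ lintegral_mono fun w => ?_)
    exact Finset.single_le_sum (f := fun a => (w a : ℝ≥0∞)) (fun _ _ => zero_le) (Finset.mem_univ a)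
  simpa using h1

lemma integral_sum_weight : ∫ w, ∑ a, (w a : ℝ) ∂ρ = 1 := by
  have : ∫ w : α → ℝ≥0, (∑ a, (w a : ℝ≥0∞)).toReal ∂ρ = 1 := by
    rw [integral_toReal (Measurable.aemeasurable (by fun_prop)) (.of_forall fun w => by simp [ENNReal.sum_lt_top]), hρ]
    simp
  rw [← this]
  refine integral_congr_ae (.of_forall fun w => ?_)
  dsimp only
  rw [ENNReal.toReal_sum (by simp)]; simp

lemma integrable_weight_mul {g : (α → ℝ≥0) → ℝ} (hg : Measurable g) {C : ℝ} (hC : ∀ w, |g w| ≤ C)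
    (a : α) : Integrable (fun w : α → ℝ≥0 => (w a : ℝ) * g w) ρ :=
  (integrable_weight ρ hρ a).mul_bdd hg.aestronglyMeasurable (.of_forall hC)

/-- The exponential moment of a bounded function under the weights, up to the second order. -/
lemma lintegral_weight_mul_exp_le {g : (α → ℝ≥0) → α → ℝ} (hg : ∀ a, Measurable fun w => g w a)
    {C τ : ℝ} (hC : ∀ w a, |g w a| ≤ C) (hτ : 0 ≤ τ) (hτC : τ * C ≤ 1) :
    ∫⁻ w, ∑ a, (w a : ℝ≥0∞) * ENNReal.ofReal (Real.exp (τ * g w a)) ∂ρ ≤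
      ENNReal.ofReal (Real.exp (τ * ∫ w, ∑ a, (w a : ℝ) * g w a ∂ρ + (τ * C) ^ 2)) := by
  have h1 : ∀ w : α → ℝ≥0, ∑ a, (w a : ℝ≥0∞) * ENNReal.ofReal (Real.exp (τ * g w a)) ≤
      ENNReal.ofReal (∑ a, ((w a : ℝ) * (1 + (τ * C) ^ 2) + τ * ((w a : ℝ) * g w a))) := by
    intro w
    have hle : ∀ a, Real.exp (τ * g w a) ≤ 1 + (τ * C) ^ 2 + τ * g w a := by
      intro a
      have h2 : |τ * g w a| ≤ τ * C := by
        rw [abs_mul, abs_of_nonneg hτ]; exact mul_le_mul_of_nonneg_left (hC w a) hτ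
      have h3 := Real.abs_exp_sub_one_sub_id_le (h2.trans hτC)
      have h4 : (τ * g w a) ^ 2 ≤ (τ * C) ^ 2 := sq_le_sq' (abs_le.1 h2).1 (abs_le.1 h2).2
      have := (abs_le.1 h3).2
      linarith
    rw [ENNReal.ofReal_sum_of_nonneg]
    · refine Finset.sum_le_sum fun a _ => ?_
      have : (w a : ℝ≥0∞) = ENNReal.ofReal (w a : ℝ) := by simp
      rw [this, ← ENNReal.ofReal_mul (by positivity)]
      refine ENNReal.ofReal_le_ofReal ?_
      calc (w a : ℝ) * Real.exp (τ * g w a) ≤ w a * (1 + (τ * C) ^ 2 + τ * g w a) :=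
            mul_le_mul_of_nonneg_left (hle a) (by positivity)
        _ = _ := by ring
    · intro a _
      have := (Real.exp_pos (τ * g w a)).le.trans (hle a)
      calc 0 ≤ (w a : ℝ) * (1 + (τ * C) ^ 2 + τ * g w a) := mul_nonneg (by positivity) this
        _ = _ := by ring
  have hi1 : ∀ a, Integrable (fun w : α → ℝ≥0 => (w a : ℝ) * (1 + (τ * C) ^ 2)) ρ :=
    fun a => (integrable_weight ρ hρ a).mul_const _
  have hi2 : ∀ a, Integrable (fun w : α → ℝ≥0 => τ * ((w a : ℝ) * g w a)) ρ :=
    fun a => (integrable_weight_mul ρ hρ (hg a) (fun w => hC w a) a).const_mul _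
  refine (lintegral_mono h1).trans ?_
  rw [← ofReal_integral_eq_lintegral_ofReal]
  · refine ENNReal.ofReal_le_ofReal ?_
    have h5 : ∫ w : α → ℝ≥0, ∑ a, ((w a : ℝ) * (1 + (τ * C) ^ 2) + τ * ((w a : ℝ) * g w a)) ∂ρ =
        1 + (τ * C) ^ 2 + τ * ∫ w, ∑ a, (w a : ℝ) * g w a ∂ρ := by
      simp only [Finset.sum_add_distrib, ← Finset.sum_mul, ← Finset.mul_sum]
      rw [integral_add, integral_mul_const, integral_sum_weight ρ hρ, integral_const_mul, one_mul]
      · exact (integrable_finsetSum _ fun a _ => integrable_weight ρ hρ a).mul_const _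
      · exact (integrable_finsetSum _ fun a _ =>
          integrable_weight_mul ρ hρ (hg a) (fun w => hC w a) a).const_mul _
    rw [h5]
    have := Real.add_one_le_exp (τ * ∫ w, ∑ a, (w a : ℝ) * g w a ∂ρ + (τ * C) ^ 2)
    linarith
  · exact integrable_finsetSum _ fun a _ => (hi1 a).add (hi2 a)
  · refine .of_forall fun w => Finset.sum_nonneg fun a _ => ?_
    have h2 : |τ * g w a| ≤ τ * C := by
      rw [abs_mul, abs_of_nonneg hτ]; exact mul_le_mul_of_nonneg_left (hC w a) hτ
    have h6 := (abs_le.1 h2).1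
    calc 0 ≤ (w a : ℝ) * (1 + (τ * C) ^ 2 + τ * g w a) :=
          mul_nonneg (by positivity) (by nlinarith [sq_nonneg (τ * C)])
      _ = _ := by ring

/-- An upper law of large numbers: the averages, with respect to the Mandelbrot measure, of the
sums of a bounded function of the weights are asymptotically at most their means. -/
lemma eventually_wsum_prob_mul_gsum_le {g : (α → ℝ≥0) → α → ℝ}
    (hg : ∀ a, Measurable fun w => g w a) {C : ℝ} (hC : ∀ w a, |g w a| ≤ C) {δ : ℝ} (hδ : 0 < δ) :
    ∀ᵐ t ∂treeLaw ρ, Y t [] ≠ 0 → ∀ᶠ n : ℕ in atTop,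
      wsum n (fun u => prob t u * gsum g t u) ≤ n * ((∫ w, ∑ a, (w a : ℝ) * g w a ∂ρ) + δ) := by
  set m := ∫ w, ∑ a, (w a : ℝ) * g w a ∂ρ
  wlog hC0 : 0 ≤ C generalizing C
  · exact this (C := max C 0) (fun w a => (hC w a).trans (le_max_left _ _)) (le_max_right _ _)
  -- for this `τ` the second order term `(τ * C) ^ 2` of the exponential moment is at most `τ * δ / 4`
  set τ := min (1 / (C + 1)) (δ / (4 * (C + 1) ^ 2)) with hτdef
  have hτ : 0 < τ := lt_min (by positivity) (by positivity)
  have hτ1 : τ * (C + 1) ≤ 1 := by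
    have := min_le_left (1 / (C + 1)) (δ / (4 * (C + 1) ^ 2))
    rw [← hτdef, le_div_iff₀ (by positivity)] at this
    exact this
  have hτ2 : τ * (C + 1) ^ 2 ≤ δ / 4 := by
    have := min_le_right (1 / (C + 1)) (δ / (4 * (C + 1) ^ 2))
    rw [← hτdef, le_div_iff₀ (by positivity)] at this
    linarith
  have hτC : τ * C ≤ 1 := by nlinarith
  have hlt : ∫⁻ w, ∑ a, (w a : ℝ≥0∞) * ENNReal.ofReal (Real.exp (τ * g w a)) ∂ρ <
      ENNReal.ofReal (Real.exp (τ * (m + δ / 2))) := by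
    refine (lintegral_weight_mul_exp_le ρ hρ hg hC hτ.le hτC).trans_lt ?_
    rw [ENNReal.ofReal_lt_ofReal_iff (Real.exp_pos _), Real.exp_lt_exp]
    have : (τ * C) ^ 2 ≤ τ * (δ / 4) := by
      calc (τ * C) ^ 2 = τ * (τ * C ^ 2) := by ring
        _ ≤ τ * (τ * (C + 1) ^ 2) := by gcongr; linarith
        _ ≤ τ * (δ / 4) := by gcongr
    have := mul_pos hτ hδ
    change τ * m + (τ * C) ^ 2 < _
    linarith
  have hgrow := eventually_wsum_wt_le ρ (V := fun w a => (w a : ℝ≥0∞) *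
    ENNReal.ofReal (Real.exp (τ * g w a))) (fun a => by have := hg a; fun_prop)
    (measurable_Y []) (lintegral_Y_le ρ hρ) hlt ENNReal.ofReal_ne_top
  filter_upwards [hgrow, ae_regular ρ hρ] with t ht hreg hY
  have hYr : 0 < (Y t []).toReal := ENNReal.toReal_pos hY (hreg []).2
  have hev : ∀ᶠ n : ℕ in atTop, -Real.log (Y t []).toReal / τ ≤ n * (δ / 2) := by
    have : Tendsto (fun n : ℕ => (n : ℝ) * (δ / 2)) atTop atTop :=
      tendsto_natCast_atTop_atTop.atTop_mul_const (by positivity)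
    exact this.eventually_ge_atTop _
  have hwt : ∀ u, wt (fun w a => (w a : ℝ≥0∞) * ENNReal.ofReal (Real.exp (τ * g w a))) t u =
      Qt t u * ENNReal.ofReal (Real.exp (τ * gsum g t u)) := fun u => by
    rw [← gsum_mul]
    exact wt_mul_exp (fun w a => (w a : ℝ≥0∞)) (fun w a => τ * g w a) t u
  filter_upwards [ht, hev] with n hn hn2
  have h1 : wsum n (fun u => prob t u * Real.exp (τ * gsum g t u)) ≤
      Real.exp (n * (τ * (m + δ / 2))) / (Y t []).toReal := by
    rw [Real.exp_nat_mul, le_div_iff₀ hYr]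
    have h2 : wsum n (fun u => prob t u * Real.exp (τ * gsum g t u)) * (Y t []).toReal =
        (wsum n (fun u => wt (fun w a => (w a : ℝ≥0∞) * ENNReal.ofReal (Real.exp (τ * g w a))) t u *
          Y (sub t u) [])).toReal := by
      unfold wsum
      rw [ENNReal.toReal_sum, Finset.sum_mul]
      · refine Finset.sum_congr rfl fun u _ => ?_
        dsimp only
        rw [hwt, prob, ← Y_eq_sub, mul_right_comm (Qt t _), ENNReal.toReal_mul,
          ENNReal.toReal_ofReal (Real.exp_pos _).le, ENNReal.toReal_div]
        field_simp
      · intro u _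
        dsimp only
        rw [hwt, ← Y_eq_sub, mul_right_comm]
        exact ENNReal.mul_ne_top (hreg.mass_ne_top _) ENNReal.ofReal_ne_top
    rw [h2]
    calc _ ≤ (ENNReal.ofReal (Real.exp (τ * (m + δ / 2))) ^ n).toReal :=
          ENNReal.toReal_mono (by finiteness) hn
      _ = _ := by rw [ENNReal.toReal_pow, ENNReal.toReal_ofReal (Real.exp_pos _).le]
  -- Gibbs' variational principle turns the exponential moment into a bound for the average
  have h3 : wsum n (fun u => prob t u * (τ * gsum g t u)) ≤
      Real.log (wsum n (fun u => prob t u * Real.exp (τ * gsum g t u))) :=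
    sum_mul_le_log_sum_mul_exp (fun _ _ => prob_nonneg _ _) (hreg.wsum_prob hY n)
  have hpos : 0 < wsum n (fun u => prob t u * Real.exp (τ * gsum g t u)) := by
    have h0 := hreg.wsum_prob hY n
    by_contra hcon
    have hall : ∀ v ∈ (Finset.univ : Finset (Fin n → α)),
        prob t (List.ofFn v) * Real.exp (τ * gsum g t (List.ofFn v)) = 0 := by
      refine (Finset.sum_eq_zero_iff_of_nonneg fun v _ => ?_).1 (le_antisymm (not_lt.1 hcon) ?_)
      · exact mul_nonneg (prob_nonneg _ _) (Real.exp_pos _).le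
      · exact Finset.sum_nonneg fun v _ => mul_nonneg (prob_nonneg _ _) (Real.exp_pos _).le
    have : wsum n (prob t) = 0 := Finset.sum_eq_zero fun v hv => by
      have := hall v hv
      simpa [Real.exp_ne_zero] using this
    linarith
  have h4 := h3.trans (Real.log_le_log hpos h1)
  rw [Real.log_div (Real.exp_ne_zero _) hYr.ne', Real.log_exp] at h4
  have h5 : wsum n (fun u => prob t u * (τ * gsum g t u)) =
      τ * wsum n (fun u => prob t u * gsum g t u) := by
    rw [mul_wsum]; exact wsum_congr fun u _ => by ring
  rw [h5] at h4
  rw [div_le_iff₀ hτ] at hn2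
  refine le_of_mul_le_mul_left ?_ hτ
  linarith

lemma integral_sum_weight_mul_comp (f : α → β) (h : β → ℝ) :
    ∫ w, ∑ a, (w a : ℝ) * h (f a) ∂ρ = ∑ b, marginal ρ f b * h b := by
  have h1 : ∀ w : α → ℝ≥0, ∑ a, (w a : ℝ) * h (f a) =
      ∑ b, (∑ a, (if f a = b then (w a : ℝ) else 0)) * h b := by
    intro w
    simp only [Finset.sum_mul, ite_mul, zero_mul]
    rw [Finset.sum_comm]
    simp
  have hint : ∀ b, Integrable (fun w : α → ℝ≥0 => ∑ a, (if f a = b then (w a : ℝ) else 0)) ρ :=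
    fun b => integrable_finsetSum _ fun a _ => by
      split_ifs
      · exact integrable_weight ρ hρ a
      · exact integrable_zero _ _ _
  simp only [h1]
  rw [integral_finsetSum _ fun b _ => (hint b).mul_const _]
  simp only [integral_mul_const, marginal]

omit hρ in
lemma marginal_nonneg (f : α → β) (b : β) : 0 ≤ marginal ρ f b :=
  integral_nonneg fun w => Finset.sum_nonneg fun a _ => by split_ifs <;> simp

lemma sum_marginal (f : α → β) : ∑ b, marginal ρ f b = 1 := by
  have := integral_sum_weight_mul_comp ρ hρ f fun _ => 1
  simpa [integral_sum_weight ρ hρ] using this.symm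

omit hρ in
lemma wsum_prod (n : ℕ) (r : β → ℝ) : wsum n (fun w : List β => (w.map r).prod) = (∑ b, r b) ^ n := by
  induction n with
  | zero => simp
  | succ n ih => simp only [wsum_succ, List.map_cons, List.prod_cons, ← mul_wsum, ih,
      ← Finset.sum_mul, pow_succ']

omit [Fintype α] [Fintype β] hρ in
lemma gsum_comp (h : β → ℝ) (f : α → β) (t : List α → α → ℝ≥0) (u : List α) :
    gsum (fun _ a => h (f a)) t u = ((u.map f).map h).sum := by
  induction u generalizing t with
  | nil => rfl
  | cons a u ih => simp [gsum, ih]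

/-- The entropy dimension of the projection by `f` is at most the entropy of the Bernoulli measure
which is the mean of the projection. -/
lemma eventually_projEntropy_le_marginal (f : α → β) {δ : ℝ} (hδ : 0 < δ) :
    ∀ᵐ t ∂treeLaw ρ, Y t [] ≠ 0 → ∀ᶠ n : ℕ in atTop,
      projEntropy f n t ≤ n * (∑ b, Real.negMulLog (marginal ρ f b) + δ) := by
  set q := marginal ρ f
  have hq0 : ∀ b, 0 ≤ q b := marginal_nonneg ρ f
  -- raising the entries of `q` to `ε` makes their logarithms bounded, and adds at most `δ / 2` to
  -- `∑ q`
  set ε : ℝ := δ / (2 * (Fintype.card β + 1)) with hε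
  have hε0 : 0 < ε := by positivity
  have hεδ : ε * Fintype.card β ≤ δ / 2 := by
    rw [hε, div_mul_eq_mul_div, div_le_iff₀ (by positivity)]; nlinarith
  have hr0 : ∀ b, 0 < max (q b) ε := fun b => lt_max_of_lt_right hε0
  obtain ⟨C, hC⟩ : ∃ C, ∀ b, |-Real.log (max (q b) ε)| ≤ C := by
    obtain ⟨C, hC⟩ := (Set.finite_range fun b => |-Real.log (max (q b) ε)|).bddAbove
    exact ⟨C, fun b => hC ⟨b, rfl⟩⟩
  filter_upwards [ae_regular ρ hρ, eventually_wsum_prob_mul_gsum_le ρ hρ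
    (g := fun _ a => -Real.log (max (q (f a)) ε)) (fun a => measurable_const) (C := C)
    (fun _ a => hC _) (half_pos hδ)] with t hreg ht hY
  filter_upwards [ht hY] with n hn
  have h1 := hreg.projEntropy_le hY f n (r := fun w => (w.map fun b => max (q b) ε).prod)
    (fun w => List.prod_pos (by simp only [List.mem_map]; rintro _ ⟨b, _, rfl⟩; exact hr0 b))
  rw [wsum_prod] at h1
  have h2 : ∀ w : List β, Real.log (w.map fun b => max (q b) ε).prod =
      -(w.map fun b => -Real.log (max (q b) ε)).sum := by
    intro w
    induction w with
    | nil => simp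
    | cons b w ih =>
      simp only [List.map_cons, List.prod_cons, List.sum_cons]
      rw [Real.log_mul (hr0 b).ne', ih]
      · ring
      · exact (List.prod_pos (by simp only [List.mem_map]; rintro _ ⟨b, _, rfl⟩; exact hr0 b)).ne'
  have h3 : -wsum n (fun u => prob t u * Real.log ((u.map f).map fun b => max (q b) ε).prod) =
      wsum n (fun u => prob t u * gsum (fun _ a => -Real.log (max (q (f a)) ε)) t u) := by
    rw [wsum, ← Finset.sum_neg_distrib]
    refine Finset.sum_congr rfl fun v _ => ?_
    dsimp only
    rw [h2, ← gsum_comp (fun b => -Real.log (max (q b) ε)) f t]; ring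
  rw [h3] at h1
  rw [integral_sum_weight_mul_comp ρ hρ f fun b => -Real.log (max (q b) ε)] at hn
  have h4 : ∑ b, q b * -Real.log (max (q b) ε) ≤ ∑ b, Real.negMulLog (q b) := by
    refine Finset.sum_le_sum fun b _ => ?_
    rw [Real.negMulLog]
    rcases (hq0 b).eq_or_lt with h | h
    · simp [← h]
    · have := Real.log_le_log h (le_max_left (q b) ε)
      nlinarith
  have h5 : Real.log ((∑ b, max (q b) ε) ^ n) ≤ n * (δ / 2) := by
    rw [Real.log_pow]
    have h6 : ∑ b, max (q b) ε ≤ 1 + ε * Fintype.card β := by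
      calc ∑ b, max (q b) ε ≤ ∑ b, (q b + ε) :=
            Finset.sum_le_sum fun b _ => max_le (by linarith) (by linarith [hq0 b])
        _ = _ := by rw [Finset.sum_add_distrib, sum_marginal ρ hρ f]; simp [mul_comm]
    have h7 : 0 ≤ ∑ b, max (q b) ε := Finset.sum_nonneg fun b _ => (hr0 b).le
    have h8 : Real.log (∑ b, max (q b) ε) ≤ δ / 2 := by
      rcases h7.eq_or_lt with h | h
      · rw [← h]; simp; positivity
      · linarith [Real.log_le_sub_one_of_pos h]
    gcongr
  have h9 : (n : ℝ) * ∑ b, q b * -Real.log (max (q b) ε) ≤ n * ∑ b, Real.negMulLog (q b) := by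
    gcongr
  change wsum n _ ≤ (n : ℝ) * (∑ b, q b * -Real.log (max (q b) ε) + δ / 2) at hn
  linarith

/-! The weights are truncated from below and from above, so that their logarithms are bounded. -/

/-- The truncation of `x` to `[1 / k, k]`. -/
def clamp (k : ℕ) (x : ℝ≥0) : ℝ := max (1 / k) (min x k)

omit hρ in
lemma clamp_pos {k : ℕ} (hk : 1 ≤ k) (x : ℝ≥0) : 0 < clamp k x :=
  lt_max_of_lt_left (by positivity)

omit hρ in
lemma measurable_clamp (k : ℕ) : Measurable (clamp k) := by unfold clamp; fun_prop

omit hρ in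
lemma abs_log_clamp_le {k : ℕ} (hk : 1 ≤ k) (x : ℝ≥0) : |Real.log (clamp k x)| ≤ Real.log k := by
  have hk' : (1 : ℝ) ≤ k := by exact_mod_cast hk
  have hk0 : (0 : ℝ) < k := by linarith
  rw [abs_le]
  constructor
  · rw [← Real.log_inv, ← one_div]
    exact Real.log_le_log (by positivity) (le_max_left _ _)
  · refine Real.log_le_log (clamp_pos hk x) (max_le ?_ (min_le_right _ _))
    rw [div_le_iff₀ hk0]; nlinarith

lemma lintegral_clamp_le {k : ℕ} (hk : 1 ≤ k) :
    ∫⁻ w, ∑ a, ENNReal.ofReal (clamp k (w a)) ∂ρ ≤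
      ENNReal.ofReal (1 + (Fintype.card α : ℝ) / k) := by
  calc ∫⁻ w, ∑ a, ENNReal.ofReal (clamp k (w a)) ∂ρ
      ≤ ∫⁻ w, ((∑ a, (w a : ℝ≥0∞)) + Fintype.card α * ENNReal.ofReal (1 / k)) ∂ρ := by
        refine lintegral_mono fun w => ?_
        have h1 : ∀ a, ENNReal.ofReal (clamp k (w a)) ≤ (w a : ℝ≥0∞) + ENNReal.ofReal (1 / k) := by
          intro a
          have : (w a : ℝ≥0∞) = ENNReal.ofReal (w a : ℝ) := by simp
          rw [this, ← ENNReal.ofReal_add (by positivity) (by positivity)]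
          refine ENNReal.ofReal_le_ofReal (max_le ?_ ?_)
          · have : (0 : ℝ) ≤ w a := by positivity
            linarith
          · have : (0 : ℝ) ≤ 1 / k := by positivity
            linarith [min_le_left (w a : ℝ) (k : ℝ)]
        refine (Finset.sum_le_sum fun a _ => h1 a).trans ?_
        rw [Finset.sum_add_distrib]; simp
    _ = _ := by
        rw [lintegral_add_right _ measurable_const, hρ, lintegral_const, measure_univ, mul_one,
          ENNReal.ofReal_add (by positivity) (by positivity), ENNReal.ofReal_one]
        congr 1
        rw [show (Fintype.card α : ℝ≥0∞) = ENNReal.ofReal (Fintype.card α : ℝ) by simp,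
          ← ENNReal.ofReal_mul (by positivity)]
        congr 1; ring

/-- Gibbs' inequality against the products of the truncated weights, whose sums have a mean growing at
rate at most `1 + #α / k`. -/
lemma eventually_projEntropy_id_le_clamp {k : ℕ} (hk : 1 ≤ k) {δ : ℝ} (hδ : 0 < δ) :
    ∀ᵐ t ∂treeLaw ρ, Y t [] ≠ 0 → ∀ᶠ n : ℕ in atTop,
      projEntropy (id : α → α) n t ≤ n * (-(∫ w, ∑ a, (w a : ℝ) * Real.log (clamp k (w a)) ∂ρ) +
        (Fintype.card α : ℝ) / k + δ) := by
  have hlt : ∫⁻ w, ∑ a, 1 * ENNReal.ofReal (Real.exp (Real.log (clamp k (w a)))) ∂ρ <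
      ENNReal.ofReal (Real.exp ((Fintype.card α : ℝ) / k + δ / 2)) := by
    simp only [one_mul, Real.exp_log (clamp_pos hk _)]
    refine (lintegral_clamp_le ρ hρ hk).trans_lt ?_
    rw [ENNReal.ofReal_lt_ofReal_iff (Real.exp_pos _)]
    have := Real.add_one_le_exp ((Fintype.card α : ℝ) / k + δ / 2)
    linarith
  have hgrow := eventually_wsum_wt_le ρ (V := fun w a => 1 *
    ENNReal.ofReal (Real.exp (Real.log (clamp k (w a)))))
    (fun a => by have := measurable_clamp k; fun_prop) (Φ := fun _ => 1)
    measurable_const (by simp) hlt ENNReal.ofReal_ne_top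
  filter_upwards [ae_regular ρ hρ, eventually_wsum_prob_mul_gsum_le ρ hρ
    (g := fun w a => -Real.log (clamp k (w a))) (fun a => by have := measurable_clamp k; fun_prop)
    (C := Real.log k) (fun w a => by rw [abs_neg]; exact abs_log_clamp_le hk _) (half_pos hδ), hgrow]
    with t hreg ht ht2 hY
  filter_upwards [ht hY, ht2] with n hn hn2
  have hwt : ∀ u, wt (fun w a => 1 * ENNReal.ofReal (Real.exp (Real.log (clamp k (w a))))) t u =
      ENNReal.ofReal (Real.exp (gsum (fun w a => Real.log (clamp k (w a))) t u)) := by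
    intro u
    rw [wt_mul_exp (fun _ _ => 1) (fun w a => Real.log (clamp k (w a))) t u]
    rw [wt_one, one_mul]
  simp only [hwt, mul_one] at hn2
  have h1 := hreg.projEntropy_le hY id n
    (r := fun u => Real.exp (gsum (fun w a => Real.log (clamp k (w a))) t u)) fun w => Real.exp_pos _
  have h2 : wsum n (fun u => Real.exp (gsum (fun w a => Real.log (clamp k (w a))) t u)) ≤
      Real.exp ((Fintype.card α : ℝ) / k + δ / 2) ^ n := by
    rw [wsum] at hn2 ⊢
    rw [← ENNReal.ofReal_sum_of_nonneg fun _ _ => (Real.exp_pos _).le,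
      ← ENNReal.ofReal_pow (Real.exp_pos _).le] at hn2
    exact (ENNReal.ofReal_le_ofReal_iff (by positivity)).1 hn2
  have hpos : 0 ≤ wsum n (fun u => Real.exp (gsum (fun w a => Real.log (clamp k (w a))) t u)) :=
    Finset.sum_nonneg fun _ _ => (Real.exp_pos _).le
  have h3 : Real.log (wsum n (fun u => Real.exp (gsum (fun w a => Real.log (clamp k (w a))) t u))) ≤
      n * ((Fintype.card α : ℝ) / k + δ / 2) := by
    rcases hpos.eq_or_lt with h | h
    · rw [← h, Real.log_zero]; positivity
    · have := Real.log_le_log h h2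
      rwa [Real.log_pow, Real.log_exp] at this
  have h4 : -wsum n (fun u => prob t u * Real.log (Real.exp
      (gsum (fun w a => Real.log (clamp k (w a))) t (u.map id)))) =
      wsum n (fun u => prob t u * gsum (fun w a => -Real.log (clamp k (w a))) t u) := by
    rw [wsum, ← Finset.sum_neg_distrib]
    refine Finset.sum_congr rfl fun v _ => ?_
    have := gsum_mul (-1) (fun w a => Real.log (clamp k (w a))) t (List.ofFn v)
    simp only [neg_mul, one_mul] at this
    dsimp only
    rw [Real.log_exp, List.map_id, this]; ring
  rw [h4] at h1
  simp only [mul_neg, Finset.sum_neg_distrib, integral_neg] at hn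
  linarith

end Upper

section UpperLimit

variable {α β : Type*} [Fintype α] [Fintype β]

lemma eventually_clamp_eq {x : ℝ≥0} (hx : x ≠ 0) : ∀ᶠ k : ℕ in atTop, clamp k x = x := by
  have hx0 : (0 : ℝ) < x := by positivity
  filter_upwards [eventually_ge_atTop 1,
    (tendsto_natCast_atTop_atTop (R := ℝ)).eventually_ge_atTop (x : ℝ),
    (tendsto_natCast_atTop_atTop (R := ℝ)).eventually_ge_atTop (1 / x : ℝ)] with k hk h1 h2
  have hk0 : (0 : ℝ) < k := by positivity
  rw [clamp, min_eq_left h1, max_eq_right]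
  rw [div_le_iff₀ hk0]
  rw [div_le_iff₀ hx0] at h2
  linarith

lemma eventually_mul_log_clamp_eq (x : ℝ≥0) :
    ∀ᶠ k : ℕ in atTop, (x : ℝ) * Real.log (clamp k x) = -Real.negMulLog x := by
  by_cases hx : x = 0
  · simp [hx]
  · filter_upwards [eventually_clamp_eq hx] with k hk
    rw [hk, Real.negMulLog]; ring

lemma negMulLog_le_one {x : ℝ} (hx : 0 ≤ x) : Real.negMulLog x ≤ 1 := by
  have := negMulLog_le_of_pos hx one_pos
  simp at this; linarith

/-- Uniform bounds in `k`: domination, for the convergence of the truncated integrals, and a lower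
bound, for Fatou's lemma. -/
lemma abs_mul_log_clamp_le {k : ℕ} (hk : 1 ≤ k) (x : ℝ≥0) :
    |(x : ℝ) * Real.log (clamp k x)| ≤ |Real.negMulLog x| ∧
      -1 ≤ (x : ℝ) * Real.log (clamp k x) := by
  have hk' : (1 : ℝ) ≤ k := by exact_mod_cast hk
  have hk0 : (0 : ℝ) < k := by linarith
  have hik : 1 / (k : ℝ) ≤ 1 := by rw [div_le_iff₀ hk0]; linarith
  rcases eq_or_ne x 0 with rfl | hx
  · simp
  have hx0 : (0 : ℝ) < x := by positivity
  have hN := negMulLog_le_one hx0.le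
  rw [Real.negMulLog, neg_mul] at hN ⊢
  rw [abs_neg, abs_mul, abs_mul, abs_of_pos hx0]
  rcases le_total (x : ℝ) k with h1 | h1
  · rcases le_total (1 / (k : ℝ)) x with h2 | h2
    · have : clamp k x = x := by rw [clamp, min_eq_left h1, max_eq_right h2]
      rw [this]; exact ⟨le_rfl, by linarith⟩
    · have : clamp k x = 1 / k := by rw [clamp, min_eq_left h1, max_eq_left h2]
      rw [this]
      have h3 : Real.log x ≤ Real.log (1 / k) := Real.log_le_log hx0 h2
      have h4 : Real.log (1 / k) ≤ 0 := Real.log_nonpos (by positivity) hik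
      refine ⟨?_, by nlinarith⟩
      rw [abs_of_nonpos h4, abs_of_nonpos (h3.trans h4)]
      exact mul_le_mul_of_nonneg_left (by linarith) hx0.le
  · have : clamp k x = k := by rw [clamp, min_eq_right h1, max_eq_right (hik.trans hk')]
    rw [this]
    have h3 : Real.log k ≤ Real.log x := Real.log_le_log hk0 h1
    have h4 : 0 ≤ Real.log k := Real.log_nonneg hk'
    refine ⟨?_, by nlinarith⟩
    rw [abs_of_nonneg h4, abs_of_nonneg (h4.trans h3)]
    exact mul_le_mul_of_nonneg_left h3 hx0.le

variable (ρ : Measure (α → ℝ≥0)) [IsProbabilityMeasure ρ]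
variable (hρ : ∫⁻ w, ∑ a, (w a : ℝ≥0∞) ∂ρ = 1) (hpos : treeLaw ρ {t | Y t [] ≠ 0} ≠ 0)
include hρ

omit hρ in
lemma nonneg_of_eventually_le {c : ℝ} {a : ℕ → ℝ} (ha : ∀ n, 0 ≤ a n)
    (h : ∀ᶠ n : ℕ in atTop, a n ≤ n * c) : 0 ≤ c := by
  obtain ⟨n, hn, h1⟩ := (h.and (eventually_ge_atTop 1)).exists
  have : (0 : ℝ) < n := by exact_mod_cast h1
  by_contra hc
  have := mul_neg_of_pos_of_neg this (not_le.1 hc)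
  linarith [ha n]

lemma integrable_mul_log_clamp {k : ℕ} (hk : 1 ≤ k) (a : α) :
    Integrable (fun w : α → ℝ≥0 => (w a : ℝ) * Real.log (clamp k (w a))) ρ :=
  integrable_weight_mul ρ hρ (C := Real.log k) (by have := measurable_clamp k; fun_prop)
    (fun _ => abs_log_clamp_le hk _) a

include hpos

/-- Nonnegativity of the entropies, on an event of positive probability, bounds the truncations of
`𝔼 ∑ W log W`. -/
lemma integral_mul_log_clamp_le {k : ℕ} (hk : 1 ≤ k) :
    ∫ w, ∑ a, (w a : ℝ) * Real.log (clamp k (w a)) ∂ρ ≤ (Fintype.card α : ℝ) / k := by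
  refine le_of_forall_pos_le_add fun δ hδ => ?_
  have h : ∃ᵐ t ∂treeLaw ρ, Y t [] ≠ 0 := frequently_ae_iff.2 hpos
  obtain ⟨t, hY, hreg, ht⟩ := (h.and_eventually ((ae_regular ρ hρ).and
    (eventually_projEntropy_id_le_clamp ρ hρ hk hδ))).exists
  have := nonneg_of_eventually_le (fun n => hreg.projEntropy_nonneg hY id n) (ht hY)
  linarith

/-- If the Mandelbrot measure is positive then `∑ W log W` is integrable. -/
lemma integrable_negMulLog (a : α) : Integrable (fun w : α → ℝ≥0 => Real.negMulLog (w a)) ρ := by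
  set c := (Fintype.card α : ℝ)
  have hterm : ∀ k : ℕ, 1 ≤ k → ∀ w : α → ℝ≥0, ∀ a, 0 ≤ (w a : ℝ) * Real.log (clamp k (w a)) + 1 :=
    fun k hk w a => by linarith [(abs_mul_log_clamp_le hk (w a)).2]
  have hlim : ∀ w : α → ℝ≥0, Tendsto (fun k : ℕ =>
      ENNReal.ofReal (∑ a, ((w a : ℝ) * Real.log (clamp k (w a)) + 1))) atTop
      (𝓝 (ENNReal.ofReal (∑ a, (-Real.negMulLog (w a) + 1)))) := by
    intro w
    refine ENNReal.tendsto_ofReal (tendsto_finsetSum _ fun a _ => ?_)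
    refine tendsto_const_nhds.congr' ?_
    filter_upwards [eventually_mul_log_clamp_eq (w a)] with k hk
    rw [hk]
  -- the summands are bounded below by `-1`, so that Fatou's lemma applies after adding `1` to each
  have hfat : ∫⁻ w, ENNReal.ofReal (∑ a : α, (-Real.negMulLog (w a) + 1)) ∂ρ ≤
      ENNReal.ofReal (2 * c) := by
    calc ∫⁻ w, ENNReal.ofReal (∑ a : α, (-Real.negMulLog (w a) + 1)) ∂ρ
        = ∫⁻ w, liminf (fun k : ℕ =>
          ENNReal.ofReal (∑ a, ((w a : ℝ) * Real.log (clamp k (w a)) + 1))) atTop ∂ρ :=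
          lintegral_congr fun w => (hlim w).liminf_eq.symm
      _ ≤ liminf (fun k : ℕ => ∫⁻ w,
          ENNReal.ofReal (∑ a : α, ((w a : ℝ) * Real.log (clamp k (w a)) + 1)) ∂ρ) atTop :=
          lintegral_liminf_le fun k => by have := measurable_clamp k; fun_prop
      _ ≤ ENNReal.ofReal (2 * c) := by
          refine liminf_le_of_le (by isBoundedDefault) fun b hb => ?_
          obtain ⟨k, hk, hk1⟩ := (hb.and (eventually_ge_atTop 1)).exists
          refine hk.trans ?_
          rw [← ofReal_integral_eq_lintegral_ofReal]
          · refine ENNReal.ofReal_le_ofReal ?_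
            simp only [Finset.sum_add_distrib, Finset.sum_const, Finset.card_univ, nsmul_eq_mul,
              mul_one]
            rw [integral_add (integrable_finsetSum _ fun a _ =>
              integrable_mul_log_clamp ρ hρ hk1 a) (integrable_const _)]
            have h1 := integral_mul_log_clamp_le ρ hρ hpos hk1
            have h2 : c / k ≤ c := div_le_self (by positivity) (by exact_mod_cast hk1)
            simp only [integral_const, probReal_univ, smul_eq_mul, one_mul]
            linarith
          · exact integrable_finsetSum _ fun a _ =>
              (integrable_mul_log_clamp ρ hρ hk1 a).add (integrable_const _)
          · exact .of_forall fun w => Finset.sum_nonneg fun a _ => hterm k hk1 w a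
  have hn1 : ∀ w : α → ℝ≥0, ∀ a, 0 ≤ -Real.negMulLog (w a) + 1 := fun w a => by
    linarith [negMulLog_le_one (w a).coe_nonneg]
  have hint : Integrable (fun w : α → ℝ≥0 => ∑ a : α, (-Real.negMulLog (w a) + 1)) ρ := by
    refine ⟨Measurable.aestronglyMeasurable (by fun_prop), ?_⟩
    rw [hasFiniteIntegral_iff_ofReal (.of_forall fun w => Finset.sum_nonneg fun a _ => hn1 w a)]
    exact hfat.trans_lt ENNReal.ofReal_lt_top
  refine (hint.add (integrable_const 1)).mono' (Measurable.aestronglyMeasurable (by fun_prop))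
    (.of_forall fun w => ?_)
  have h1 := Finset.single_le_sum (f := fun a => -Real.negMulLog (w a) + 1)
    (fun a _ => hn1 w a) (Finset.mem_univ a)
  have h2 := negMulLog_le_one (w a).coe_nonneg
  rw [Real.norm_eq_abs, abs_le]
  simp only [Pi.add_apply] at h1 ⊢
  have h3 := hn1 w a
  constructor <;> linarith

lemma tendsto_integral_mul_log_clamp :
    Tendsto (fun k : ℕ => ∫ w, ∑ a, (w a : ℝ) * Real.log (clamp k (w a)) ∂ρ) atTop
      (𝓝 (-weightEntropy ρ)) := by
  rw [weightEntropy, ← integral_neg]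
  refine tendsto_integral_filter_of_dominated_convergence
    (fun w => ∑ a, |Real.negMulLog (w a)|) ?_ ?_ ?_ ?_
  · refine .of_forall fun k => Measurable.aestronglyMeasurable ?_
    have := measurable_clamp k; fun_prop
  · filter_upwards [eventually_ge_atTop 1] with k hk
    refine .of_forall fun w => ?_
    rw [Real.norm_eq_abs]
    exact (Finset.abs_sum_le_sum_abs _ _).trans
      (Finset.sum_le_sum fun a _ => (abs_mul_log_clamp_le hk (w a)).1)
  · exact integrable_finsetSum _ fun a _ => (integrable_negMulLog ρ hρ hpos a).abs
  · refine .of_forall fun w => ?_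
    rw [← Finset.sum_neg_distrib]
    refine tendsto_finsetSum _ fun a _ => tendsto_const_nhds.congr' ?_
    filter_upwards [eventually_mul_log_clamp_eq (w a)] with k hk
    rw [hk]

/-- The upper bound for the entropy dimension of the projection by `f`. -/
lemma eventually_projEntropy_le (f : α → β) {δ : ℝ} (hδ : 0 < δ) :
    ∀ᵐ t ∂treeLaw ρ, Y t [] ≠ 0 → ∀ᶠ n : ℕ in atTop, projEntropy f n t ≤
      n * (min (weightEntropy ρ) (∑ b, Real.negMulLog (marginal ρ f b)) + δ) := by
  have h1 := tendsto_integral_mul_log_clamp ρ hρ hpos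
  have h2 : Tendsto (fun k : ℕ => (Fintype.card α : ℝ) / k) atTop (𝓝 0) :=
    tendsto_const_div_atTop_nhds_zero_nat _
  have h3 := (h1.neg.add h2).eventually_lt_const
    (show - -weightEntropy ρ + 0 < weightEntropy ρ + δ / 2 by linarith)
  obtain ⟨k, hk, hk1⟩ := (h3.and (eventually_ge_atTop 1)).exists
  filter_upwards [eventually_projEntropy_id_le_clamp ρ hρ hk1 (half_pos hδ),
    eventually_projEntropy_le_marginal ρ hρ f hδ] with t ht1 ht2 hY
  filter_upwards [ht1 hY, ht2 hY] with n hn1 hn2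
  rw [min_add, mul_min_of_nonneg _ _ (Nat.cast_nonneg n)]
  refine le_min ((projEntropy_le_id f n t).trans (hn1.trans ?_)) hn2
  exact mul_le_mul_of_nonneg_left (by linarith) (Nat.cast_nonneg n)

end UpperLimit

/-! ### The spine and the many-to-one formulas -/

section Sequences

variable {E : Type*}

/-- The sequence with first term `x`, followed by `e`. -/
def consSeq (x : E) (e : ℕ → E) : ℕ → E
  | 0 => x
  | n + 1 => e n

@[simp] lemma consSeq_zero (x : E) (e : ℕ → E) : consSeq x e 0 = x := rfl

@[simp] lemma consSeq_succ (x : E) (e : ℕ → E) (n : ℕ) : consSeq x e (n + 1) = e n := rfl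

@[simp] lemma shift_consSeq (x : E) (e : ℕ → E) : shift (consSeq x e) = e := rfl

lemma dependsOn_comp_consSeq {R : Type*} {G : (ℕ → E) → R} {M : ℕ}
    (hG : DependsOn G (Set.Iio (M + 1))) (x : E) :
    DependsOn (fun e => G (consSeq x e)) (Set.Iio M) := by
  intro e e' h
  refine hG fun i hi => ?_
  cases i with
  | zero => rfl
  | succ i => exact h i (by simpa using hi)

variable [MeasurableSpace E]

lemma measurable_consSeq : Measurable fun p : E × (ℕ → E) => consSeq p.1 p.2 := by
  refine measurable_pi_iff.2 fun n => ?_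
  cases n with
  | zero => exact measurable_fst
  | succ n => simp only [consSeq]; fun_prop

lemma map_consSeq (μ : Measure E) [IsProbabilityMeasure μ] :
    (μ.prod (Measure.infinitePi fun _ : ℕ => μ)).map (fun p => consSeq p.1 p.2) =
      Measure.infinitePi fun _ : ℕ => μ := by
  refine Measure.eq_infinitePi _ fun s t ht => ?_
  rw [Measure.map_apply measurable_consSeq (.pi s.countable_toSet fun i _ => ht i)]
  have h1 : (fun p : E × (ℕ → E) => consSeq p.1 p.2) ⁻¹' ((s : Set ℕ).pi t) =
      (if 0 ∈ s then t 0 else Set.univ) ×ˢ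
        (Set.pi (s.preimage Nat.succ Nat.succ_injective.injOn) fun n => t (n + 1)) := by
    ext ⟨w, x⟩
    simp only [Set.mem_preimage, Set.mem_pi, Set.mem_prod, Finset.coe_preimage, SetLike.mem_coe]
    constructor
    · intro h
      refine ⟨?_, fun n hn => h (n + 1) hn⟩
      split_ifs with h0
      · exact h 0 h0
      · trivial
    · rintro ⟨h0, h⟩ n hn
      cases n with
      | zero => simpa [hn] using h0
      | succ n => exact h n hn
  rw [h1, Measure.prod_prod, Measure.infinitePi_pi _ fun i _ => ht _]
  have h2 : μ (if 0 ∈ s then t 0 else Set.univ) = ∏ i ∈ s.filter (· = 0), μ (t i) := by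
    split_ifs with h0
    · rw [show s.filter (· = 0) = {0} by ext v; simp; rintro rfl; exact h0]; simp
    · rw [show s.filter (· = 0) = ∅ by ext v; simp; rintro h rfl; exact h0 h]; simp
  have h3 : ∏ n ∈ s.preimage Nat.succ Nat.succ_injective.injOn, μ (t (n + 1)) =
      ∏ i ∈ s.filter (¬ · = 0), μ (t i) := by
    refine Finset.prod_bij (fun n _ => n + 1) ?_ ?_ ?_ ?_
    · intro n h; simpa using h
    · intro n _ n' _ h; simpa using h
    · intro n hn
      cases n with
      | zero => simp at hn
      | succ n => exact ⟨n, by simpa using hn, rfl⟩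
    · intros; rfl
  rw [h2, h3, Finset.prod_filter_mul_prod_filter_not]

lemma lintegral_infinitePi_consSeq (μ : Measure E) [IsProbabilityMeasure μ]
    {G : (ℕ → E) → ℝ≥0∞} (hG : Measurable G) :
    ∫⁻ e, G e ∂(Measure.infinitePi fun _ : ℕ => μ) =
      ∫⁻ x, ∫⁻ e, G (consSeq x e) ∂(Measure.infinitePi fun _ : ℕ => μ) ∂μ := by
  conv_lhs => rw [← map_consSeq μ]
  rw [lintegral_map hG measurable_consSeq]
  exact lintegral_prod _ (hG.comp measurable_consSeq).aemeasurable

end Sequences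

section Spine

variable {α β : Type*} [Fintype α] [MeasurableSpace α] [MeasurableSingletonClass α]
variable (ρ : Measure (α → ℝ≥0))

/-- The law of a letter and of the weights at its parent along the spine: the weight vector is
biased by `∑_a w_a`, and a letter is then chosen with probability proportional to its weight. -/
def stepLaw : Measure (α × (α → ℝ≥0)) :=
  ∑ a, (ρ.withDensity fun w => (w a : ℝ≥0∞)).map fun w => (a, w)

lemma lintegral_stepLaw {F : α × (α → ℝ≥0) → ℝ≥0∞} (hF : Measurable F) :
    ∫⁻ x, F x ∂stepLaw ρ = ∫⁻ w, ∑ a, (w a : ℝ≥0∞) * F (a, w) ∂ρ := by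
  rw [stepLaw, lintegral_finsetSum_measure, lintegral_finsetSum]
  · refine Finset.sum_congr rfl fun a _ => ?_
    have : Measurable fun w : α → ℝ≥0 => F (a, w) := hF.comp (by fun_prop)
    rw [lintegral_map hF (by fun_prop), lintegral_withDensity_eq_lintegral_mul _
      (show Measurable fun w : α → ℝ≥0 => (w a : ℝ≥0∞) by fun_prop) this]
    rfl
  · intro a _
    have : Measurable fun w : α → ℝ≥0 => F (a, w) := hF.comp (by fun_prop)
    fun_prop

lemma isProbabilityMeasure_stepLaw (hρ : ∫⁻ w, ∑ a, (w a : ℝ≥0∞) ∂ρ = 1) :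
    IsProbabilityMeasure (stepLaw ρ) := by
  refine ⟨?_⟩
  have := lintegral_stepLaw ρ (F := fun _ => 1) measurable_const
  simpa [hρ] using this

variable [Nonempty α]

/-- The letters of a word `v`, paired with the weights at their parents, followed by dummy values. -/
def path (t : List α → α → ℝ≥0) : List α → ℕ → α × (α → ℝ≥0)
  | [] => fun _ => (Classical.arbitrary α, 0)
  | a :: v => consSeq (a, t []) (path (sub t [a]) v)

lemma measurable_path (v : List α) : Measurable fun t : List α → α → ℝ≥0 => path t v := by
  induction v with
  | nil => exact measurable_const
  | cons a v ih =>
    have h1 : Measurable fun t : List α → α → ℝ≥0 => ((a, t []), path (sub t [a]) v) :=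
      Measurable.prodMk (by fun_prop) (ih.comp (measurable_sub [a]))
    exact measurable_consSeq.comp h1

variable [IsProbabilityMeasure ρ] (hρ : ∫⁻ w, ∑ a, (w a : ℝ≥0∞) ∂ρ = 1)
include hρ

lemma lintegral_pathLaw {G : (ℕ → α × (α → ℝ≥0)) → ℝ≥0∞} (hG : Measurable G) :
    ∫⁻ e, G e ∂(Measure.infinitePi fun _ : ℕ => stepLaw ρ) =
      ∫⁻ w, ∑ a, (w a : ℝ≥0∞) *
        ∫⁻ e, G (consSeq (a, w) e) ∂(Measure.infinitePi fun _ : ℕ => stepLaw ρ) ∂ρ := by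
  have := isProbabilityMeasure_stepLaw ρ hρ
  rw [lintegral_infinitePi_consSeq _ hG, lintegral_stepLaw]
  exact Measurable.lintegral_prod_right' (f := fun p : (α × (α → ℝ≥0)) × (ℕ → α × (α → ℝ≥0)) =>
    G (consSeq p.1 p.2)) (hG.comp measurable_consSeq)

/-- The many-to-one formula: the letters and weights met along a word chosen with the weights `Qt` form,
in mean, an independent sequence of law `stepLaw`. -/
lemma lintegral_wsum_path (M : ℕ) {G : (ℕ → α × (α → ℝ≥0)) → ℝ≥0∞} (hG : Measurable G)
    (hM : DependsOn G (Set.Iio M)) :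
    ∫⁻ t, wsum M (fun v => Qt t v * G (path t v)) ∂treeLaw ρ =
      ∫⁻ e, G e ∂(Measure.infinitePi fun _ : ℕ => stepLaw ρ) := by
  have := isProbabilityMeasure_stepLaw ρ hρ
  induction M generalizing G with
  | zero =>
    have h1 : ∀ e, G e = G fun _ => (Classical.arbitrary α, 0) := fun e => hM fun i hi => by simp at hi
    simp only [h1, wsum_zero]
    simp [wt]
  | succ M ih =>
    have hm : ∀ M, ∀ G : (ℕ → α × (α → ℝ≥0)) → ℝ≥0∞, Measurable G →
        Measurable fun t : List α → α → ℝ≥0 => wsum M (fun v => Qt t v * G (path t v)) :=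
      fun M G hG => measurable_wsum fun v => (measurable_Qt v).mul (hG.comp (measurable_path v))
    have hc : ∀ x, Measurable fun e => G (consSeq x e) := fun x =>
      hG.comp (measurable_consSeq.comp measurable_prodMk_left)
    rw [lintegral_treeLaw ρ (hm _ _ hG), lintegral_pathLaw ρ hρ hG]
    refine lintegral_congr fun w => ?_
    simp only [wsum_succ, wt, path, node_nil, sub_node, mul_assoc, ← mul_wsum]
    rw [lintegral_finsetSum]
    · refine Finset.sum_congr rfl fun a _ => ?_
      rw [← ih (hc (a, w)) (dependsOn_comp_consSeq hM (a, w)),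
        ← lintegral_pi_eval ρ (hm M _ (hc (a, w))) a]
      exact lintegral_const_mul _ ((hm M _ (hc (a, w))).comp (measurable_pi_apply a))
    · exact fun a _ => ((hm M _ (hc (a, w))).comp (measurable_pi_apply a)).const_mul _

omit hρ [MeasurableSpace α] [MeasurableSingletonClass α] [Nonempty α] in
lemma lintegral_pi_mul {F H : (List α → α → ℝ≥0) → ℝ≥0∞} (hF : Measurable F) (hH : Measurable H)
    {a a' : α} (h : a ≠ a') :
    ∫⁻ s, F (s a) * H (s a') ∂(Measure.pi fun _ : α => treeLaw ρ) =
      (∫⁻ t, F t ∂treeLaw ρ) * ∫⁻ t, H t ∂treeLaw ρ := by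
  have h1 : iIndepFun (fun (a : α) (s : α → List α → α → ℝ≥0) => s a)
      (Measure.pi fun _ : α => treeLaw ρ) :=
    iIndepFun_pi (X := fun _ x => x) fun _ => aemeasurable_id
  have h2 := lintegral_mul_eq_lintegral_mul_lintegral_of_indepFun
    (hF.comp (measurable_pi_apply a)) (hH.comp (measurable_pi_apply a'))
    ((h1.indepFun h).comp hF hH)
  simp only [Pi.mul_apply, Function.comp_def] at h2
  rw [h2, lintegral_pi_eval ρ hF, lintegral_pi_eval ρ hH]

/-! Pairs of words of length `M` whose projections by `f` agree on the first `n` letters. -/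

variable (f : α → β)

/-- The mass of the words of length `M` whose projections agree with that of `v` on the first `n`
letters. -/
def matchMass (M n : ℕ) (t : List α → α → ℝ≥0) (v : List α) : ℝ≥0∞ :=
  wsum M fun v' => if (v'.map f).take n = (v.map f).take n then Qt t v' else 0

omit [MeasurableSpace α] [MeasurableSingletonClass α] [Nonempty α] [IsProbabilityMeasure ρ] hρ in
lemma measurable_matchMass (M n : ℕ) (v : List α) :
    Measurable fun t : List α → α → ℝ≥0 => matchMass f M n t v :=
  measurable_wsum fun v' => by
    split_ifs
    · exact measurable_Qt v'
    · exact measurable_const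

/-- The mean mass of a letter, as an extended nonnegative number. -/
def letterMass (b : β) : ℝ≥0∞ := ∫⁻ w, ∑ a, (if f a = b then (w a : ℝ≥0∞) else 0) ∂ρ

/-- The mean mass of the projection of the first `n` letters of a spine. -/
def spineMass (n : ℕ) (e : ℕ → α × (α → ℝ≥0)) : ℝ≥0∞ :=
  ∏ l ∈ Finset.range n, letterMass ρ f (f (e l).1)

omit [MeasurableSpace α] [MeasurableSingletonClass α] [Nonempty α] [IsProbabilityMeasure ρ] hρ in
lemma spineMass_consSeq (n : ℕ) (x : α × (α → ℝ≥0)) (e : ℕ → α × (α → ℝ≥0)) :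
    spineMass ρ f (n + 1) (consSeq x e) = letterMass ρ f (f x.1) * spineMass ρ f n e := by
  simp [spineMass, Finset.prod_range_succ', mul_comm]

omit [Nonempty α] [IsProbabilityMeasure ρ] hρ in
lemma measurable_spineMass (n : ℕ) : Measurable (spineMass ρ f n) := by
  unfold spineMass
  refine Finset.measurable_fun_prod _ fun l _ => ?_
  exact (measurable_of_finite fun a : α => letterMass ρ f (f a)).comp (by fun_prop)

/-- The mean of `matchMass` depends on the letters of `v` only; the tree `t₀` supplies the irrelevant
weights of `path`. -/
lemma lintegral_matchMass {M n : ℕ} (hn : n ≤ M) (v : List α) (hv : v.length = M)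
    (t₀ : List α → α → ℝ≥0) :
    ∫⁻ t, matchMass f M n t v ∂treeLaw ρ = spineMass ρ f n (path t₀ v) := by
  induction M generalizing n v t₀ with
  | zero =>
    obtain rfl : n = 0 := by omega
    simp [matchMass, spineMass, wt]
  | succ M ih =>
    cases n with
    | zero =>
      have : ∀ t, matchMass f (M + 1) 0 t v = Yn t [] (M + 1) := fun t => by
        simp [matchMass, Yn_eq]
      simp only [this]
      rw [lintegral_Yn ρ hρ]
      simp [spineMass]
    | succ n =>
      cases v with
      | nil => simp at hv
      | cons a v =>
        have hnode : ∀ w s, matchMass f (M + 1) (n + 1) (node w s) (a :: v) =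
            ∑ a', (if f a' = f a then (w a' : ℝ≥0∞) else 0) * matchMass f M n (s a') v := by
          intro w s
          simp only [matchMass, wsum_succ, mul_wsum]
          refine Finset.sum_congr rfl fun a' _ => wsum_congr fun v' _ => ?_
          by_cases h1 : f a' = f a <;> by_cases h2 : (v'.map f).take n = (v.map f).take n <;>
            simp [h1, h2, wt]
        have hm : ∀ a' : α, Measurable fun s : α → List α → α → ℝ≥0 => matchMass f M n (s a') v :=
          fun a' => (measurable_matchMass f M n v).comp (measurable_pi_apply a')
        rw [lintegral_treeLaw ρ (measurable_matchMass f _ _ _), path, spineMass_consSeq,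
          letterMass, ← lintegral_mul_const]
        · refine lintegral_congr fun w => ?_
          simp only [hnode]
          rw [lintegral_finsetSum _ fun a' _ => (hm a').const_mul _, Finset.sum_mul]
          refine Finset.sum_congr rfl fun a' _ => ?_
          rw [lintegral_const_mul _ (hm a'), lintegral_pi_eval ρ (measurable_matchMass f M n v),
            ih (by omega) v (by simpa using hv) (sub t₀ [a])]
        · refine Finset.measurable_fun_sum _ fun a' _ => ?_
          split_ifs <;> fun_prop

/-- A bound for the conditional mean, given the spine `e`, of the mass of the words of length `M`
whose projections agree with that of the spine on the first `n` letters: either a word leaves the spine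
at the root, into a subtree independent of it, or it follows the spine for one more letter. The bound
drops the condition that the first letters agree. -/
def spineBound : ℕ → ℕ → (ℕ → α × (α → ℝ≥0)) → ℝ≥0∞
  | 0, _, _ => 1
  | M + 1, n, e => (∑ a, ((e 0).2 a : ℝ≥0∞)) * spineMass ρ f (n - 1) (shift e) +
      (e 0).2 (e 0).1 * spineBound M (n - 1) (shift e)

omit [Nonempty α] [IsProbabilityMeasure ρ] hρ in
lemma measurable_spineBound (M n : ℕ) : Measurable (spineBound ρ f M n) := by
  induction M generalizing n with
  | zero => exact measurable_const
  | succ M ih =>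
    have h1 : Measurable (shift : (ℕ → α × (α → ℝ≥0)) → _) := by unfold shift; fun_prop
    have h2 : Measurable fun e : ℕ → α × (α → ℝ≥0) => ((e 0).2 (e 0).1 : ℝ≥0∞) := by
      have : Measurable fun x : α × (α → ℝ≥0) => x.2 x.1 := measurable_from_prod_countable_right
        fun a => by fun_prop
      exact (this.comp (measurable_pi_apply 0)).coe_nnreal_ennreal
    exact ((by fun_prop : Measurable fun e : ℕ → α × (α → ℝ≥0) =>
      ∑ a, ((e 0).2 a : ℝ≥0∞)).mul ((measurable_spineMass ρ f (n - 1)).comp h1)).add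
      (h2.mul ((ih (n - 1)).comp h1))

omit [MeasurableSpace α] [MeasurableSingletonClass α] [Nonempty α] [IsProbabilityMeasure ρ] hρ in
lemma dependsOn_spineMass {M n : ℕ} (hn : n ≤ M) : DependsOn (spineMass ρ f n) (Set.Iio M) := by
  intro e e' h
  refine Finset.prod_congr rfl fun l hl => ?_
  rw [h l (by simp at hl ⊢; omega)]

omit [MeasurableSpace α] [MeasurableSingletonClass α] [Nonempty α] [IsProbabilityMeasure ρ] hρ in
lemma dependsOn_spineBound {M n : ℕ} (hn : n ≤ M) : DependsOn (spineBound ρ f M n) (Set.Iio M) := by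
  induction M generalizing n with
  | zero => intro e e' _; rfl
  | succ M ih =>
    intro e e' h
    have h0 : e 0 = e' 0 := h 0 (by simp)
    have h1 : ∀ i ∈ Set.Iio M, shift e i = shift e' i := fun i hi => h (i + 1) (by simpa using hi)
    rw [spineBound, spineBound, h0, dependsOn_spineMass ρ f (by omega : n - 1 ≤ M) h1,
      ih (by omega : n - 1 ≤ M) h1]

omit [MeasurableSpace α] [MeasurableSingletonClass α] [Nonempty α] [IsProbabilityMeasure ρ] hρ in
lemma matchMass_node_le (M n : ℕ) (w : α → ℝ≥0) (s : α → List α → α → ℝ≥0) (a : α) (v : List α) :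
    matchMass f (M + 1) n (node w s) (a :: v) ≤
      ∑ a', (w a' : ℝ≥0∞) * matchMass f M (n - 1) (s a') v := by
  simp only [matchMass, wsum_succ, mul_wsum]
  refine Finset.sum_le_sum fun a' _ => wsum_le fun v' _ => ?_
  by_cases h : (v'.map f).take (n - 1) = (v.map f).take (n - 1)
  · rw [if_pos h]
    split_ifs
    · simp [wt]
    · exact zero_le
  · rw [if_neg h, if_neg]
    · simp
    · intro h'
      cases n with
      | zero => simp at h
      | succ n => simp at h'; exact h h'.2

/-- The many-to-two inequality: given the spine, the subtrees leaving it are independent of it. -/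
lemma lintegral_wsum_path_mul_matchMass_le {M n : ℕ} (hn : n ≤ M)
    {G : (ℕ → α × (α → ℝ≥0)) → ℝ≥0∞} (hG : Measurable G) (hM : DependsOn G (Set.Iio M)) :
    ∫⁻ t, wsum M (fun v => Qt t v * G (path t v) * matchMass f M n t v) ∂treeLaw ρ ≤
      ∫⁻ e, G e * spineBound ρ f M n e ∂(Measure.infinitePi fun _ : ℕ => stepLaw ρ) := by
  have := isProbabilityMeasure_stepLaw ρ hρ
  induction M generalizing G n with
  | zero =>
    obtain rfl : n = 0 := by omega
    have h1 : ∀ e, G e = G fun _ => (Classical.arbitrary α, 0) := fun e => hM fun i hi => by simp at hi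
    simp only [h1, wsum_zero]
    simp [wt, matchMass, spineBound]
  | succ M ih =>
    have hn' : n - 1 ≤ M := by omega
    have hQG : ∀ (G : (ℕ → α × (α → ℝ≥0)) → ℝ≥0∞), Measurable G → ∀ v : List α,
        Measurable fun t : List α → α → ℝ≥0 => Qt t v * G (path t v) :=
      fun G hG v => (measurable_Qt v).mul (hG.comp (measurable_path v))
    have hc : ∀ x, Measurable fun e => G (consSeq x e) := fun x =>
      hG.comp (measurable_consSeq.comp measurable_prodMk_left)
    have hd : ∀ x, DependsOn (fun e => G (consSeq x e)) (Set.Iio M) := fun x =>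
      dependsOn_comp_consSeq hM x
    have hm1 : Measurable fun t : List α → α → ℝ≥0 =>
        wsum (M + 1) fun v => Qt t v * G (path t v) * matchMass f (M + 1) n t v :=
      measurable_wsum fun v => (hQG G hG v).mul (measurable_matchMass f _ _ v)
    have hm2 : Measurable fun e => G e * spineBound ρ f (M + 1) n e :=
      hG.mul (measurable_spineBound ρ f _ _)
    rw [lintegral_treeLaw ρ hm1, lintegral_pathLaw ρ hρ hm2]
    refine lintegral_mono fun w => ?_
    -- the pairs of words whose first letters are `a` and `a'`
    let T : α → α → (α → List α → α → ℝ≥0) → ℝ≥0∞ := fun a a' s =>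
      wsum M fun v => Qt (s a) v * G (consSeq (a, w) (path (s a) v)) * matchMass f M (n - 1) (s a') v
    have hT : ∀ a a', Measurable (T a a') := fun a a' => measurable_wsum fun v =>
      ((hQG _ (hc (a, w)) v).comp (measurable_pi_apply a)).mul
        ((measurable_matchMass f M (n - 1) v).comp (measurable_pi_apply a'))
    have h1 : ∀ s, wsum (M + 1) (fun v => Qt (node w s) v * G (path (node w s) v) *
        matchMass f (M + 1) n (node w s) v) ≤ ∑ a, (w a : ℝ≥0∞) * ∑ a', (w a' : ℝ≥0∞) * T a a' s := by
      intro s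
      rw [wsum_succ]
      refine Finset.sum_le_sum fun a _ => ?_
      simp only [T, mul_wsum, ← wsum_sum_comm]
      refine wsum_le fun v _ => ?_
      calc _ ≤ Qt (node w s) (a :: v) * G (path (node w s) (a :: v)) *
            ∑ a', (w a' : ℝ≥0∞) * matchMass f M (n - 1) (s a') v := by
            gcongr; exact matchMass_node_le f M n w s a v
        _ = _ := by
            simp only [wt, path, node_nil, sub_node, Finset.mul_sum]
            exact Finset.sum_congr rfl fun a' _ => by ring
    have hdiag : ∀ a, ∫⁻ s, T a a s ∂(Measure.pi fun _ : α => treeLaw ρ) ≤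
        ∫⁻ e, G (consSeq (a, w) e) * spineBound ρ f M (n - 1) e
          ∂(Measure.infinitePi fun _ : ℕ => stepLaw ρ) := by
      intro a
      refine le_trans (le_of_eq ?_) (ih hn' (hc (a, w)) (hd (a, w)))
      exact lintegral_pi_eval ρ (measurable_wsum fun v => (hQG _ (hc (a, w)) v).mul
        (measurable_matchMass f M (n - 1) v)) a
    have hoff : ∀ a a', a ≠ a' → ∫⁻ s, T a a' s ∂(Measure.pi fun _ : α => treeLaw ρ) =
        ∫⁻ e, G (consSeq (a, w) e) * spineMass ρ f (n - 1) e
          ∂(Measure.infinitePi fun _ : ℕ => stepLaw ρ) := by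
      intro a a' haa
      have hm3 : Measurable fun e => G (consSeq (a, w) e) * spineMass ρ f (n - 1) e :=
        (hc (a, w)).mul (measurable_spineMass ρ f (n - 1))
      have hd3 : DependsOn (fun e => G (consSeq (a, w) e) * spineMass ρ f (n - 1) e) (Set.Iio M) :=
        fun e e' h => congrArg₂ (· * ·) (hd (a, w) h) (dependsOn_spineMass ρ f hn' h)
      rw [← lintegral_wsum_path ρ hρ M hm3 hd3]
      rw [lintegral_wsum, lintegral_wsum]
      rotate_left
      · exact fun v => hQG _ hm3 v
      · exact fun v => ((hQG _ (hc (a, w)) v).comp (measurable_pi_apply a)).mul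
          ((measurable_matchMass f M (n - 1) v).comp (measurable_pi_apply a'))
      refine wsum_congr fun v hv => ?_
      rw [lintegral_pi_mul ρ (hQG _ (hc (a, w)) v) (measurable_matchMass f M (n - 1) v) haa,
        ← lintegral_mul_const _ (hQG _ (hc (a, w)) v)]
      refine lintegral_congr fun t => ?_
      rw [lintegral_matchMass ρ hρ f hn' v hv t, mul_assoc]
    calc _ ≤ ∫⁻ s, ∑ a, (w a : ℝ≥0∞) * ∑ a', (w a' : ℝ≥0∞) * T a a' s
          ∂(Measure.pi fun _ : α => treeLaw ρ) := lintegral_mono h1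
      _ = ∑ a, (w a : ℝ≥0∞) * ∑ a', (w a' : ℝ≥0∞) *
          ∫⁻ s, T a a' s ∂(Measure.pi fun _ : α => treeLaw ρ) := by
          rw [lintegral_finsetSum _ fun a _ =>
            (Finset.measurable_fun_sum _ fun a' _ => (hT a a').const_mul _).const_mul _]
          refine Finset.sum_congr rfl fun a _ => ?_
          rw [lintegral_const_mul _ (Finset.measurable_fun_sum _ fun a' _ => (hT a a').const_mul _),
            lintegral_finsetSum _ fun a' _ => (hT a a').const_mul _]
          congr 1
          exact Finset.sum_congr rfl fun a' _ => lintegral_const_mul _ (hT a a')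
      _ ≤ _ := by
          refine Finset.sum_le_sum fun a _ => ?_
          gcongr
          simp only [spineBound, consSeq_zero, shift_consSeq, mul_add]
          have hb1 : Measurable fun e => G (consSeq (a, w) e) * spineMass ρ f (n - 1) e :=
            (hc (a, w)).mul (measurable_spineMass ρ f (n - 1))
          have hb2 : Measurable fun e => G (consSeq (a, w) e) * spineBound ρ f M (n - 1) e :=
            (hc (a, w)).mul (measurable_spineBound ρ f M (n - 1))
          have hre : ∫⁻ e, (G (consSeq (a, w) e) * ((∑ a', (w a' : ℝ≥0∞)) * spineMass ρ f (n - 1) e) +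
              G (consSeq (a, w) e) * (w a * spineBound ρ f M (n - 1) e))
              ∂(Measure.infinitePi fun _ : ℕ => stepLaw ρ) =
              (∑ a', (w a' : ℝ≥0∞)) * ∫⁻ e, G (consSeq (a, w) e) * spineMass ρ f (n - 1) e
                ∂(Measure.infinitePi fun _ : ℕ => stepLaw ρ) +
              w a * ∫⁻ e, G (consSeq (a, w) e) * spineBound ρ f M (n - 1) e
                ∂(Measure.infinitePi fun _ : ℕ => stepLaw ρ) := by
            rw [← lintegral_const_mul _ hb1, ← lintegral_const_mul _ hb2,
              ← lintegral_add_left (hb1.const_mul _)]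
            exact lintegral_congr fun e => by ring
          rw [hre, Finset.sum_mul]
          rw [← Finset.add_sum_erase _ _ (Finset.mem_univ a), add_comm]
          refine add_le_add ?_ (by gcongr; exact hdiag a)
          refine (Finset.sum_le_sum fun a' ha' => ?_).trans
            (Finset.sum_le_sum_of_subset (Finset.erase_subset a Finset.univ))
          rw [hoff a a' (Finset.ne_of_mem_erase ha').symm]

end Spine

/-! ### Laws of large numbers along the spine -/

section Deterministic

lemma exists_abs_sub_le_of_tendsto {a : ℕ → ℝ} {L : ℝ}
    (h : Tendsto (fun n : ℕ => a n / n) atTop (𝓝 L)) {η : ℝ} (hη : 0 < η) :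
    ∃ A, 0 ≤ A ∧ ∀ n : ℕ, |a n - n * L| ≤ A + η * n := by
  obtain ⟨N, hN⟩ := (Metric.tendsto_atTop.1 h η hη)
  refine ⟨∑ n ∈ Finset.range (N + 1), |a n - n * L|, Finset.sum_nonneg fun _ _ => abs_nonneg _,
    fun n => ?_⟩
  by_cases hn : n < N + 1
  · have := Finset.single_le_sum (f := fun n : ℕ => |a n - n * L|) (fun _ _ => abs_nonneg _)
      (Finset.mem_range.2 hn)
    have h2 : 0 ≤ η * n := by positivity
    linarith
  · have hn0 : (0 : ℝ) < n := by exact_mod_cast (show 0 < n by omega)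
    have := (hN n (by omega)).le
    rw [Real.dist_eq] at this
    have h3 : a n - n * L = n * (a n / n - L) := by field_simp
    rw [h3, abs_mul, abs_of_pos hn0]
    have h4 : 0 ≤ ∑ n ∈ Finset.range (N + 1), |a n - n * L| :=
      Finset.sum_nonneg fun _ _ => abs_nonneg _
    nlinarith

/-- Exponential bounds for the terms of `spineBound`, from the growth rates of the partial sums `s`,
`y` and `u` of the logarithms of its factors. -/
lemma exists_exp_bound {s y u : ℕ → ℝ} {h c H d : ℝ}
    (hs : Tendsto (fun n : ℕ => s n / n) atTop (𝓝 (-h)))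
    (hy : Tendsto (fun n : ℕ => y n / n) atTop (𝓝 c))
    (hu : Tendsto (fun n : ℕ => u n / n) atTop (𝓝 (-H)))
    (hh : 0 < h) (hdh : d < h) (hdH : d < H) :
    ∃ C η : ℝ, 0 < η ∧
      (∀ M n : ℕ, n ≤ M → s M ≤ C - n * d) ∧
      (∀ j n : ℕ, n ≤ j → s j + (y (j + 1) - y j) ≤ C - n * d - η * j) ∧
      (∀ j n : ℕ, j + 1 ≤ n → s j + (y (j + 1) - y j) + (u n - u (j + 1)) ≤ C - n * d - η * j) := by
  -- at most `6 * η * j` is lost to the deviations of the averages and to the term `-η * j` which makes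
  -- the sum over `j` converge
  obtain ⟨η, hη, h1, h2, h3⟩ : ∃ η : ℝ, 0 < η ∧ 4 * η ≤ h ∧ d + 6 * η ≤ h ∧ d + 6 * η ≤ H := by
    refine ⟨min (h / 4) (min ((h - d) / 6) ((H - d) / 6)), ?_, ?_, ?_, ?_⟩
    · exact lt_min (by linarith) (lt_min (by linarith) (by linarith))
    · linarith [min_le_left (h / 4) (min ((h - d) / 6) ((H - d) / 6))]
    · linarith [(min_le_right (h / 4) (min ((h - d) / 6) ((H - d) / 6))).trans (min_le_left _ _)]
    · linarith [(min_le_right (h / 4) (min ((h - d) / 6) ((H - d) / 6))).trans (min_le_right _ _)]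
  obtain ⟨A, hA0, hA⟩ := exists_abs_sub_le_of_tendsto hs hη
  obtain ⟨B, hB0, hB⟩ := exists_abs_sub_le_of_tendsto hy hη
  obtain ⟨D, hD0, hD⟩ := exists_abs_sub_le_of_tendsto hu hη
  have hs' : ∀ j : ℕ, s j ≤ A - j * h + η * j := fun j => by
    have := (abs_le.1 (hA j)).2; linarith
  have hy' : ∀ j : ℕ, y (j + 1) - y j ≤ |c| + 2 * B + η + 2 * (η * j) := fun j => by
    have e1 := (abs_le.1 (hB (j + 1))).2
    have e2 := (abs_le.1 (hB j)).1
    have := le_abs_self c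
    push_cast at e1
    linarith
  have hu' : ∀ n j : ℕ, u n - u (j + 1) ≤ -(n * H) + j * H + |H| + 2 * D + η * n + η * j + η := by
    intro n j
    have e1 := (abs_le.1 (hD n)).2
    have e2 := (abs_le.1 (hD (j + 1))).1
    have := le_abs_self H
    push_cast at e2
    linarith
  refine ⟨A + |c| + 2 * B + 2 * η + |H| + 2 * D, η, hη, ?_, ?_, ?_⟩
  · intro M n hn
    have hn' : (n : ℝ) ≤ M := by exact_mod_cast hn
    have e1 := hs' M
    have e2 : (M : ℝ) * (h - η) ≥ n * (h - η) := by gcongr; linarith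
    have e3 : (n : ℝ) * (h - η) ≥ n * d := by gcongr; linarith
    have := abs_nonneg c; have := abs_nonneg H
    linarith
  · intro j n hn
    have hn' : (n : ℝ) ≤ j := by exact_mod_cast hn
    have e2 : (j : ℝ) * (h - 4 * η) ≥ n * (h - 4 * η) := by gcongr
    have e3 : (n : ℝ) * (h - 4 * η) ≥ n * d := by gcongr; linarith
    have := hs' j; have := hy' j; have := abs_nonneg H
    linarith
  · intro j n hn
    have hn' : (j : ℝ) ≤ n := by exact_mod_cast (show j ≤ n by omega)
    have e2 : (j : ℝ) * h ≥ j * (d + 6 * η) := by gcongr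
    have e3 : ((n : ℝ) - j) * H ≥ (n - j) * (d + 6 * η) := by
      have : (0 : ℝ) ≤ n - j := by linarith
      gcongr
    have e4 : η * j ≤ η * n := by gcongr
    have := hs' j; have := hy' j; have := hu' n j
    linarith

end Deterministic

section SpineLimits

variable {α β : Type*} [Fintype α] [Fintype β] [MeasurableSpace α] [MeasurableSingletonClass α]
variable (ρ : Measure (α → ℝ≥0)) [IsProbabilityMeasure ρ]

/-- Integrability and integrals under `stepLaw` are those of the weighted sums over the letters. -/
lemma integrable_stepLaw {φ : α × (α → ℝ≥0) → ℝ} (hφ : Measurable φ)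
    (h : ∀ a, Integrable (fun w : α → ℝ≥0 => (w a : ℝ) * φ (a, w)) ρ) :
    Integrable φ (stepLaw ρ) ∧ ∫ x, φ x ∂stepLaw ρ = ∫ w, ∑ a, (w a : ℝ) * φ (a, w) ∂ρ := by
  have hw : ∀ a : α, Measurable fun w : α → ℝ≥0 => w a := fun a => measurable_pi_apply a
  have hφa : ∀ a, Measurable fun w : α → ℝ≥0 => φ (a, w) := fun a => hφ.comp (by fun_prop)
  have h1 : ∀ a, Integrable φ ((ρ.withDensity fun w => (w a : ℝ≥0∞)).map fun w => (a, w)) := by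
    intro a
    rw [integrable_map_measure hφ.aestronglyMeasurable (by fun_prop)]
    exact (integrable_withDensity_iff_integrable_smul (hw a)).2 (by simpa [NNReal.smul_def] using h a)
  refine ⟨?_, ?_⟩
  · rw [stepLaw, integrable_finsetSum_measure]
    exact fun a _ => h1 a
  · rw [stepLaw, integral_finsetSum_measure fun a _ => h1 a, integral_finsetSum _ fun a _ => h a]
    refine Finset.sum_congr rfl fun a _ => ?_
    rw [integral_map (by fun_prop) hφ.aestronglyMeasurable,
      integral_withDensity_eq_integral_smul (hw a)]
    simp [NNReal.smul_def]

/-- The strong law of large numbers along the coordinates of a product measure. -/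
lemma ae_tendsto_average {E : Type*} [MeasurableSpace E] (μ : Measure E) [IsProbabilityMeasure μ]
    {φ : E → ℝ} (hφ : Measurable φ) (hint : Integrable φ μ) :
    ∀ᵐ e ∂(Measure.infinitePi fun _ : ℕ => μ),
      Tendsto (fun n : ℕ => (∑ i ∈ Finset.range n, φ (e i)) / n) atTop (𝓝 (∫ x, φ x ∂μ)) := by
  have hmp : ∀ i : ℕ, MeasurePreserving (fun e : ℕ → E => e i) (Measure.infinitePi fun _ : ℕ => μ) μ :=
    fun i => measurePreserving_eval_infinitePi (fun _ : ℕ => μ) i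
  have h := strong_law_ae_real (μ := Measure.infinitePi fun _ : ℕ => μ)
    (fun i (e : ℕ → E) => φ (e i)) ((hmp 0).integrable_comp_of_integrable hint)
    (fun i j hij => (iIndepFun_infinitePi (P := fun _ : ℕ => μ) (X := fun _ => φ)
      fun _ => hφ).indepFun hij)
    (fun i => ?_)
  · have e0 : ∫ e, φ (e 0) ∂(Measure.infinitePi fun _ : ℕ => μ) = ∫ x, φ x ∂μ := by
      rw [← (hmp 0).map_eq, integral_map (hmp 0).measurable.aemeasurable hφ.aestronglyMeasurable]
      rw [(hmp 0).map_eq]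
    rwa [e0] at h
  · refine ⟨(hφ.comp (measurable_pi_apply i)).aemeasurable,
      (hφ.comp (measurable_pi_apply 0)).aemeasurable, ?_⟩
    have : ∀ i : ℕ, (Measure.infinitePi fun _ : ℕ => μ).map (fun e => φ (e i)) = μ.map φ := fun i => by
      rw [← (hmp i).map_eq, Measure.map_map hφ (measurable_pi_apply i), (hmp i).map_eq]; rfl
    rw [this, this]

variable (hρ : ∫⁻ w, ∑ a, (w a : ℝ≥0∞) ∂ρ = 1)
  (hint : ∀ a, Integrable (fun w : α → ℝ≥0 => Real.negMulLog (w a)) ρ)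
include hρ

omit [MeasurableSpace α] [MeasurableSingletonClass α] [Fintype β] in
lemma letterMass_eq (f : α → β) (b : β) : letterMass ρ f b = ENNReal.ofReal (marginal ρ f b) := by
  rw [letterMass, marginal, ofReal_integral_eq_lintegral_ofReal]
  · refine lintegral_congr fun w => ?_
    rw [ENNReal.ofReal_sum_of_nonneg fun a _ => by split_ifs <;> simp]
    refine Finset.sum_congr rfl fun a _ => ?_
    split_ifs <;> simp
  · refine integrable_finsetSum _ fun a _ => ?_
    split_ifs
    · exact integrable_weight ρ hρ a
    · exact integrable_zero _ _ _
  · exact .of_forall fun w => Finset.sum_nonneg fun a _ => by split_ifs <;> simp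

lemma ae_stepLaw_pos (f : α → β) :
    ∀ᵐ x ∂stepLaw ρ, 0 < x.2 x.1 ∧ 0 < marginal ρ f (f x.1) := by
  have hm : Measurable fun x : α × (α → ℝ≥0) => x.2 x.1 :=
    measurable_from_prod_countable_right fun a => by fun_prop
  have hm2 : Measurable fun x : α × (α → ℝ≥0) => marginal ρ f (f x.1) :=
    (measurable_of_finite fun a : α => marginal ρ f (f a)).comp measurable_fst
  have hs1 : MeasurableSet {x : α × (α → ℝ≥0) | x.2 x.1 = 0} := hm (measurableSet_singleton 0)
  have hs2 : MeasurableSet {x : α × (α → ℝ≥0) | marginal ρ f (f x.1) = 0} :=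
    hm2 (measurableSet_singleton 0)
  have h1 : stepLaw ρ {x | x.2 x.1 = 0} = 0 := by
    rw [← lintegral_indicator_one hs1, lintegral_stepLaw ρ (measurable_one.indicator hs1)]
    simp only [Set.indicator_apply, Set.mem_ofPred_eq]
    rw [← lintegral_zero]
    refine lintegral_congr fun w => Finset.sum_eq_zero fun a _ => ?_
    by_cases h : w a = 0 <;> simp [h]
  have h2 : stepLaw ρ {x | marginal ρ f (f x.1) = 0} = 0 := by
    rw [← lintegral_indicator_one hs2, lintegral_stepLaw ρ (measurable_one.indicator hs2)]
    simp only [Set.indicator_apply, Set.mem_ofPred_eq]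
    rw [lintegral_finsetSum _ fun a _ => by
      split_ifs <;> fun_prop]
    refine Finset.sum_eq_zero fun a _ => ?_
    by_cases h : marginal ρ f (f a) = 0
    · have h3 := letterMass_eq ρ hρ f (f a)
      rw [h, ENNReal.ofReal_zero] at h3
      simp only [h, if_true, Pi.one_apply, mul_one]
      refine le_antisymm (h3 ▸ lintegral_mono fun w => ?_) zero_le
      have := Finset.single_le_sum (f := fun a' => if f a' = f a then (w a' : ℝ≥0∞) else 0)
        (fun _ _ => zero_le) (Finset.mem_univ a)
      simpa using this
    · simp [h]
  have h1' : ∀ᵐ x ∂stepLaw ρ, ¬ x.2 x.1 = 0 := by rw [ae_iff]; simpa using h1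
  have h2' : ∀ᵐ x ∂stepLaw ρ, ¬ marginal ρ f (f x.1) = 0 := by rw [ae_iff]; simpa using h2
  filter_upwards [h1', h2'] with x hx1 hx2
  exact ⟨pos_iff_ne_zero.2 hx1, (marginal_nonneg ρ f _).lt_of_ne' hx2⟩

omit [MeasurableSpace α] [MeasurableSingletonClass α] in
include hint in
/-- The bound `𝔼 (X log⁺ X) < ∞` for `X = ∑_a W_a`. -/
lemma integrable_mul_log_one_add_sum (a : α) :
    Integrable (fun w : α → ℝ≥0 => (w a : ℝ) * Real.log (1 + ∑ b, (w b : ℝ))) ρ := by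
  set k := (Fintype.card α : ℝ)
  have hk : 0 ≤ k := by positivity
  have hg : Integrable (fun w : α → ℝ≥0 => ∑ b, ((w b : ℝ) * (Real.log (1 + k) + Real.log 2) +
      |Real.negMulLog (w b)|)) ρ :=
    integrable_finsetSum _ fun b _ => ((integrable_weight ρ hρ b).mul_const _).add (hint b).abs
  refine hg.mono' (Measurable.aestronglyMeasurable (by fun_prop)) (.of_forall fun w => ?_)
  obtain ⟨b, -, hb⟩ := Finset.exists_max_image Finset.univ (fun b => (w b : ℝ)) ⟨a, Finset.mem_univ a⟩
  have hw0 : ∀ c, (0 : ℝ) ≤ w c := fun c => (w c).coe_nonneg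
  have hsum : ∑ c, (w c : ℝ) ≤ k * w b := by
    have := Finset.sum_le_card_nsmul Finset.univ (fun c => (w c : ℝ)) (w b) fun c hc => hb c hc
    simpa [nsmul_eq_mul] using this
  have hsum0 : 0 ≤ ∑ c, (w c : ℝ) := Finset.sum_nonneg fun c _ => hw0 c
  have hlog : Real.log (1 + ∑ c, (w c : ℝ)) ≤ Real.log (1 + k) + Real.log (1 + w b) := by
    rw [← Real.log_mul (by positivity) (by have := hw0 b; positivity)]
    refine Real.log_le_log (by positivity) ?_
    have := hw0 b
    nlinarith
  have hlog0 : 0 ≤ Real.log (1 + ∑ c, (w c : ℝ)) := Real.log_nonneg (by linarith)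
  have hx : (w b : ℝ) * Real.log (1 + w b) ≤ w b * Real.log 2 + |Real.negMulLog (w b)| := by
    rcases le_total (w b : ℝ) 1 with h1 | h1
    · have : Real.log (1 + w b) ≤ Real.log 2 :=
        Real.log_le_log (by have := hw0 b; positivity) (by linarith)
      have := mul_le_mul_of_nonneg_left this (hw0 b)
      linarith [abs_nonneg (Real.negMulLog (w b))]
    · have : Real.log (1 + w b) ≤ Real.log 2 + Real.log (w b) := by
        rw [← Real.log_mul (by norm_num) (by linarith)]
        exact Real.log_le_log (by linarith) (by linarith)
      have h2 := mul_le_mul_of_nonneg_left this (hw0 b)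
      have h3 := neg_le_abs (Real.negMulLog (w b))
      rw [Real.negMulLog] at h3 ⊢
      linarith
  rw [Real.norm_eq_abs, abs_of_nonneg (mul_nonneg (hw0 a) hlog0)]
  have hnn : ∀ c, 0 ≤ (w c : ℝ) * (Real.log (1 + k) + Real.log 2) + |Real.negMulLog (w c)| := by
    intro c
    have := Real.log_nonneg (show (1 : ℝ) ≤ 1 + k by linarith)
    have := Real.log_nonneg (show (1 : ℝ) ≤ 2 by norm_num)
    have := hw0 c
    positivity
  refine le_trans ?_ (Finset.single_le_sum (f := fun c => (w c : ℝ) * (Real.log (1 + k) + Real.log 2) +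
    |Real.negMulLog (w c)|) (fun c _ => hnn c) (Finset.mem_univ b))
  calc (w a : ℝ) * Real.log (1 + ∑ c, (w c : ℝ)) ≤ w b * Real.log (1 + ∑ c, (w c : ℝ)) :=
        mul_le_mul_of_nonneg_right (hb a (Finset.mem_univ a)) hlog0
    _ ≤ w b * (Real.log (1 + k) + Real.log (1 + w b)) := mul_le_mul_of_nonneg_left hlog (hw0 b)
    _ ≤ _ := by linarith

omit hρ [IsProbabilityMeasure ρ] [MeasurableSpace α] [MeasurableSingletonClass α] [Fintype β] in
/-- The recursion for `spineBound` unfolded: `j` is the generation at which the spine is left. -/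
lemma spineBound_eq (f : α → β) (M n : ℕ) (e : ℕ → α × (α → ℝ≥0)) :
    spineBound ρ f M n e = ∑ j ∈ Finset.range M, (∏ i ∈ Finset.range j, ((e i).2 (e i).1 : ℝ≥0∞)) *
      (∑ a, ((e j).2 a : ℝ≥0∞)) * ∏ l ∈ Finset.Ico (j + 1) n, letterMass ρ f (f (e l).1) +
      ∏ i ∈ Finset.range M, ((e i).2 (e i).1 : ℝ≥0∞) := by
  induction M generalizing n e with
  | zero => simp [spineBound]
  | succ M ih =>
    rw [spineBound, ih, Finset.sum_range_succ', Finset.prod_range_succ' _ M]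
    simp only [Finset.prod_range_succ' _ _, Finset.range_zero, Finset.prod_empty, one_mul, shift,
      spineMass]
    have h1 : ∏ l ∈ Finset.range (n - 1), letterMass ρ f (f (e (l + 1)).1) =
        ∏ l ∈ Finset.Ico (0 + 1) n, letterMass ρ f (f (e l).1) := by
      rw [Finset.prod_Ico_eq_prod_range]
      exact Finset.prod_congr rfl fun l _ => by rw [add_comm l 1]
    have h2 : ∀ j, ∏ l ∈ Finset.Ico (j + 1) (n - 1), letterMass ρ f (f (e (l + 1)).1) =
        ∏ l ∈ Finset.Ico (j + 1 + 1) n, letterMass ρ f (f (e l).1) := by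
      intro j
      rw [Finset.prod_Ico_eq_prod_range, Finset.prod_Ico_eq_prod_range]
      rw [show n - 1 - (j + 1) = n - (j + 1 + 1) by omega]
      exact Finset.prod_congr rfl fun l _ => by
        rw [show j + 1 + l + 1 = j + 1 + 1 + l by omega]
    rw [mul_add, Finset.mul_sum, h1]
    simp only [h2]
    rw [add_comm, add_right_comm]
    congr 1
    · congr 1
      · exact Finset.sum_congr rfl fun j _ => by ring
    · ring

include hint in
/-- Along almost every spine, the conditional means of the masses of the projected cylinders decay
exponentially. -/
lemma ae_exists_spineBound_le (f : α → β) {d : ℝ} (h0 : 0 < weightEntropy ρ)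
    (hd1 : d < weightEntropy ρ) (hd2 : d < ∑ b, Real.negMulLog (marginal ρ f b)) :
    ∀ᵐ e ∂(Measure.infinitePi fun _ : ℕ => stepLaw ρ), ∃ C : ℝ≥0, ∀ M n : ℕ, n ≤ M →
      spineBound ρ f M n e ≤ C * ENNReal.ofReal (Real.exp (-(n * d))) := by
  have := isProbabilityMeasure_stepLaw ρ hρ
  have hm1 : Measurable fun x : α × (α → ℝ≥0) => Real.log (x.2 x.1 : ℝ) := by
    have : Measurable fun x : α × (α → ℝ≥0) => x.2 x.1 :=
      measurable_from_prod_countable_right fun a => by fun_prop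
    fun_prop
  have hm2 : Measurable fun x : α × (α → ℝ≥0) => Real.log (1 + ∑ b, (x.2 b : ℝ)) := by fun_prop
  have hm3 : Measurable fun x : α × (α → ℝ≥0) => Real.log (marginal ρ f (f x.1)) :=
    (measurable_of_finite fun a : α => Real.log (marginal ρ f (f a))).comp measurable_fst
  obtain ⟨hi1, he1⟩ := integrable_stepLaw ρ hm1 fun a => by
    simpa [Real.negMulLog] using (hint a).neg
  obtain ⟨hi2, -⟩ := integrable_stepLaw ρ hm2 (integrable_mul_log_one_add_sum ρ hρ hint)
  obtain ⟨hi3, he3⟩ := integrable_stepLaw ρ hm3 fun a => (integrable_weight ρ hρ a).mul_const (Real.log (marginal ρ f (f a)))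
  have hE1 : ∫ x, Real.log (x.2 x.1 : ℝ) ∂stepLaw ρ = -weightEntropy ρ := by
    rw [he1, weightEntropy, ← integral_neg]
    refine integral_congr_ae (.of_forall fun w => ?_)
    simp [Real.negMulLog]
  have hE3 : ∫ x : α × (α → ℝ≥0), Real.log (marginal ρ f (f x.1)) ∂stepLaw ρ =
      -∑ b, Real.negMulLog (marginal ρ f b) := by
    rw [he3, integral_sum_weight_mul_comp ρ hρ f fun b => Real.log (marginal ρ f b),
      ← Finset.sum_neg_distrib]
    exact Finset.sum_congr rfl fun b _ => by rw [Real.negMulLog]; ring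
  have hall : ∀ᵐ e ∂(Measure.infinitePi fun _ : ℕ => stepLaw ρ), ∀ i,
      0 < (e i).2 (e i).1 ∧ 0 < marginal ρ f (f (e i).1) := by
    refine ae_all_iff.2 fun i => ?_
    exact (measurePreserving_eval_infinitePi (fun _ : ℕ => stepLaw ρ) i).quasiMeasurePreserving.ae
      (ae_stepLaw_pos ρ hρ f)
  filter_upwards [hall, ae_tendsto_average _ hm1 hi1, ae_tendsto_average _ hm2 hi2,
    ae_tendsto_average _ hm3 hi3] with e hpos ht1 ht2 ht3
  rw [hE1] at ht1
  rw [hE3] at ht3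
  -- the logarithms of the products of weights, of the total weights and of the projected mean weights
  -- along the spine grow linearly
  obtain ⟨C, η, hη, hC1, hC2, hC3⟩ := exists_exp_bound ht1 ht2 ht3 h0 hd1 hd2
  have hW : ∀ j, ∏ i ∈ Finset.range j, ((e i).2 (e i).1 : ℝ≥0∞) =
      ENNReal.ofReal (Real.exp (∑ i ∈ Finset.range j, Real.log ((e i).2 (e i).1 : ℝ))) := by
    intro j
    rw [Real.exp_sum, ENNReal.ofReal_prod_of_nonneg fun _ _ => (Real.exp_pos _).le]
    refine Finset.prod_congr rfl fun i _ => ?_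
    rw [Real.exp_log (by exact_mod_cast (hpos i).1)]; simp
  have hX : ∀ j, ∑ a, ((e j).2 a : ℝ≥0∞) ≤ ENNReal.ofReal (Real.exp
      (∑ i ∈ Finset.range (j + 1), Real.log (1 + ∑ b, ((e i).2 b : ℝ)) -
        ∑ i ∈ Finset.range j, Real.log (1 + ∑ b, ((e i).2 b : ℝ)))) := by
    intro j
    rw [Finset.sum_range_succ_sub_sum, Real.exp_log (by positivity),
      ENNReal.ofReal_add zero_le_one (by positivity),
      ENNReal.ofReal_sum_of_nonneg fun _ _ => by positivity]
    simp
  have hR : ∀ j n, j + 1 ≤ n → ∏ l ∈ Finset.Ico (j + 1) n, letterMass ρ f (f (e l).1) =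
      ENNReal.ofReal (Real.exp (∑ i ∈ Finset.range n, Real.log (marginal ρ f (f (e i).1)) -
        ∑ i ∈ Finset.range (j + 1), Real.log (marginal ρ f (f (e i).1)))) := by
    intro j n hjn
    rw [← Finset.sum_Ico_eq_sub _ hjn, Real.exp_sum,
      ENNReal.ofReal_prod_of_nonneg fun _ _ => (Real.exp_pos _).le]
    refine Finset.prod_congr rfl fun i _ => ?_
    rw [Real.exp_log (hpos i).2, letterMass_eq ρ hρ]
  have hterm : ∀ j n, (∏ i ∈ Finset.range j, ((e i).2 (e i).1 : ℝ≥0∞)) *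
      (∑ a, ((e j).2 a : ℝ≥0∞)) * ∏ l ∈ Finset.Ico (j + 1) n, letterMass ρ f (f (e l).1) ≤
      ENNReal.ofReal (Real.exp (C - n * d)) * ENNReal.ofReal (Real.exp (-η)) ^ j := by
    intro j n
    rw [← ENNReal.ofReal_pow (Real.exp_pos _).le, ← Real.exp_nat_mul,
      ← ENNReal.ofReal_mul (Real.exp_pos _).le, ← Real.exp_add, hW]
    rcases le_or_gt n j with hnj | hnj
    · rw [Finset.Ico_eq_empty (by omega), Finset.prod_empty, mul_one]
      refine (mul_le_mul_right (hX j) _).trans ?_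
      rw [← ENNReal.ofReal_mul (Real.exp_pos _).le, ← Real.exp_add]
      refine ENNReal.ofReal_le_ofReal (Real.exp_le_exp.2 ?_)
      have := hC2 j n hnj
      linarith
    · rw [hR j n hnj]
      refine (mul_le_mul_left (mul_le_mul_right (hX j) _) _).trans ?_
      rw [← ENNReal.ofReal_mul (Real.exp_pos _).le, ← Real.exp_add,
        ← ENNReal.ofReal_mul (Real.exp_pos _).le, ← Real.exp_add]
      refine ENNReal.ofReal_le_ofReal (Real.exp_le_exp.2 ?_)
      have := hC3 j n hnj
      linarith
  have hgeo : (∑' j : ℕ, ENNReal.ofReal (Real.exp (-η)) ^ j) ≠ ∞ := by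
    rw [ENNReal.tsum_geometric]
    refine ENNReal.inv_ne_top.2 (tsub_pos_iff_lt.2 ?_).ne'
    rw [ENNReal.ofReal_lt_one]
    exact Real.exp_lt_one_iff.2 (by linarith)
  have hfin : ENNReal.ofReal (Real.exp C) * ((∑' j : ℕ, ENNReal.ofReal (Real.exp (-η)) ^ j) + 1) ≠ ∞ :=
    ENNReal.mul_ne_top ENNReal.ofReal_ne_top (by simpa using hgeo)
  refine ⟨(ENNReal.ofReal (Real.exp C) * ((∑' j : ℕ, ENNReal.ofReal (Real.exp (-η)) ^ j) + 1)).toNNReal,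
    fun M n hn => ?_⟩
  rw [ENNReal.coe_toNNReal hfin, spineBound_eq]
  have hsplit : ENNReal.ofReal (Real.exp (C - n * d)) =
      ENNReal.ofReal (Real.exp C) * ENNReal.ofReal (Real.exp (-(n * d))) := by
    rw [← ENNReal.ofReal_mul (Real.exp_pos _).le, ← Real.exp_add]; rfl
  calc _ ≤ ∑ j ∈ Finset.range M, ENNReal.ofReal (Real.exp (C - n * d)) *
          ENNReal.ofReal (Real.exp (-η)) ^ j + ENNReal.ofReal (Real.exp (C - n * d)) := by
        refine add_le_add (Finset.sum_le_sum fun j _ => hterm j n) ?_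
        rw [hW]
        exact ENNReal.ofReal_le_ofReal (Real.exp_le_exp.2 (hC1 M n hn))
    _ ≤ ENNReal.ofReal (Real.exp (C - n * d)) * (∑' j : ℕ, ENNReal.ofReal (Real.exp (-η)) ^ j) +
          ENNReal.ofReal (Real.exp (C - n * d)) := by
        rw [← Finset.mul_sum]; gcongr; exact ENNReal.sum_le_tsum _
    _ = _ := by rw [hsplit]; ring

end SpineLimits

/-! ### The lower bound for the entropy, and non-degeneracy -/

section LowerBound

variable {α β : Type*} [Fintype α] [Fintype β] [MeasurableSpace α] [MeasurableSingletonClass α]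
variable [Nonempty α]
variable (ρ : Measure (α → ℝ≥0)) [IsProbabilityMeasure ρ]

/-- The mass, for the weights of the first `M` generations, of the words of length `M` whose projected
cylinder of generation `n` has mass greater than `c`. -/
def heavyMass (f : α → β) (M n : ℕ) (c : ℝ≥0∞) (t : List α → α → ℝ≥0) : ℝ≥0∞ :=
  wsum M fun v => if c < matchMass f M n t v then Qt t v else 0

lemma measurable_heavyMass (f : α → β) (M n : ℕ) (c : ℝ≥0∞) :
    Measurable (heavyMass (α := α) f M n c) :=
  measurable_wsum fun v => Measurable.ite
    (measurableSet_lt measurable_const (measurable_matchMass f M n v)) (measurable_Qt v)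
    measurable_const

variable (hρ : ∫⁻ w, ∑ a, (w a : ℝ≥0∞) ∂ρ = 1)
  (hint : ∀ a, Integrable (fun w : α → ℝ≥0 => Real.negMulLog (w a)) ρ)
include hρ hint

/-- Truncated second-moment bound: spines along which `spineBound` is not controlled have small
probability, and on the others the many-to-two inequality and Markov's inequality apply. -/
lemma exists_lintegral_heavyMass_le (f : α → β) {d : ℝ} (h0 : 0 < weightEntropy ρ)
    (hd1 : d < weightEntropy ρ) (hd2 : d < ∑ b, Real.negMulLog (marginal ρ f b)) :
    ∃ η : ℕ → ℝ≥0∞, Tendsto η atTop (𝓝 0) ∧ ∀ (C M : ℕ) (S : Finset ℕ) (c : ℕ → ℝ≥0∞),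
      (∀ n ∈ S, n ≤ M) → (∀ n, c n ≠ 0) → (∀ n, c n ≠ ∞) →
      ∫⁻ t, (⨆ n ∈ S, heavyMass f M n (c n) t) ∂treeLaw ρ ≤
        η C + ∑ n ∈ S, C * ENNReal.ofReal (Real.exp (-(n * d))) / c n := by
  have := isProbabilityMeasure_stepLaw ρ hρ
  set Λ := Measure.infinitePi fun _ : ℕ => stepLaw ρ
  -- the spines along which the bound with the constant `C` fails; these events decrease to a null set
  set bad : ℕ → Set (ℕ → α × (α → ℝ≥0)) := fun C => {e | ∃ M n : ℕ, n ≤ M ∧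
    C * ENNReal.ofReal (Real.exp (-(n * d))) < spineBound ρ f M n e} with hbad
  have hmeas1 : ∀ (C M n : ℕ), MeasurableSet {e : ℕ → α × (α → ℝ≥0) |
      C * ENNReal.ofReal (Real.exp (-(n * d))) < spineBound ρ f M n e} := fun C M n =>
    measurableSet_lt measurable_const (measurable_spineBound ρ f M n)
  have hmeas : ∀ C, MeasurableSet (bad C) := by
    intro C
    have : bad C = ⋃ M : ℕ, ⋃ n : ℕ, ⋃ _ : n ≤ M, {e : ℕ → α × (α → ℝ≥0) |
      C * ENNReal.ofReal (Real.exp (-(n * d))) < spineBound ρ f M n e} := by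
      ext e; simp [hbad]
    rw [this]
    exact .iUnion fun M => .iUnion fun n => .iUnion fun _ => hmeas1 C M n
  refine ⟨fun C => Λ (bad C), ?_, ?_⟩
  · have hanti : Antitone bad := by
      intro C C' h e he
      obtain ⟨M, n, hn, he⟩ := he
      refine ⟨M, n, hn, lt_of_le_of_lt ?_ he⟩
      gcongr
    have h1 := tendsto_measure_iInter_atTop (μ := Λ) (fun C => (hmeas C).nullMeasurableSet) hanti
      ⟨0, measure_ne_top _ _⟩
    have h2 : Λ (⋂ C, bad C) = 0 := by
      have h3 := ae_exists_spineBound_le ρ hρ hint f h0 hd1 hd2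
      refine measure_mono_null ?_ (ae_iff.1 h3)
      intro e he
      simp only [Set.mem_iInter] at he
      simp only [Set.mem_ofPred_eq]
      rintro ⟨C, hC⟩
      obtain ⟨k, hk⟩ := exists_nat_ge C
      obtain ⟨M, n, hn, h⟩ := he k
      refine absurd (hC M n hn) (not_le.2 (lt_of_le_of_lt ?_ h))
      gcongr
      exact_mod_cast hk
    rwa [h2] at h1
  · intro C M S c hS hc0 hct
    set good : Set (ℕ → α × (α → ℝ≥0)) := {e | ∀ n ≤ M,
      spineBound ρ f M n e ≤ C * ENNReal.ofReal (Real.exp (-(n * d)))} with hgood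
    have hgm : MeasurableSet good := by
      have : good = ⋂ n : ℕ, ⋂ _ : n ≤ M, {e : ℕ → α × (α → ℝ≥0) |
        C * ENNReal.ofReal (Real.exp (-(n * d))) < spineBound ρ f M n e}ᶜ := by
        ext e; simp [hgood]
      rw [this]
      exact .iInter fun n => .iInter fun _ => (hmeas1 C M n).compl
    -- only the generations below `M` matter, as the many-to-one formula for words of length `M` requires
    have hdep : ∀ e e' : ℕ → α × (α → ℝ≥0), (∀ i ∈ Set.Iio M, e i = e' i) →
        (e ∈ good ↔ e' ∈ good) := by
      intro e e' h
      simp only [hgood, Set.mem_ofPred_eq]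
      refine forall₂_congr fun n hn => ?_
      rw [dependsOn_spineBound ρ f hn h]
    have hdep1 : DependsOn (good.indicator (1 : (ℕ → α × (α → ℝ≥0)) → ℝ≥0∞)) (Set.Iio M) := by
      intro e e' h
      simp only [Set.indicator_apply, hdep e e' h, Pi.one_apply]
    have hdep2 : DependsOn (goodᶜ.indicator (1 : (ℕ → α × (α → ℝ≥0)) → ℝ≥0∞)) (Set.Iio M) := by
      intro e e' h
      simp only [Set.indicator_apply, Set.mem_compl_iff, hdep e e' h, Pi.one_apply]
    have hG1 : Measurable (good.indicator (1 : (ℕ → α × (α → ℝ≥0)) → ℝ≥0∞)) :=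
      measurable_one.indicator hgm
    have hG2 : Measurable (goodᶜ.indicator (1 : (ℕ → α × (α → ℝ≥0)) → ℝ≥0∞)) :=
      measurable_one.indicator hgm.compl
    have hpt : ∀ t, (⨆ n ∈ S, heavyMass f M n (c n) t) ≤
        wsum M (fun v => Qt t v * goodᶜ.indicator 1 (path t v)) +
          ∑ n ∈ S, wsum M (fun v => Qt t v * good.indicator 1 (path t v) * matchMass f M n t v) /
            c n := by
      intro t
      refine iSup₂_le fun n hn => ?_
      calc heavyMass f M n (c n) t ≤ wsum M (fun v => Qt t v * goodᶜ.indicator 1 (path t v)) +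
            wsum M (fun v => Qt t v * good.indicator 1 (path t v) * matchMass f M n t v) / c n := by
            rw [div_eq_mul_inv, wsum_mul, ← wsum_add_distrib]
            refine wsum_le fun v _ => ?_
            split_ifs with h
            · by_cases hg : path t v ∈ good
              · simp only [Set.indicator_of_mem hg, Pi.one_apply, mul_one]
                rw [mul_assoc, ← div_eq_mul_inv]
                refine le_add_left ?_
                refine le_mul_of_one_le_right' ?_
                rw [ENNReal.le_div_iff_mul_le (Or.inl (hc0 n)) (Or.inl (hct n)), one_mul]
                exact h.le
              · simp [hg]
            · exact zero_le
        _ ≤ _ := by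
            gcongr
            exact Finset.single_le_sum (f := fun n => wsum M (fun v =>
              Qt t v * good.indicator 1 (path t v) * matchMass f M n t v) / c n)
              (fun _ _ => zero_le) hn
    refine (lintegral_mono hpt).trans ?_
    have hm1 : Measurable fun t : List α → α → ℝ≥0 =>
        wsum M (fun v => Qt t v * goodᶜ.indicator 1 (path t v)) :=
      measurable_wsum fun v => (measurable_Qt v).mul (hG2.comp (measurable_path v))
    have hm2 : ∀ n, Measurable fun t : List α → α → ℝ≥0 =>
        wsum M (fun v => Qt t v * good.indicator 1 (path t v) * matchMass f M n t v) := fun n =>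
      measurable_wsum fun v => ((measurable_Qt v).mul (hG1.comp (measurable_path v))).mul
        (measurable_matchMass f M n v)
    rw [lintegral_add_left hm1, lintegral_finsetSum _ fun n _ => (hm2 n).div_const _]
    refine add_le_add ?_ (Finset.sum_le_sum fun n hn => ?_)
    · rw [lintegral_wsum_path ρ hρ M hG2 hdep2, lintegral_indicator_one hgm.compl]
      refine measure_mono fun e he => ?_
      simp only [hgood, Set.mem_compl_iff, Set.mem_ofPred_eq, not_forall, not_le] at he
      obtain ⟨n, hn, h⟩ := he
      exact ⟨M, n, hn, h⟩
    · simp only [div_eq_mul_inv]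
      rw [lintegral_mul_const _ (hm2 n)]
      gcongr
      refine (lintegral_wsum_path_mul_matchMass_le ρ hρ f (hS n hn) hG1 hdep1).trans ?_
      calc ∫⁻ e, good.indicator 1 e * spineBound ρ f M n e ∂Λ ≤
            ∫⁻ e, C * ENNReal.ofReal (Real.exp (-(n * d))) ∂Λ := by
            refine lintegral_mono fun e => ?_
            by_cases he : e ∈ good
            · simpa [he] using he n (hS n hn)
            · simp [he]
        _ = _ := by simp

/-- Positive entropy makes the martingale of the masses uniformly integrable, hence its limit
non-degenerate. -/
lemma treeLaw_Y_ne_zero (h0 : 0 < weightEntropy ρ) : treeLaw ρ {t | Y t [] ≠ 0} ≠ 0 := by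
  intro hY
  have hYae : ∀ᵐ t ∂treeLaw ρ, Y t [] = 0 := by rw [ae_iff]; exact hY
  -- for the constant projection and `n = 0`, `heavyMass` is the part of the total mass where it exceeds
  -- `K`; `d = -1` is a value below the entropy `0` of the projection
  obtain ⟨η, hη, hb⟩ := exists_lintegral_heavyMass_le ρ hρ hint (fun _ : α => ()) (d := -1) h0
    (by linarith) (by
      have : marginal ρ (fun _ : α => ()) () = 1 := by
        simpa using sum_marginal ρ hρ (fun _ : α => ())
      simp [this])
  obtain ⟨C, hC⟩ := ((ENNReal.tendsto_nhds_zero.1 hη) (1 / 4) (by simp)).exists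
  set K : ℝ≥0∞ := 4 * (C + 1) with hK
  have hK0 : K ≠ 0 := by simp [hK]
  have hKt : K ≠ ∞ := by
    simp [hK, ENNReal.mul_eq_top]
  have hheavy : ∀ M, ∫⁻ t, heavyMass (fun _ : α => ()) M 0 K t ∂treeLaw ρ ≤ 1 / 4 + 1 / 4 := by
    intro M
    have := hb C M {0} (fun _ => K) (by simp) (fun _ => hK0) (fun _ => hKt)
    simp only [Finset.mem_singleton, iSup_iSup_eq_left, Finset.sum_singleton, Nat.cast_zero, zero_mul,
      neg_zero, Real.exp_zero, ENNReal.ofReal_one, mul_one] at this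
    refine this.trans (add_le_add hC ?_)
    rw [ENNReal.div_le_iff hK0 hKt, hK, ← mul_assoc]
    rw [ENNReal.div_mul_cancel (by norm_num) (by norm_num), one_mul]
    exact le_self_add
  have hsplit : ∀ M t, Yn t [] M ≤ min (Yn t [] M) K + heavyMass (fun _ : α => ()) M 0 K t := by
    intro M t
    have h1 : heavyMass (fun _ : α => ()) M 0 K t = if K < Yn t [] M then Yn t [] M else 0 := by
      have h2 : ∀ v, matchMass (fun _ : α => ()) M 0 t v = Yn t [] M := fun v => by
        simp [matchMass, Yn_eq]
      simp only [heavyMass, h2]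
      split_ifs
      · simp [Yn_eq]
      · simp [wsum]
    rw [h1]
    split_ifs with h
    · exact le_add_left le_rfl
    · rw [min_eq_left (not_lt.1 h)]; exact le_self_add
  have hlim : Tendsto (fun M => ∫⁻ t, min (Yn t [] M) K ∂treeLaw ρ) atTop (𝓝 0) := by
    have h1 := tendsto_lintegral_of_dominated_convergence (μ := treeLaw ρ)
      (F := fun M t => min (Yn t [] M) K) (f := fun _ => 0) (fun _ => K)
      (fun M => (measurable_Yn [] M).min measurable_const)
      (fun M => .of_forall fun t => min_le_right _ _) (by simpa using hKt) (by
        filter_upwards [ae_regular ρ hρ, hYae] with t ht h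
        have h2 := (ht []).1
        rw [h] at h2
        refine tendsto_of_tendsto_of_tendsto_of_le_of_le tendsto_const_nhds h2
          (fun _ => zero_le) fun M => min_le_left _ _)
    simpa using h1
  have hone : ∀ M, 1 ≤ ∫⁻ t, min (Yn t [] M) K ∂treeLaw ρ + (1 / 4 + 1 / 4) := by
    intro M
    refine (lintegral_Yn ρ hρ M).ge.trans ((lintegral_mono (hsplit M)).trans ?_)
    rw [lintegral_add_left ((measurable_Yn [] M).min measurable_const)]
    gcongr
    exact hheavy M
  have h2 : (1 : ℝ≥0∞) ≤ 0 + (1 / 4 + 1 / 4) :=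
    ge_of_tendsto' (hlim.add tendsto_const_nhds) hone
  have h3 := ENNReal.toReal_mono (by simp) h2
  rw [zero_add, ENNReal.toReal_add (by simp) (by simp)] at h3
  norm_num at h3

omit [MeasurableSpace α] [MeasurableSingletonClass α] [Nonempty α] [IsProbabilityMeasure ρ] hρ hint
omit [Fintype β] ρ in
lemma heavyMass_eq (f : α → β) [Fintype β] (n k : ℕ) (c : ℝ≥0∞) (t : List α → α → ℝ≥0) :
    heavyMass f (n + k) n c t = wsum n fun w : List β =>
      if c < (wsum n fun u => if u.map f = w then Qt t u * Yn t u k else 0) then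
        (wsum n fun u => if u.map f = w then Qt t u * Yn t u k else 0) else 0 := by
  have h1 : ∀ u v : List α, u.length = n → matchMass f (n + k) n t (u ++ v) =
      wsum n fun u' => if u'.map f = u.map f then Qt t u' * Yn t u' k else 0 := by
    intro u v hu
    rw [matchMass, wsum_add]
    refine wsum_congr fun u' hu' => ?_
    have h2 : ∀ x : List α, x.length = n → ∀ y : List α, ((x ++ y).map f).take n = x.map f := by
      intro x hx y; rw [List.map_append, List.take_left' (by simpa using hx)]
    simp only [h2 u hu, h2 u' hu']
    split_ifs with h
    · rw [Yn_eq, mul_wsum]; exact wsum_congr fun v' _ => wt_append _ _ _ _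
    · simp [wsum]
  rw [heavyMass, wsum_add]
  have h3 : ∀ u : List α, u.length = n → (wsum k fun v => if c < matchMass f (n + k) n t (u ++ v)
      then Qt t (u ++ v) else 0) =
      if c < (wsum n fun u' => if u'.map f = u.map f then Qt t u' * Yn t u' k else 0) then
        Qt t u * Yn t u k else 0 := by
    intro u hu
    simp only [h1 u _ hu]
    split_ifs with h
    · rw [Yn_eq, mul_wsum]; exact wsum_congr fun v' _ => wt_append _ _ _ _
    · simp [wsum]
  rw [wsum_congr h3, ← wsum_fiber f n]
  refine wsum_congr fun w _ => ?_
  split_ifs with h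
  · refine wsum_congr fun u _ => ?_
    split_ifs with h4 h5
    · rfl
    · rw [h4] at h5; exact absurd h h5
    · rfl
  · unfold wsum
    refine Finset.sum_eq_zero fun u _ => ?_
    dsimp only
    split_ifs with h4 h5
    · rw [h4] at h5; exact absurd h5 h
    · rfl
    · rfl

end LowerBound

/-! ### Passage to the limit measure -/

section LowerBound

variable {α β : Type*} [Fintype α] [Fintype β]

/-- The mass of the projected cylinder of `w`, a word of length `n`. -/
def projMass (f : α → β) (n : ℕ) (t : List α → α → ℝ≥0) (w : List β) : ℝ≥0∞ :=
  wsum n fun u => if u.map f = w then Qt t u * Y t u else 0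

/-- The mass carried by the projected cylinders of generation `n` of mass greater than `c`. -/
def heavyLimit (f : α → β) (n : ℕ) (c : ℝ≥0∞) (t : List α → α → ℝ≥0) : ℝ≥0∞ :=
  wsum n fun w : List β => if c < projMass f n t w then projMass f n t w else 0

lemma measurable_projMass (f : α → β) (n : ℕ) (w : List β) :
    Measurable fun t : List α → α → ℝ≥0 => projMass f n t w :=
  measurable_wsum fun u => by
    split_ifs
    · exact (measurable_Qt u).mul (measurable_Y u)
    · exact measurable_const

lemma measurable_heavyLimit (f : α → β) (n : ℕ) (c : ℝ≥0∞) :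
    Measurable (heavyLimit (α := α) f n c) :=
  measurable_wsum fun w => Measurable.ite
    (measurableSet_lt measurable_const (measurable_projMass f n w)) (measurable_projMass f n w)
    measurable_const

/-- Every heavy projected cylinder of the limit measure is heavy for the approximating masses. -/
lemma Regular.heavyLimit_le_liminf {t : List α → α → ℝ≥0} (h : Regular t) (f : α → β) (n : ℕ)
    (c : ℝ≥0∞) : heavyLimit f n c t ≤ liminf (fun M => heavyMass f M n c t) atTop := by
  have hconv : ∀ w : List β, Tendsto (fun k => wsum n fun u => if u.map f = w then Qt t u * Yn t u k
      else 0) atTop (𝓝 (projMass f n t w)) := by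
    intro w
    refine tendsto_finsetSum _ fun u _ => ?_
    dsimp only
    split_ifs
    · exact ENNReal.Tendsto.const_mul (h _).1 (Or.inr (by rw [Qt_eq]; simp))
    · exact tendsto_const_nhds
  have h1 : liminf (fun M => heavyMass f M n c t) atTop =
      liminf (fun k => heavyMass f (n + k) n c t) atTop := by
    simp only [add_comm n]
    exact (liminf_nat_add (fun M => heavyMass f M n c t) n).symm
  rw [h1]
  have h2 : Tendsto (fun k => wsum n fun w : List β => if c < projMass f n t w then
      (wsum n fun u => if u.map f = w then Qt t u * Yn t u k else 0) else 0) atTop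
      (𝓝 (heavyLimit f n c t)) := by
    refine tendsto_finsetSum _ fun w _ => ?_
    dsimp only
    split_ifs
    · exact hconv _
    · exact tendsto_const_nhds
  rw [← h2.liminf_eq]
  refine liminf_le_liminf ?_
  have h3 : ∀ᶠ k in atTop, ∀ w : Fin n → β, c < projMass f n t (List.ofFn w) →
      c < wsum n fun u => if u.map f = List.ofFn w then Qt t u * Yn t u k else 0 := by
    refine eventually_all.2 fun w => ?_
    by_cases hc : c < projMass f n t (List.ofFn w)
    · filter_upwards [(hconv (List.ofFn w)).eventually (lt_mem_nhds hc)] with k hk _ using hk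
    · exact .of_forall fun k hk => absurd hk hc
  filter_upwards [h3] with k hk
  rw [heavyMass_eq]
  refine Finset.sum_le_sum fun w _ => ?_
  dsimp only
  by_cases hc : c < projMass f n t (List.ofFn w)
  · rw [if_pos hc, if_pos (hk w hc)]
  · rw [if_neg hc]; exact zero_le

variable [MeasurableSpace α] [MeasurableSingletonClass α] [Nonempty α]
variable (ρ : Measure (α → ℝ≥0)) [IsProbabilityMeasure ρ]
variable (hρ : ∫⁻ w, ∑ a, (w a : ℝ≥0∞) ∂ρ = 1)
  (hint : ∀ a, Integrable (fun w : α → ℝ≥0 => Real.negMulLog (w a)) ρ)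
include hρ hint

/-- Almost surely, the projected cylinders of mass above `exp (-n d)` carry asymptotically no mass. -/
lemma ae_tendsto_heavyLimit (f : α → β) {d : ℝ} (h0 : 0 < weightEntropy ρ)
    (hd1 : d < weightEntropy ρ) (hd2 : d < ∑ b, Real.negMulLog (marginal ρ f b)) :
    ∀ᵐ t ∂treeLaw ρ, Tendsto (fun n : ℕ => heavyLimit f n (ENNReal.ofReal (Real.exp (-(n * d)))) t)
      atTop (𝓝 0) := by
  -- the gap between `d` and `d'` makes the bounds summable over `n`
  obtain ⟨d', hd', hd''⟩ : ∃ d', d < d' ∧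
      d' < min (weightEntropy ρ) (∑ b, Real.negMulLog (marginal ρ f b)) :=
    exists_between (lt_min hd1 hd2)
  obtain ⟨η, hη, hb⟩ := exists_lintegral_heavyMass_le ρ hρ hint f h0
    (hd''.trans_le (min_le_left _ _)) (hd''.trans_le (min_le_right _ _))
  set c : ℕ → ℝ≥0∞ := fun n => ENNReal.ofReal (Real.exp (-(n * d))) with hc
  have hc0 : ∀ n, c n ≠ 0 := fun n => by simp [hc, Real.exp_pos]
  have hct : ∀ n, c n ≠ ∞ := fun n => by simp [hc]
  set x : ℕ → ℝ≥0∞ := fun n => ENNReal.ofReal (Real.exp (d - d')) ^ n with hx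
  have hterm : ∀ n : ℕ, ENNReal.ofReal (Real.exp (-(n * d'))) / c n = x n := by
    intro n
    simp only [hc, hx]
    rw [← ENNReal.ofReal_div_of_pos (Real.exp_pos _), ← Real.exp_sub,
      ← ENNReal.ofReal_pow (Real.exp_pos _).le, ← Real.exp_nat_mul]
    congr 2; ring
  have hxs : ∑' n, x n ≠ ∞ := by
    rw [hx, ENNReal.tsum_geometric]
    refine ENNReal.inv_ne_top.2 (tsub_pos_iff_lt.2 ?_).ne'
    rw [ENNReal.ofReal_lt_one]
    exact Real.exp_lt_one_iff.2 (by linarith)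
  set B : ℕ → (List α → α → ℝ≥0) → ℝ≥0∞ := fun n => heavyLimit f n (c n) with hB
  have hBm : ∀ n, Measurable (B n) := fun n => measurable_heavyLimit f n _
  -- the supremum over finitely many `n` is compared, by Fatou's lemma, with a single large generation `M`
  have hfin : ∀ (C : ℕ) (S : Finset ℕ), ∫⁻ t, ⨆ n ∈ S, B n t ∂treeLaw ρ ≤
      η C + C * ∑ n ∈ S, x n := by
    intro C S
    calc ∫⁻ t, ⨆ n ∈ S, B n t ∂treeLaw ρ ≤
          ∫⁻ t, liminf (fun M => ⨆ n ∈ S, heavyMass f M n (c n) t) atTop ∂treeLaw ρ := by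
          refine lintegral_mono_ae ?_
          filter_upwards [ae_regular ρ hρ] with t ht
          refine iSup₂_le fun n hn => (ht.heavyLimit_le_liminf f n (c n)).trans ?_
          refine liminf_le_liminf (.of_forall fun M => ?_)
          exact le_iSup₂ (f := fun n (_ : n ∈ S) => heavyMass f M n (c n) t) n hn
      _ ≤ liminf (fun M => ∫⁻ t, ⨆ n ∈ S, heavyMass f M n (c n) t ∂treeLaw ρ) atTop :=
          lintegral_liminf_le fun M => Measurable.biSup _ S.countable_toSet
            fun n _ => measurable_heavyMass f M n (c n)
      _ ≤ liminf (fun _ : ℕ => η C + C * ∑ n ∈ S, x n) atTop := by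
          refine liminf_le_liminf ?_
          filter_upwards [eventually_ge_atTop (S.sup id)] with M hM
          refine (hb C M S c (fun n hn => (Finset.le_sup (f := id) hn).trans hM) hc0 hct).trans ?_
          rw [Finset.mul_sum]
          simp only [mul_div_assoc, hterm]
          exact le_rfl
      _ = _ := by simp
  have hlim : ∀ (C n₀ : ℕ), ∫⁻ t, limsup (fun n => B n t) atTop ∂treeLaw ρ ≤
      η C + C * ∑' n, x (n + n₀) := by
    intro C n₀
    calc ∫⁻ t, limsup (fun n => B n t) atTop ∂treeLaw ρ ≤
          ∫⁻ t, ⨆ L, ⨆ n ∈ Finset.Ico n₀ (n₀ + L), B n t ∂treeLaw ρ := by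
          refine lintegral_mono fun t => ?_
          rw [limsup_eq_iInf_iSup_of_nat]
          refine (iInf_le _ n₀).trans (iSup₂_le fun n hn => ?_)
          refine le_iSup_of_le (n + 1) ?_
          exact le_iSup₂ (f := fun n (_ : n ∈ Finset.Ico n₀ (n₀ + _)) => B n t) n
            (by simp; omega)
      _ = ⨆ L, ∫⁻ t, ⨆ n ∈ Finset.Ico n₀ (n₀ + L), B n t ∂treeLaw ρ := by
          refine lintegral_iSup (fun L => Measurable.biSup _ (Finset.countable_toSet _)
            fun n _ => hBm n) ?_
          intro L L' hL t
          refine iSup₂_le fun n hn => ?_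
          exact le_iSup₂ (f := fun n (_ : n ∈ Finset.Ico n₀ (n₀ + L')) => B n t) n
            (by simp at hn ⊢; omega)
      _ ≤ _ := by
          refine iSup_le fun L => (hfin C _).trans ?_
          gcongr
          rw [Finset.sum_Ico_eq_sum_range, Nat.add_sub_cancel_left]
          simp only [add_comm n₀]
          exact ENNReal.sum_le_tsum _
  have hlim2 : ∀ C, ∫⁻ t, limsup (fun n => B n t) atTop ∂treeLaw ρ ≤ η C := by
    intro C
    have h1 : Tendsto (fun n₀ => η C + C * ∑' n, x (n + n₀)) atTop (𝓝 (η C + C * 0)) :=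
      tendsto_const_nhds.add (ENNReal.Tendsto.const_mul
        (ENNReal.tendsto_sum_nat_add x hxs) (Or.inr (by simp)))
    simpa using ge_of_tendsto' h1 (hlim C)
  have hzero : ∫⁻ t, limsup (fun n => B n t) atTop ∂treeLaw ρ = 0 :=
    le_antisymm (ge_of_tendsto' hη hlim2) zero_le
  rw [lintegral_eq_zero_iff (Measurable.limsup hBm)] at hzero
  filter_upwards [hzero] with t ht
  exact tendsto_of_le_liminf_of_limsup_le zero_le ht.le

omit [MeasurableSpace α] [MeasurableSingletonClass α] [Nonempty α] [IsProbabilityMeasure ρ] hρ hint in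
omit ρ in
lemma projProb_eq (f : α → β) (n : ℕ) {t : List α → α → ℝ≥0} (h : Regular t) (hY : Y t [] ≠ 0)
    (w : List β) : projProb f n t w = (projMass f n t w / Y t []).toReal := by
  rw [projMass, div_eq_mul_inv, wsum_mul, projProb]
  unfold wsum
  rw [ENNReal.toReal_sum]
  · refine Finset.sum_congr rfl fun u _ => ?_
    dsimp only
    split_ifs
    · rfl
    · simp
  · intro u _
    dsimp only
    split_ifs
    · exact ENNReal.mul_ne_top (h.mass_ne_top _) (ENNReal.inv_ne_top.2 hY)
    · simp

omit [MeasurableSpace α] [MeasurableSingletonClass α] [Nonempty α] [IsProbabilityMeasure ρ] hρ hint in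
omit ρ in
/-- The entropy is bounded below by means of the mass of the cylinders that are not heavy. -/
lemma Regular.le_projEntropy {t : List α → α → ℝ≥0} (h : Regular t) (hY : Y t [] ≠ 0) (f : α → β)
    (n : ℕ) (d : ℝ) :
    (1 - (heavyLimit f n (ENNReal.ofReal (Real.exp (-(n * d)))) t / Y t []).toReal) *
      (n * d + Real.log (Y t []).toReal) ≤ projEntropy f n t := by
  set c := ENNReal.ofReal (Real.exp (-(n * d))) with hc
  have hYt : Y t [] ≠ ∞ := (h []).2
  have hYpos : 0 < (Y t []).toReal := ENNReal.toReal_pos hY hYt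
  have hmt : ∀ w, projMass f n t w ≠ ∞ := by
    intro w
    refine ENNReal.sum_ne_top.2 fun u _ => ?_
    dsimp only
    split_ifs
    · exact h.mass_ne_top _
    · simp
  have h1 : (heavyLimit f n c t / Y t []).toReal = wsum n fun w : List β =>
      if c < projMass f n t w then projProb f n t w else 0 := by
    rw [heavyLimit, div_eq_mul_inv, wsum_mul]
    unfold wsum
    rw [ENNReal.toReal_sum]
    · refine Finset.sum_congr rfl fun w _ => ?_
      dsimp only
      split_ifs
      · rw [projProb_eq f n h hY]; rfl
      · simp
    · intro w _
      dsimp only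
      split_ifs
      · exact ENNReal.mul_ne_top (hmt _) (ENNReal.inv_ne_top.2 hY)
      · simp
  rw [h1, ← h.wsum_projProb hY f n, projEntropy]
  unfold wsum
  rw [← Finset.sum_sub_distrib, Finset.sum_mul]
  refine Finset.sum_le_sum fun w _ => ?_
  have hp0 := projProb_nonneg f n t (List.ofFn w)
  dsimp only
  split_ifs with hw
  · rw [sub_self, zero_mul]
    exact Real.negMulLog_nonneg hp0 (h.projProb_le_one hY f (by simp))
  · rw [sub_zero]
    rcases hp0.eq_or_lt with h0 | h0
    · rw [← h0]; simp
    · rw [Real.negMulLog, neg_mul, ← mul_neg]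
      refine mul_le_mul_of_nonneg_left ?_ hp0
      have hle : projProb f n t (List.ofFn w) ≤ Real.exp (-(n * d)) / (Y t []).toReal := by
        rw [projProb_eq f n h hY, ENNReal.toReal_div]
        gcongr
        exact ENNReal.toReal_le_of_le_ofReal (Real.exp_pos _).le (not_lt.1 hw)
      have := Real.log_le_log h0 hle
      rw [Real.log_div (Real.exp_pos _).ne' hYpos.ne', Real.log_exp] at this
      linarith

/-- The lower bound for the entropies of the projections. -/
lemma eventually_le_projEntropy (f : α → β) {d : ℝ}
    (hd : d < min (weightEntropy ρ) (∑ b, Real.negMulLog (marginal ρ f b))) :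
    ∀ᵐ t ∂treeLaw ρ, Y t [] ≠ 0 → ∀ᶠ n : ℕ in atTop, n * d ≤ projEntropy f n t := by
  rcases le_or_gt d 0 with hd0 | hd0
  · filter_upwards [ae_regular ρ hρ] with t ht hY
    refine .of_forall fun n => le_trans ?_ (ht.projEntropy_nonneg hY f n)
    exact mul_nonpos_of_nonneg_of_nonpos (Nat.cast_nonneg n) hd0
  · obtain ⟨d', hd1, hd2⟩ := exists_between hd
    have h1 := hd2.trans_le (min_le_left _ _)
    have h2 := hd2.trans_le (min_le_right _ _)
    filter_upwards [ae_regular ρ hρ, ae_tendsto_heavyLimit ρ hρ hint f (hd0.trans (hd1.trans h1)) h1 h2]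
      with t ht hB hY
    have hB' : Tendsto (fun n : ℕ => (heavyLimit f n (ENNReal.ofReal (Real.exp (-(n * d')))) t /
        Y t []).toReal) atTop (𝓝 0) := by
      have := ENNReal.Tendsto.div_const hB (Or.inr hY)
      rw [ENNReal.zero_div] at this
      exact (ENNReal.tendsto_toReal ENNReal.zero_ne_top).comp this
    have hlim : Tendsto (fun n : ℕ => (1 - (heavyLimit f n (ENNReal.ofReal (Real.exp (-(n * d')))) t /
        Y t []).toReal) * (d' + Real.log (Y t []).toReal / n)) atTop (𝓝 ((1 - 0) * (d' + 0))) :=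
      (tendsto_const_nhds.sub hB').mul (tendsto_const_nhds.add
        (tendsto_const_div_atTop_nhds_zero_nat _))
    rw [sub_zero, one_mul, add_zero] at hlim
    have hpos : Tendsto (fun n : ℕ => d' + Real.log (Y t []).toReal / n) atTop (𝓝 (d' + 0)) :=
      tendsto_const_nhds.add (tendsto_const_div_atTop_nhds_zero_nat _)
    filter_upwards [hlim.eventually (lt_mem_nhds hd1),
      hpos.eventually (lt_mem_nhds (by linarith : (0 : ℝ) < d' + 0)),
      eventually_gt_atTop 0] with n hn1 hn2 hn3
    have hn : (0 : ℝ) < n := by exact_mod_cast hn3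
    have e1 : n * d' + Real.log (Y t []).toReal = n * (d' + Real.log (Y t []).toReal / n) := by
      field_simp
    have := ht.le_projEntropy hY f n d'
    rw [e1] at this
    nlinarith

end LowerBound

/-! ### Entropy dimensions of the projections of Mandelbrot measures -/

section Cylinders

variable {α β : Type*} [Fintype α] [MeasurableSpace α] [MeasurableSingletonClass α]
  [MeasurableSpace β]

lemma measurable_letterwise (f : α → β) : Measurable fun (x : ℕ → α) (n : ℕ) => f (x n) :=
  measurable_pi_iff.2 fun n => (measurable_of_finite f).comp (measurable_pi_apply n)

lemma pre_letterwise (f : α → β) (x : ℕ → α) (n : ℕ) :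
    pre (fun n => f (x n)) n = (pre x n).map f := by
  simp [pre, List.map_ofFn, Function.comp_def]

/-- The masses of cylinders for the letter by letter image of a measure. -/
lemma map_letterwise_cyl [Finite β] [MeasurableSingletonClass β] (ν : Measure (ℕ → α)) (f : α → β)
    (w : List β) : (ν.map fun x n => f (x n)) (cyl w) =
      wsum w.length fun u => if u.map f = w then ν (cyl u) else 0 := by
  have : Fintype β := Fintype.ofFinite β
  rw [Measure.map_apply (measurable_letterwise f) (measurableSet_cyl w)]
  have h1 : (fun (x : ℕ → α) (n : ℕ) => f (x n)) ⁻¹' cyl w =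
      ⋃ u : Fin w.length → α, if (List.ofFn u).map f = w then cyl (List.ofFn u) else ∅ := by
    ext x
    simp only [Set.mem_preimage, cyl, Set.mem_ofPred_eq, Set.mem_iUnion, pre_letterwise]
    constructor
    · intro h
      refine ⟨fun i => x i, ?_⟩
      rw [if_pos (by simpa [pre] using h)]
      simp [pre]
    · rintro ⟨u, hu⟩
      split_ifs at hu with h
      · simp only [List.length_ofFn, Set.mem_ofPred_eq] at hu
        rw [hu, h]
      · exact absurd hu (Set.notMem_empty x)
  rw [h1, measure_iUnion]
  · rw [tsum_fintype]
    refine Finset.sum_congr rfl fun u _ => ?_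
    dsimp only
    split_ifs <;> simp
  · intro u v huv
    simp only [Function.onFun]
    split_ifs
    · refine Set.disjoint_left.2 fun x hx hx' => huv (List.ofFn_injective ?_)
      simp only [cyl, List.length_ofFn, Set.mem_ofPred_eq] at hx hx'
      rw [← hx, ← hx']
    all_goals simp
  · intro u
    split_ifs
    · exact measurableSet_cyl _
    · exact .empty

lemma Regular.mandelbrotMeasure_univ {t : List α → α → ℝ≥0} (h : Regular t) :
    mandelbrotMeasure t Set.univ = Y t [] := by
  rw [← cyl_nil, h.mandelbrotMeasure_spec.2]; simp [wt]

lemma Regular.mandelbrotMeasure_ne_zero_iff {t : List α → α → ℝ≥0} (h : Regular t) :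
    mandelbrotMeasure t ≠ 0 ↔ Y t [] ≠ 0 := by
  rw [← h.mandelbrotMeasure_univ, ne_eq, ne_eq, Measure.measure_univ_eq_zero]

lemma Regular.blockEntropy_map [Fintype β] [MeasurableSingletonClass β] {t : List α → α → ℝ≥0}
    (h : Regular t) (f : α → β) (n : ℕ) :
    blockEntropy ((((mandelbrotMeasure t).map fun x n => f (x n)) Set.univ)⁻¹ •
      (mandelbrotMeasure t).map fun x n => f (x n)) n = projEntropy f n t := by
  refine Finset.sum_congr rfl fun w _ => ?_
  congr 1
  rw [Measure.map_apply (measurable_letterwise f) .univ, Set.preimage_univ, h.mandelbrotMeasure_univ,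
    Measure.real, Measure.smul_apply, map_letterwise_cyl, projProb, List.length_ofFn, smul_eq_mul,
    mul_wsum]
  unfold wsum
  by_cases hY : Y t [] = 0
  · have hm : ∀ u, Qt t u * Y t u = 0 := by
      intro u
      have := h.wsum_mass u.length
      rw [hY, wsum, Finset.sum_eq_zero_iff] at this
      simpa using this u.get (Finset.mem_univ _)
    simp only [h.mandelbrotMeasure_spec.2, prob, hm]
    simp
  · rw [ENNReal.toReal_sum]
    · refine Finset.sum_congr rfl fun u _ => ?_
      dsimp only
      split_ifs
      · rw [h.mandelbrotMeasure_spec.2, prob, div_eq_mul_inv, mul_comm]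
      · simp
    · intro u _
      dsimp only
      split_ifs
      · rw [h.mandelbrotMeasure_spec.2]
        exact ENNReal.mul_ne_top (ENNReal.inv_ne_top.2 hY) (h.mass_ne_top _)
      · simp

variable [Nonempty α] (ρ : Measure (α → ℝ≥0)) [IsProbabilityMeasure ρ]

/-- The entropy dimension of the projection of a Mandelbrot measure: the minimum of the mean entropy
of the weights and of the entropy of the mean projected weights. -/
lemma ae_hasEntropyDim [Fintype β] [MeasurableSingletonClass β]
    (hρ : ∫⁻ w, ∑ a, (w a : ℝ≥0∞) ∂ρ = 1) (hpos : treeLaw ρ {t | Y t [] ≠ 0} ≠ 0) (f : α → β) :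
    ∀ᵐ t ∂treeLaw ρ, Y t [] ≠ 0 → HasEntropyDim ((mandelbrotMeasure t).map fun x n => f (x n))
      (min (weightEntropy ρ) (∑ b, Real.negMulLog (marginal ρ f b))) := by
  set D := min (weightEntropy ρ) (∑ b, Real.negMulLog (marginal ρ f b)) with hD
  have hδ : ∀ k : ℕ, (0 : ℝ) < 1 / (k + 1) := fun k => Nat.one_div_pos_of_nat
  have h1 : ∀ᵐ t ∂treeLaw ρ, ∀ k : ℕ, Y t [] ≠ 0 → ∀ᶠ n : ℕ in atTop,
      projEntropy f n t ≤ n * (D + 1 / (k + 1)) :=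
    ae_all_iff.2 fun k => eventually_projEntropy_le ρ hρ hpos f (hδ k)
  have h2 : ∀ᵐ t ∂treeLaw ρ, ∀ k : ℕ, Y t [] ≠ 0 → ∀ᶠ n : ℕ in atTop,
      n * (D - 1 / (k + 1)) ≤ projEntropy f n t :=
    ae_all_iff.2 fun k => eventually_le_projEntropy ρ hρ (integrable_negMulLog ρ hρ hpos) f
      (by rw [← hD]; linarith [hδ k])
  filter_upwards [ae_regular ρ hρ, h1, h2] with t ht h1 h2 hY
  unfold HasEntropyDim
  simp only [ht.blockEntropy_map]
  rw [Metric.tendsto_atTop']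
  intro ε hε
  obtain ⟨k, hk⟩ := exists_nat_one_div_lt hε
  obtain ⟨n₀, hn₀⟩ := eventually_atTop.1 ((h1 k hY).and (h2 k hY))
  refine ⟨n₀, fun n hn => ?_⟩
  obtain ⟨e1, e2⟩ := hn₀ n hn.le
  have hn' : (0 : ℝ) < n := by exact_mod_cast (show 0 < n by omega)
  rw [Real.dist_eq, abs_lt]
  constructor
  · rw [lt_sub_iff_add_lt, lt_div_iff₀ hn']; nlinarith
  · rw [sub_lt_iff_lt_add, div_lt_iff₀ hn']; nlinarith

end Cylinders

section Transfer

variable {α : Type*} [Fintype α] {Ω : Type*} [MeasurableSpace Ω] {P : Measure Ω}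
  [IsProbabilityMeasure P] {c : List α → Ω → α → Bool} {W : List α → Ω → α → ℝ≥0}

lemma IsMandelbrotOn.measurable_tree (h : IsMandelbrotOn P c W) :
    Measurable fun ω u => W u ω := measurable_pi_iff.2 h.measurable

lemma IsMandelbrotOn.isProbabilityMeasure (h : IsMandelbrotOn P c W) :
    IsProbabilityMeasure (P.map (W [])) :=
  Measure.isProbabilityMeasure_map (h.measurable []).aemeasurable

lemma IsMandelbrotOn.map_tree (h : IsMandelbrotOn P c W) [IsProbabilityMeasure (P.map (W []))] :
    P.map (fun ω u => W u ω) = treeLaw (P.map (W [])) := by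
  have h1 : iIndepFun W P := h.indep.comp (fun _ => Prod.snd) fun _ => measurable_snd
  rw [(iIndepFun_iff_map_fun_eq_infinitePi_map h.measurable).1 h1, treeLaw]
  congr 1
  funext u
  exact ((h.ident u).comp measurable_snd).map_eq

lemma IsMandelbrotOn.lintegral_sum (h : IsMandelbrotOn P c W) :
    ∫⁻ w, ∑ a, (w a : ℝ≥0∞) ∂(P.map (W [])) = 1 := by
  rw [lintegral_map (by fun_prop) (h.measurable [])]
  exact h.normalised

lemma IsMandelbrotOn.ae_of_treeLaw (h : IsMandelbrotOn P c W) [IsProbabilityMeasure (P.map (W []))]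
    {p : (List α → α → ℝ≥0) → Prop} (hp : ∀ᵐ t ∂treeLaw (P.map (W [])), p t) :
    ∀ᵐ ω ∂P, p fun u => W u ω :=
  ae_of_ae_map h.measurable_tree.aemeasurable (h.map_tree ▸ hp)

lemma IsMandelbrotOn.nonempty (h : IsMandelbrotOn P c W) : Nonempty α := by
  by_contra hα
  rw [not_nonempty_iff] at hα
  simpa using h.normalised

variable [MeasurableSpace α] [MeasurableSingletonClass α]

lemma IsMandelbrotOn.isPositive_iff (h : IsMandelbrotOn P c W)
    [IsProbabilityMeasure (P.map (W []))] :
    IsPositive P W ↔ treeLaw (P.map (W [])) {t | Y t [] ≠ 0} ≠ 0 := by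
  have hm : MeasurableSet {t : List α → α → ℝ≥0 | Y t [] ≠ 0} :=
    (measurable_Y [] (measurableSet_singleton 0)).compl
  rw [← h.map_tree, Measure.map_apply h.measurable_tree hm, IsPositive, pos_iff_ne_zero]
  refine not_congr (Eq.congr_left (measure_congr ?_))
  filter_upwards [h.ae_of_treeLaw (ae_regular _ h.lintegral_sum)] with ω hω
  exact propext hω.mandelbrotMeasure_ne_zero_iff

end Transfer

/-! ### Entropy of shift-invariant measures -/

section ShiftEntropy

variable {α : Type*}

lemma iterate_shift_apply (x : ℕ → α) (n k : ℕ) : (shift^[n] x) k = x (n + k) := by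
  induction n generalizing x with
  | zero => simp
  | succ n ih => rw [Function.iterate_succ_apply, ih]; simp only [shift]; congr 1; omega

lemma pre_add (x : ℕ → α) (n k : ℕ) : pre x (n + k) = pre x n ++ pre (shift^[n] x) k := by
  induction k with
  | zero => simp [pre]
  | succ k ih => rw [← add_assoc, pre_succ, ih, pre_succ, iterate_shift_apply, List.append_assoc]

lemma length_pre (x : ℕ → α) (n : ℕ) : (pre x n).length = n := by simp [pre]

lemma cyl_append (u v : List α) : cyl (u ++ v) = cyl u ∩ shift^[u.length] ⁻¹' cyl v := by
  ext x
  simp only [cyl, Set.mem_ofPred_eq, Set.mem_inter_iff, Set.mem_preimage, List.length_append, pre_add]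
  constructor
  · intro h
    exact List.append_inj h (length_pre _ _)
  · rintro ⟨h1, h2⟩
    rw [h1, h2]

lemma cyl_ofFn {n : ℕ} (u : Fin n → α) :
    cyl (List.ofFn u) = (fun (x : ℕ → α) (i : Fin n) => x i) ⁻¹' {u} := by
  ext x
  simp only [cyl, Set.mem_ofPred_eq, List.length_ofFn, Set.mem_preimage, Set.mem_singleton_iff, pre]
  exact List.ofFn_injective.eq_iff

variable [Fintype α] [MeasurableSpace α] [MeasurableSingletonClass α]

lemma measurable_shift : Measurable (shift : (ℕ → α) → ℕ → α) := by unfold shift; fun_prop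

lemma sum_measure_inter_cyl (ν : Measure (ℕ → α)) (s : Set (ℕ → α))
    {g : (ℕ → α) → ℕ → α} (hg : Measurable g) (n : ℕ) :
    wsum n (fun u => ν (s ∩ g ⁻¹' cyl u)) = ν s := by
  have hm : Measurable fun (x : ℕ → α) (i : Fin n) => g x i := by fun_prop
  have h := sum_measure_preimage_singleton (μ := ν.restrict s) (Finset.univ : Finset (Fin n → α))
    (f := fun x i => g x i) fun y _ => hm (measurableSet_singleton y)
  rw [Finset.coe_univ, Set.preimage_univ, Measure.restrict_apply_univ] at h
  rw [← h]
  refine Finset.sum_congr rfl fun u _ => ?_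
  rw [Measure.restrict_apply (hm (measurableSet_singleton u)), Set.inter_comm]
  dsimp only
  rw [cyl_ofFn]
  rfl

variable (ν : Measure (ℕ → α)) [IsProbabilityMeasure ν]

lemma wsum_real_cyl_append_right (u : List α) (k : ℕ) :
    wsum k (fun v => ν.real (cyl (u ++ v))) = ν.real (cyl u) := by
  have := sum_measure_inter_cyl ν (cyl u)
    ((measurable_shift (α := α)).iterate u.length) k
  rw [Measure.real, ← this]
  unfold wsum
  rw [ENNReal.toReal_sum fun _ _ => measure_ne_top _ _]
  exact Finset.sum_congr rfl fun v _ => by rw [← cyl_append]; rfl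

lemma wsum_real_cyl (k : ℕ) : wsum k (fun v => ν.real (cyl v)) = 1 := by
  have := wsum_real_cyl_append_right ν [] k
  simpa [cyl_nil] using this

lemma wsum_real_cyl_append_left (hν : MeasurePreserving shift ν ν) (v : List α) (n : ℕ) :
    wsum n (fun u => ν.real (cyl (u ++ v))) = ν.real (cyl v) := by
  have hp := hν.iterate n
  have := sum_measure_inter_cyl ν (shift^[n] ⁻¹' cyl v) measurable_id n
  rw [hp.measure_preimage (measurableSet_cyl v).nullMeasurableSet] at this
  rw [Measure.real, ← this]
  unfold wsum
  rw [ENNReal.toReal_sum fun _ _ => measure_ne_top _ _]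
  refine Finset.sum_congr rfl fun u _ => ?_
  dsimp only
  rw [cyl_append, List.length_ofFn, Set.preimage_id, Set.inter_comm]; rfl

lemma blockEntropy_nonneg (n : ℕ) : 0 ≤ blockEntropy ν n :=
  Finset.sum_nonneg fun _ _ => Real.negMulLog_nonneg measureReal_nonneg measureReal_le_one

/-- Subadditivity of the block entropies, with its equality case. -/
lemma blockEntropy_add_le (hν : MeasurePreserving shift ν ν) (n k : ℕ) :
    blockEntropy ν (n + k) ≤ blockEntropy ν n + blockEntropy ν k ∧
      (blockEntropy ν (n + k) = blockEntropy ν n + blockEntropy ν k →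
        ∀ u v : List α, u.length = n → v.length = k →
          ν.real (cyl (u ++ v)) = ν.real (cyl u) * ν.real (cyl v)) := by
  set p : (Fin n → α) × (Fin k → α) → ℝ := fun x => ν.real (cyl (List.ofFn x.1 ++ List.ofFn x.2))
  set r : (Fin n → α) × (Fin k → α) → ℝ :=
    fun x => ν.real (cyl (List.ofFn x.1)) * ν.real (cyl (List.ofFn x.2))
  have hle1 : ∀ u v : List α, ν.real (cyl (u ++ v)) ≤ ν.real (cyl u) := fun u v => by
    rw [cyl_append]; exact measureReal_mono Set.inter_subset_left
  have hle2 : ∀ u v : List α, ν.real (cyl (u ++ v)) ≤ ν.real (cyl v) := fun u v => by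
    have := (hν.iterate u.length).measure_preimage (measurableSet_cyl v).nullMeasurableSet
    rw [cyl_append, Measure.real, Measure.real, ← this]
    exact measureReal_mono Set.inter_subset_right
  have h1 : blockEntropy ν (n + k) = ∑ x, Real.negMulLog (p x) := by
    rw [Fintype.sum_prod_type]
    exact wsum_add n k fun w => Real.negMulLog (ν.real (cyl w))
  have hm1 : ∀ u : Fin n → α, ∑ v : Fin k → α, p (u, v) = ν.real (cyl (List.ofFn u)) :=
    fun u => wsum_real_cyl_append_right ν (List.ofFn u) k
  have hm2 : ∀ v : Fin k → α, ∑ u : Fin n → α, p (u, v) = ν.real (cyl (List.ofFn v)) :=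
    fun v => wsum_real_cyl_append_left ν hν (List.ofFn v) n
  have hs1 : ∑ u : Fin n → α, ν.real (cyl (List.ofFn u)) = 1 := wsum_real_cyl ν n
  have hs2 : ∑ u : Fin k → α, ν.real (cyl (List.ofFn u)) = 1 := wsum_real_cyl ν k
  have h2 : -∑ x, p x * Real.log (r x) = blockEntropy ν n + blockEntropy ν k := by
    have h3 : ∀ x, p x * Real.log (r x) = p x * Real.log (ν.real (cyl (List.ofFn x.1))) +
        p x * Real.log (ν.real (cyl (List.ofFn x.2))) := by
      intro x
      rcases (show 0 ≤ p x from measureReal_nonneg).eq_or_lt with h | h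
      · rw [← h]; simp
      · have e1 := h.trans_le (hle1 _ _)
        have e2 := h.trans_le (hle2 _ _)
        rw [Real.log_mul e1.ne' e2.ne', mul_add]
    simp only [h3, Finset.sum_add_distrib, neg_add]
    congr 1
    · rw [Fintype.sum_prod_type, blockEntropy, ← Finset.sum_neg_distrib]
      refine Finset.sum_congr rfl fun u _ => ?_
      dsimp only
      rw [← Finset.sum_mul, hm1, Real.negMulLog, neg_mul]
    · rw [Fintype.sum_prod_type_right, blockEntropy, ← Finset.sum_neg_distrib]
      refine Finset.sum_congr rfl fun u _ => ?_
      dsimp only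
      rw [← Finset.sum_mul, hm2, Real.negMulLog, neg_mul]
  have hG := sum_negMulLog_le_of_sum_eq_one (p := p) (r := r) (fun _ => measureReal_nonneg)
    (fun _ => mul_nonneg measureReal_nonneg measureReal_nonneg)
    (by rw [Fintype.sum_prod_type]; simp only [hm1, hs1])
    (by rw [Fintype.sum_prod_type]; simp only [r, ← Finset.mul_sum, hs2, mul_one, hs1])
    (fun x hx => by
      rcases mul_eq_zero.1 hx with h | h
      · exact le_antisymm (h ▸ hle1 _ _) measureReal_nonneg
      · exact le_antisymm (h ▸ hle2 _ _) measureReal_nonneg)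
  rw [← h1, h2] at hG
  refine ⟨hG.1, fun h u v hu hv => ?_⟩
  subst hu hv
  have := congr_fun (hG.2 h) (u.get, v.get)
  simpa [p, r] using this

lemma subadditive_blockEntropy (hν : MeasurePreserving shift ν ν) :
    Subadditive (blockEntropy ν) := fun n k => (blockEntropy_add_le ν hν n k).1

lemma bddBelow_blockEntropy_div : BddBelow (Set.range fun n : ℕ => blockEntropy ν n / n) :=
  ⟨0, by rintro _ ⟨n, rfl⟩; exact div_nonneg (blockEntropy_nonneg ν n) (Nat.cast_nonneg n)⟩

lemma tendsto_shiftEntropy (hν : MeasurePreserving shift ν ν) :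
    Tendsto (fun n : ℕ => blockEntropy ν n / n) atTop (𝓝 (shiftEntropy ν)) := by
  have h := (subadditive_blockEntropy ν hν).tendsto_lim (bddBelow_blockEntropy_div ν)
  rwa [shiftEntropy, h.limUnder_eq]

lemma shiftEntropy_le_div (hν : MeasurePreserving shift ν ν) {n : ℕ} (hn : n ≠ 0) :
    shiftEntropy ν ≤ blockEntropy ν n / n := by
  have h := (subadditive_blockEntropy ν hν).tendsto_lim (bddBelow_blockEntropy_div ν)
  rw [tendsto_nhds_unique (tendsto_shiftEntropy ν hν) h]
  exact (subadditive_blockEntropy ν hν).lim_le_div (bddBelow_blockEntropy_div ν) hn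

lemma shiftEntropy_le_blockEntropy_one (hν : MeasurePreserving shift ν ν) :
    shiftEntropy ν ≤ blockEntropy ν 1 := by
  simpa using shiftEntropy_le_div ν hν one_ne_zero

lemma blockEntropy_one : blockEntropy ν 1 = ∑ a, Real.negMulLog (ν.real (cyl [a])) := by
  have : blockEntropy ν 1 = wsum (0 + 1) fun w => Real.negMulLog (ν.real (cyl w)) := rfl
  rw [this, wsum_succ]; simp

/-- A shift-invariant measure whose entropy is that of its first marginal has independent
coordinates. -/
lemma real_cyl_cons_of_shiftEntropy_eq (hν : MeasurePreserving shift ν ν)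
    (h : shiftEntropy ν = blockEntropy ν 1) (a : α) (w : List α) :
    ν.real (cyl (a :: w)) = ν.real (cyl [a]) * ν.real (cyl w) := by
  have hge : ∀ n : ℕ, n * blockEntropy ν 1 ≤ blockEntropy ν n := by
    intro n
    rcases Nat.eq_zero_or_pos n with rfl | hn
    · simpa using blockEntropy_nonneg ν 0
    · have := shiftEntropy_le_div ν hν hn.ne'
      rw [h, le_div_iff₀ (by exact_mod_cast hn)] at this
      linarith
  have hle : ∀ n : ℕ, blockEntropy ν n ≤ n * blockEntropy ν 1 := by
    intro n
    induction n with
    | zero =>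
      have : blockEntropy ν 0 = wsum 0 fun w => Real.negMulLog (ν.real (cyl w)) := rfl
      rw [this]; simp [cyl_nil]
    | succ n ih =>
      have := (blockEntropy_add_le ν hν n 1).1
      push_cast; linarith
  have heq : ∀ n : ℕ, blockEntropy ν n = n * blockEntropy ν 1 := fun n => le_antisymm (hle n) (hge n)
  refine (blockEntropy_add_le ν hν 1 w.length).2 ?_ [a] w rfl rfl
  rw [heq (1 + w.length), heq w.length]
  push_cast; ring

/-- A probability measure whose cylinders have the measures of a product measure is this product
measure. -/
lemma eq_infinitePi_of_cyl {ν : Measure (ℕ → α)} (μ : Measure α) [IsProbabilityMeasure μ]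
    (h : ∀ n (u : Fin n → α), ν (cyl (List.ofFn u)) = ∏ i, μ {u i}) :
    ν = Measure.infinitePi fun _ : ℕ => μ := by
  refine Measure.eq_infinitePi _ fun s t ht => ?_
  obtain ⟨n, hn⟩ : ∃ n, s ⊆ Finset.range n := ⟨s.sup id + 1, fun i hi => by
    have := Finset.le_sup (f := id) hi
    simp at this ⊢; omega⟩
  have hm : Measurable fun (x : ℕ → α) (i : Fin n) => x i := by fun_prop
  have hmap : ν.map (fun (x : ℕ → α) (i : Fin n) => x i) = Measure.pi fun _ => μ := by
    refine Measure.ext_of_singleton fun u => ?_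
    rw [Measure.map_apply hm (measurableSet_singleton u), ← cyl_ofFn, h, Measure.pi_singleton]
  set t' : ℕ → Set α := fun i => if i ∈ s then t i else Set.univ
  have h1 : (s : Set ℕ).pi t = (fun (x : ℕ → α) (i : Fin n) => x i) ⁻¹'
      (Set.univ.pi fun i : Fin n => t' i) := by
    ext x
    simp only [Set.mem_pi, SetLike.mem_coe, Set.mem_preimage, Set.mem_univ, true_imp_iff, t']
    constructor
    · intro hx i
      split_ifs with hi
      · exact hx _ hi
      · trivial
    · intro hx i hi
      have := hx ⟨i, Finset.mem_range.1 (hn hi)⟩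
      simpa [hi] using this
  rw [h1, ← Measure.map_apply hm, hmap, Measure.pi_pi,
    Fin.prod_univ_eq_prod_range (fun i => μ (t' i)) n, ← Finset.prod_subset hn]
  · exact Finset.prod_congr rfl fun i hi => by simp [t', hi]
  · intro i _ hi; simp [t', hi]
  · exact MeasurableSet.univ_pi fun i => by
      simp only [t']; split_ifs
      · exact ht _
      · exact .univ

end ShiftEntropy

/-! ### Bernoulli measures -/

section Letters

variable {α β δ : Type*} [Fintype α] [Fintype β]

/-- The entropy of a probability vector. -/
def entropy (q : α → ℝ) : ℝ := ∑ a, Real.negMulLog (q a)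

/-- The image of the vector `q` by the letter map `f`. -/
def push (f : α → β) (q : α → ℝ) (b : β) : ℝ := ∑ a, if f a = b then q a else 0

/-- The probability vectors supported on `S`. -/
def simplexOn (S : Set α) : Set (α → ℝ) := {q | q ∈ stdSimplex ℝ α ∧ ∀ a ∉ S, q a = 0}

lemma push_mul_sum (f : α → β) (q : α → ℝ) (g : β → ℝ) :
    ∑ b, push f q b * g b = ∑ a, q a * g (f a) := by
  simp only [push, Finset.sum_mul, ite_mul, zero_mul]
  rw [Finset.sum_comm]
  simp

lemma push_id (q : α → ℝ) : push id q = q := by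
  funext a; simp [push]

lemma push_push (f : α → β) (g : β → δ) (q : α → ℝ) : push g (push f q) = push (g ∘ f) q := by
  funext d
  have := push_mul_sum f q fun b => if g b = d then 1 else 0
  simp only [mul_ite, mul_one, mul_zero] at this
  simpa [push] using this

lemma push_nonneg {f : α → β} {q : α → ℝ} (hq : ∀ a, 0 ≤ q a) (b : β) : 0 ≤ push f q b :=
  Finset.sum_nonneg fun a _ => by split_ifs <;> simp [hq]

lemma push_mem_stdSimplex (f : α → β) {q : α → ℝ} (hq : q ∈ stdSimplex ℝ α) :
    push f q ∈ stdSimplex ℝ β := by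
  refine ⟨push_nonneg hq.1, ?_⟩
  have := push_mul_sum f q fun _ => 1
  simpa [hq.2] using this

lemma continuous_push (f : α → β) : Continuous (push f : (α → ℝ) → β → ℝ) := by
  refine continuous_pi fun b => continuous_finsetSum _ fun a _ => ?_
  split_ifs <;> fun_prop

lemma continuous_entropy : Continuous (entropy : (α → ℝ) → ℝ) :=
  continuous_finsetSum _ fun a _ => Real.continuous_negMulLog.comp (continuous_apply a)

lemma le_one_of_mem_stdSimplex {q : α → ℝ} (hq : q ∈ stdSimplex ℝ α) (a : α) : q a ≤ 1 :=
  hq.2 ▸ Finset.single_le_sum (f := q) (fun b _ => hq.1 b) (Finset.mem_univ a)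

lemma entropy_nonneg {q : α → ℝ} (hq : q ∈ stdSimplex ℝ α) : 0 ≤ entropy q :=
  Finset.sum_nonneg fun a _ => Real.negMulLog_nonneg (hq.1 a) (le_one_of_mem_stdSimplex hq a)

lemma entropy_push_le (f : α → β) {q : α → ℝ} (hq : ∀ a, 0 ≤ q a) :
    entropy (push f q) ≤ entropy q := by
  have h1 : ∀ b, Real.negMulLog (push f q b) ≤
      ∑ a, Real.negMulLog (if f a = b then q a else 0) := fun b =>
    negMulLog_sum_le fun a _ => by split_ifs <;> simp [hq]
  refine (Finset.sum_le_sum fun b _ => h1 b).trans ?_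
  rw [Finset.sum_comm]
  refine Finset.sum_le_sum fun a _ => ?_
  rw [Finset.sum_eq_single (f a)]
  · simp
  · intro b _ hb; simp [hb.symm]
  · simp

lemma negMulLog_midpoint {x y : ℝ} (hx : 0 ≤ x) (hy : 0 ≤ y) :
    (Real.negMulLog x + Real.negMulLog y) / 2 ≤
      Real.negMulLog ((1 / 2 : ℝ) • x + (1 / 2 : ℝ) • y) := by
  have h := Real.concaveOn_negMulLog.2 (Set.mem_Ici.2 hx) (Set.mem_Ici.2 hy)
    (by norm_num : (0 : ℝ) ≤ 1 / 2) (by norm_num : (0 : ℝ) ≤ 1 / 2) (by norm_num)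
  refine le_trans ?_ h
  simp only [smul_eq_mul]; linarith

lemma negMulLog_midpoint_lt {x y : ℝ} (hx : 0 ≤ x) (hy : 0 ≤ y) (hne : x ≠ y) :
    (Real.negMulLog x + Real.negMulLog y) / 2 <
      Real.negMulLog ((1 / 2 : ℝ) • x + (1 / 2 : ℝ) • y) := by
  have h := Real.strictConcaveOn_negMulLog.2 (Set.mem_Ici.2 hx) (Set.mem_Ici.2 hy) hne
    (by norm_num : (0 : ℝ) < 1 / 2) (by norm_num : (0 : ℝ) < 1 / 2) (by norm_num)
  refine lt_of_le_of_lt ?_ h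
  simp only [smul_eq_mul]; linarith

lemma entropy_push_midpoint (f : α → β) {q q' : α → ℝ} (hq : ∀ a, 0 ≤ q a) (hq' : ∀ a, 0 ≤ q' a) :
    (entropy (push f q) + entropy (push f q')) / 2 ≤
      entropy (push f ((1 / 2 : ℝ) • q + (1 / 2 : ℝ) • q')) := by
  rw [entropy, entropy, entropy, ← Finset.sum_add_distrib, Finset.sum_div]
  refine Finset.sum_le_sum fun b _ => ?_
  have h2 : push f ((1 / 2 : ℝ) • q + (1 / 2 : ℝ) • q') b =
      (1 / 2 : ℝ) • push f q b + (1 / 2 : ℝ) • push f q' b := by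
    simp only [push, smul_eq_mul, Finset.mul_sum, ← Finset.sum_add_distrib]
    refine Finset.sum_congr rfl fun a _ => ?_
    split_ifs <;> simp
  rw [h2]
  exact negMulLog_midpoint (push_nonneg hq b) (push_nonneg hq' b)

lemma entropy_midpoint_lt {q q' : α → ℝ} (hq : ∀ a, 0 ≤ q a) (hq' : ∀ a, 0 ≤ q' a) (hne : q ≠ q') :
    (entropy q + entropy q') / 2 < entropy ((1 / 2 : ℝ) • q + (1 / 2 : ℝ) • q') := by
  rw [entropy, entropy, entropy, ← Finset.sum_add_distrib, Finset.sum_div]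
  obtain ⟨a, ha⟩ := Function.ne_iff.1 hne
  refine Finset.sum_lt_sum (fun b _ => ?_) ⟨a, Finset.mem_univ a, ?_⟩
  · exact negMulLog_midpoint (hq b) (hq' b)
  · exact negMulLog_midpoint_lt (hq a) (hq' a) ha

lemma isCompact_simplexOn (S : Set α) : IsCompact (simplexOn S) := by
  have : {q : α → ℝ | ∀ a ∉ S, q a = 0} = ⋂ a, ⋂ _ : a ∉ S, {q : α → ℝ | q a = 0} := by ext; simp
  refine (isCompact_stdSimplex ℝ α).inter_right (t := {q : α → ℝ | ∀ a ∉ S, q a = 0}) ?_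
  rw [this]
  exact isClosed_iInter fun a => isClosed_iInter fun _ =>
    isClosed_eq (continuous_apply a) continuous_const

lemma midpoint_mem_simplexOn {S : Set α} {q q' : α → ℝ} (hq : q ∈ simplexOn S)
    (hq' : q' ∈ simplexOn S) : (1 / 2 : ℝ) • q + (1 / 2 : ℝ) • q' ∈ simplexOn S := by
  refine ⟨convex_stdSimplex ℝ α hq.1 hq'.1 (by norm_num) (by norm_num) (by norm_num), fun a ha => ?_⟩
  simp [hq.2 a ha, hq'.2 a ha]

end Letters

section Bernoulli

variable {α β : Type*} [Fintype α] [Fintype β] [MeasurableSpace α] [MeasurableSingletonClass α]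
  [MeasurableSpace β] [MeasurableSingletonClass β]

/-- The measure on the alphabet with weights `q`. -/
def letterLaw (q : α → ℝ) : Measure α := ∑ a, ENNReal.ofReal (q a) • Measure.dirac a

/-- The Bernoulli measure with weights `q`. -/
def bernoulli (q : α → ℝ) : Measure (ℕ → α) := Measure.infinitePi fun _ : ℕ => letterLaw q

lemma letterLaw_singleton (q : α → ℝ) (a : α) : letterLaw q {a} = ENNReal.ofReal (q a) := by
  simp only [letterLaw, Measure.finsetSum_apply, Measure.smul_apply, smul_eq_mul,
    Measure.dirac_apply' _ (measurableSet_singleton a)]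
  rw [Finset.sum_eq_single a]
  · simp
  · intro b _ hb; simp [hb]
  · simp

lemma isProbabilityMeasure_letterLaw {q : α → ℝ} (hq : q ∈ stdSimplex ℝ α) :
    IsProbabilityMeasure (letterLaw q) := by
  refine ⟨?_⟩
  simp only [letterLaw, Measure.finsetSum_apply, Measure.smul_apply, smul_eq_mul, measure_univ, mul_one]
  rw [← ENNReal.ofReal_sum_of_nonneg fun a _ => hq.1 a, hq.2, ENNReal.ofReal_one]

lemma map_letterLaw (f : α → β) {q : α → ℝ} (hq : ∀ a, 0 ≤ q a) :
    (letterLaw q).map f = letterLaw (push f q) := by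
  refine Measure.ext_of_singleton fun b => ?_
  rw [Measure.map_apply (measurable_of_finite f) (measurableSet_singleton b), letterLaw_singleton,
    push, ENNReal.ofReal_sum_of_nonneg fun a _ => by split_ifs <;> simp [hq]]
  simp only [letterLaw, Measure.finsetSum_apply, Measure.smul_apply, smul_eq_mul]
  refine Finset.sum_congr rfl fun a _ => ?_
  rw [Measure.dirac_apply' _ (measurable_of_finite f (measurableSet_singleton b))]
  by_cases h : f a = b <;> simp [h]

variable {q : α → ℝ} (hq : q ∈ stdSimplex ℝ α)
include hq

lemma isProbabilityMeasure_bernoulli : IsProbabilityMeasure (bernoulli q) := by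
  have := isProbabilityMeasure_letterLaw hq
  unfold bernoulli; infer_instance

lemma bernoulli_cyl {n : ℕ} (u : Fin n → α) :
    bernoulli q (cyl (List.ofFn u)) = ∏ i, letterLaw q {u i} := by
  have := isProbabilityMeasure_letterLaw hq
  have hm : Measurable fun (x : ℕ → α) (i : Fin n) => x i := by fun_prop
  set t : ℕ → Set α := fun i => if h : i < n then {u ⟨i, h⟩} else Set.univ
  have h1 : cyl (List.ofFn u) = (Finset.range n : Set ℕ).pi t := by
    rw [cyl_ofFn]
    ext x
    simp only [Set.mem_preimage, Set.mem_singleton_iff, Set.mem_pi, Finset.coe_range, Set.mem_Iio, t]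
    constructor
    · rintro h i hi
      rw [dif_pos hi, ← h]; rfl
    · intro h
      funext i
      have := h i i.2
      rw [dif_pos i.2] at this
      exact this
  rw [h1, bernoulli, Measure.infinitePi_pi _ fun i _ => (Set.toFinite _).measurableSet,
    ← Fin.prod_univ_eq_prod_range (fun i => letterLaw q (t i))]
  exact Finset.prod_congr rfl fun i _ => by simp [t]

lemma bernoulli_real_cyl (w : List α) : (bernoulli q).real (cyl w) = (w.map q).prod := by
  have h := bernoulli_cyl hq w.get
  rw [List.ofFn_get] at h
  rw [Measure.real, h, ENNReal.toReal_prod]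
  simp only [letterLaw_singleton, ENNReal.toReal_ofReal (hq.1 _)]
  conv_rhs => rw [← List.ofFn_get w, List.map_ofFn, List.prod_ofFn]
  rfl

lemma blockEntropy_bernoulli (n : ℕ) : blockEntropy (bernoulli q) n = n * entropy q := by
  have h1 : ∀ n, blockEntropy (bernoulli q) n = wsum n fun w => Real.negMulLog (w.map q).prod := by
    intro n
    exact Finset.sum_congr rfl fun w _ => by rw [bernoulli_real_cyl hq]
  have h2 : ∀ n, wsum n (fun w => (w.map q).prod) = 1 := by
    intro n
    have := isProbabilityMeasure_bernoulli hq
    rw [← wsum_real_cyl (bernoulli q) n]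
    exact wsum_congr fun w _ => (bernoulli_real_cyl hq w).symm
  rw [h1]
  induction n with
  | zero => simp
  | succ n ih =>
    simp only [wsum_succ, List.map_cons, List.prod_cons, Real.negMulLog_mul, wsum_add_distrib,
      ← wsum_mul, ← mul_wsum, h2, ih]
    rw [Finset.sum_add_distrib, ← Finset.sum_mul, hq.2]
    simp only [one_mul]
    push_cast [entropy]; ring

lemma measurePreserving_shift_bernoulli :
    MeasurePreserving shift (bernoulli q) (bernoulli q) := by
  have := isProbabilityMeasure_letterLaw hq
  refine ⟨measurable_shift, ?_⟩
  exact Measure.map_infinitePi_infinitePi_of_inj (P := fun _ : ℕ => letterLaw q)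
    (f := fun n => n + 1) (add_left_injective 1)

lemma shiftEntropy_bernoulli : shiftEntropy (bernoulli q) = entropy q := by
  have := isProbabilityMeasure_bernoulli hq
  refine tendsto_nhds_unique (tendsto_shiftEntropy _ (measurePreserving_shift_bernoulli hq)) ?_
  refine tendsto_const_nhds.congr' ?_
  filter_upwards [eventually_gt_atTop 0] with n hn
  have : (n : ℝ) ≠ 0 := by positivity
  rw [blockEntropy_bernoulli hq]; field_simp

lemma map_bernoulli (f : α → β) :
    (bernoulli q).map (fun x n => f (x n)) = bernoulli (push f q) := by
  have := isProbabilityMeasure_letterLaw hq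
  rw [bernoulli, Measure.infinitePi_map_pi (fun _ : ℕ => letterLaw q) (f := fun _ => f) fun _ => measurable_of_finite f]
  simp only [map_letterLaw f hq.1]; rfl

lemma isInvariantOn_bernoulli {S : Set α} (hS : ∀ a ∉ S, q a = 0) :
    IsInvariantOn S (bernoulli q) := by
  have := isProbabilityMeasure_letterLaw hq
  refine ⟨isProbabilityMeasure_bernoulli hq, measurePreserving_shift_bernoulli hq, ?_⟩
  refine ae_all_iff.2 fun n => ?_
  refine (measurePreserving_eval_infinitePi (fun _ : ℕ => letterLaw q) n).quasiMeasurePreserving.ae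
    (p := fun a => a ∈ S) ?_
  rw [ae_iff_of_countable]
  intro a ha
  by_contra h
  rw [letterLaw_singleton, hS a h] at ha
  simp at ha

end Bernoulli

section Invariant

variable {α β : Type*} [Fintype α] [Fintype β] [MeasurableSpace α] [MeasurableSingletonClass α]
  [MeasurableSpace β] [MeasurableSingletonClass β] (ν : Measure (ℕ → α))

/-- The law of the first letter. -/
def firstMarginal (a : α) : ℝ := ν.real (cyl [a])

lemma cyl_singleton (a : α) : cyl [a] = (fun x : ℕ → α => x 0) ⁻¹' {a} := by
  ext x; simp [cyl, pre]

lemma firstMarginal_mem [IsProbabilityMeasure ν] : firstMarginal ν ∈ stdSimplex ℝ α := by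
  refine ⟨fun a => measureReal_nonneg, ?_⟩
  have := wsum_real_cyl ν (0 + 1)
  rw [wsum_succ] at this
  simpa [firstMarginal] using this

lemma firstMarginal_bernoulli {q : α → ℝ} (hq : q ∈ stdSimplex ℝ α) :
    firstMarginal (bernoulli q) = q := by
  funext a; simp [firstMarginal, bernoulli_real_cyl hq]

lemma IsInvariantOn.firstMarginal_mem {S : Set α} {ν : Measure (ℕ → α)} (h : IsInvariantOn S ν) :
    firstMarginal ν ∈ simplexOn S := by
  have := h.prob
  refine ⟨Sponge.firstMarginal_mem ν, fun a ha => ?_⟩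
  have h1 : ν (cyl [a]) = 0 := by
    refine measure_mono_null ?_ (ae_iff.1 h.carried)
    intro x hx h'
    rw [cyl_singleton] at hx
    exact ha (hx ▸ h' 0)
  simp [firstMarginal, Measure.real, h1]

lemma firstMarginal_map [IsProbabilityMeasure ν] (f : α → β) :
    firstMarginal (ν.map fun x n => f (x n)) = push f (firstMarginal ν) := by
  funext b
  rw [firstMarginal, Measure.real, map_letterwise_cyl, List.length_singleton, ← zero_add 1, wsum_succ]
  simp only [wsum_zero]
  rw [ENNReal.toReal_sum fun a _ => by split_ifs <;> simp]
  refine Finset.sum_congr rfl fun a _ => ?_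
  by_cases h : f a = b <;> simp [h, firstMarginal, Measure.real]

lemma integral_first_letter [IsProbabilityMeasure ν] (g : α → ℝ) :
    ∫ x, g (x 0) ∂ν = ∑ a, firstMarginal ν a * g a := by
  have hm : Measurable fun x : ℕ → α => x 0 := measurable_pi_apply 0
  have h1 : ∫ x, g (x 0) ∂ν = ∫ a, g a ∂(ν.map fun x => x 0) :=
    (integral_map hm.aemeasurable (measurable_of_finite g).aestronglyMeasurable).symm
  rw [h1, integral_fintype .of_finite]
  refine Finset.sum_congr rfl fun a _ => ?_
  rw [firstMarginal, cyl_singleton, Measure.real, Measure.real,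
    Measure.map_apply hm (measurableSet_singleton a), smul_eq_mul]

lemma measurePreserving_shift_map {ν : Measure (ℕ → α)} (h : MeasurePreserving shift ν ν) (f : α → β) :
    MeasurePreserving shift (ν.map fun x n => f (x n)) (ν.map fun x n => f (x n)) := by
  refine ⟨measurable_shift, ?_⟩
  rw [Measure.map_map measurable_shift (measurable_letterwise f)]
  conv_rhs => rw [← h.map_eq, Measure.map_map (measurable_letterwise f) measurable_shift]
  rfl

lemma shiftEntropy_map_le [IsProbabilityMeasure ν] (h : MeasurePreserving shift ν ν) (f : α → β) :
    shiftEntropy (ν.map fun x n => f (x n)) ≤ entropy (push f (firstMarginal ν)) := by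
  have := Measure.isProbabilityMeasure_map (μ := ν) (measurable_letterwise f).aemeasurable
  refine (shiftEntropy_le_blockEntropy_one _ (measurePreserving_shift_map h f)).trans ?_
  rw [blockEntropy_one, ← firstMarginal_map]; rfl

/-- Among the invariant measures with a given law of the first letter, the Bernoulli measure is the
only one of maximal entropy. -/
lemma eq_bernoulli_of_shiftEntropy_eq [IsProbabilityMeasure ν] (h : MeasurePreserving shift ν ν)
    (he : shiftEntropy ν = entropy (firstMarginal ν)) : ν = bernoulli (firstMarginal ν) := by
  have := isProbabilityMeasure_letterLaw (firstMarginal_mem ν)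
  refine eq_infinitePi_of_cyl _ fun n u => ?_
  have h1 : ∀ w : List α, ν.real (cyl w) = (w.map (firstMarginal ν)).prod := by
    intro w
    induction w with
    | nil => simp [cyl_nil]
    | cons a w ih =>
      rw [real_cyl_cons_of_shiftEntropy_eq ν h (by rw [blockEntropy_one]; exact he), ih]; rfl
  rw [← ENNReal.ofReal_toReal (measure_ne_top ν _)]
  change ENNReal.ofReal (ν.real _) = _
  rw [h1, List.map_ofFn, List.prod_ofFn]
  simp only [Function.comp_apply]
  rw [ENNReal.ofReal_prod_of_nonneg fun i _ => (firstMarginal_mem ν).1 _]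
  exact Finset.prod_congr rfl fun i _ => (letterLaw_singleton _ _).symm

end Invariant

/-! ### Differentiability of suprema of affine families -/

section Envelope

variable {X : Type*} [TopologicalSpace X] [CompactSpace X] {L G : X → ℝ}

/-- A maximum over a compact space of affine functions of `θ` with a unique maximiser for each `θ` is
differentiable, its derivative is the slope at the maximiser, and it is continuous. -/
lemma hasDerivAt_of_unique_maximizer (hL : Continuous L) (hG : Continuous G) {q : ℝ → X}
    (hq : ∀ θ x, θ * L x + G x ≤ θ * L (q θ) + G (q θ))
    (huniq : ∀ θ x, θ * L x + G x = θ * L (q θ) + G (q θ) → x = q θ) :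
    (∀ θ, HasDerivAt (fun θ => θ * L (q θ) + G (q θ)) (L (q θ)) θ) ∧
      Continuous fun θ => L (q θ) := by
  set p : ℝ → ℝ := fun θ => θ * L (q θ) + G (q θ) with hp
  obtain ⟨B, hB⟩ : ∃ B, ∀ x, |L x| ≤ B := by
    obtain ⟨B, hB⟩ := (isCompact_range hL).isBounded.exists_norm_le
    exact ⟨B, fun x => hB _ ⟨x, rfl⟩⟩
  -- by compactness and uniqueness: every cluster point of `q` at `θ` is a maximiser at `θ`
  have hcont : ∀ θ, Tendsto q (𝓝 θ) (𝓝 (q θ)) := by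
    intro θ
    refine isCompact_univ.tendsto_nhds_of_unique_mapClusterPt (.of_forall fun _ => Set.mem_univ _) ?_
    intro y _ hy
    refine huniq θ y ?_
    have h1 : MapClusterPt (θ * L y + G y) (𝓝 θ) ((fun x => θ * L x + G x) ∘ q) :=
      hy.continuousAt_comp (f := fun x => θ * L x + G x)
        (show Continuous fun x => θ * L x + G x by fun_prop).continuousAt
    have h2 : Tendsto ((fun x => θ * L x + G x) ∘ q) (𝓝 θ) (𝓝 (p θ)) := by
      have e1 : ∀ θ', p θ - 2 * B * |θ - θ'| ≤ θ * L (q θ') + G (q θ') := by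
        intro θ'
        have := hq θ' (q θ)
        have e2 : |(θ - θ') * L (q θ)| ≤ |θ - θ'| * B := by
          rw [abs_mul]; exact mul_le_mul_of_nonneg_left (hB _) (abs_nonneg _)
        have e3 : |(θ - θ') * L (q θ')| ≤ |θ - θ'| * B := by
          rw [abs_mul]; exact mul_le_mul_of_nonneg_left (hB _) (abs_nonneg _)
        have e4 := (abs_le.1 e2).2
        have e5 := (abs_le.1 e3).1
        simp only [hp]
        linarith
      refine tendsto_of_tendsto_of_tendsto_of_le_of_le (g := fun θ' => p θ - 2 * B * |θ - θ'|) ?_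
        tendsto_const_nhds e1 fun θ' => hq θ (q θ')
      have : Continuous fun θ' => p θ - 2 * B * |θ - θ'| := by fun_prop
      simpa using this.tendsto θ
    have := h1.clusterPt.mono h2
    exact (clusterPt_iff_not_disjoint.1 this |> fun h => by
      by_contra hne; exact h (disjoint_nhds_nhds.2 hne))
  have hLc : Continuous fun θ => L (q θ) :=
    hL.comp (continuous_iff_continuousAt.2 hcont)
  refine ⟨fun θ => ?_, hLc⟩
  rw [hasDerivAt_iff_tendsto_slope]
  have hdiff : Tendsto (fun θ' => |L (q θ') - L (q θ)|) (𝓝[≠] θ) (𝓝 0) := by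
    have : Continuous fun θ' => |L (q θ') - L (q θ)| := (hLc.sub continuous_const).abs
    simpa using (this.tendsto θ).mono_left nhdsWithin_le_nhds
  rw [tendsto_iff_norm_sub_tendsto_zero]
  refine squeeze_zero' (.of_forall fun _ => norm_nonneg _) ?_ hdiff
  filter_upwards [self_mem_nhdsWithin] with θ' hθ'
  have hne : θ' - θ ≠ 0 := sub_ne_zero.2 hθ'
  have h1 := hq θ' (q θ)
  have h2 := hq θ (q θ')
  have h3 : slope p θ θ' - L (q θ) = (p θ' - p θ - (θ' - θ) * L (q θ)) / (θ' - θ) := by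
    rw [slope_def_field]; field_simp
  rw [h3, norm_div, div_le_iff₀ (norm_pos_iff.2 hne), Real.norm_eq_abs, Real.norm_eq_abs, ← abs_mul,
    abs_of_nonneg (by simp only [hp]; linarith)]
  refine le_trans ?_ (le_abs_self _)
  simp only [hp]; linarith

end Envelope

/-! ### The pressure functions -/

section LetterMap

variable {𝒜 : ℕ → Type*} (π : ∀ i, 𝒜 i → 𝒜 (i + 1))

lemma letterMap_refl (i : ℕ) : letterMap π (le_refl i) = id := by
  funext a; exact Nat.leRecOn_self a

lemma letterMap_comp {i j k : ℕ} (h : i ≤ j) (h' : j ≤ k) :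
    letterMap π h' ∘ letterMap π h = letterMap π (h.trans h') := by
  funext a; exact (Nat.leRecOn_trans h h' a).symm

end LetterMap

section Pressure

variable {𝒜 : ℕ → Type*} [∀ i, Fintype (𝒜 i)] [∀ i, MeasurableSpace (𝒜 i)]
  [∀ i, MeasurableSingletonClass (𝒜 i)]
  (π : ∀ i, 𝒜 i → 𝒜 (i + 1)) (γ : ℕ → ℝ) (m : ℕ) (N : ∀ i, 𝒜 i → ℝ)

/-- The mean of `log N` under the probability vector `q`. -/
def meanLog (i : ℕ) (q : 𝒜 i → ℝ) : ℝ := ∑ b, q b * Real.log (N i b)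

/-- The weighted entropy of the Bernoulli measure with weights `q`. -/
def vecEntropy (i : ℕ) (q : 𝒜 i → ℝ) : ℝ :=
  ∑ j : Finset.Icc i m, gammaVec γ i j * entropy (push (letterMap π (Finset.mem_Icc.1 j.2).1) q)

/-- The quantity maximised in the definition of `P_i(θ)`, for the Bernoulli measure with weights
`q`. -/
def objective (i : ℕ) (θ : ℝ) (q : 𝒜 i → ℝ) : ℝ :=
  θ * (cumWeight γ i * meanLog N i q) + vecEntropy π γ m i q

lemma integral_potential (i : ℕ) (θ : ℝ) (ν : Measure (ℕ → 𝒜 i)) [IsProbabilityMeasure ν] :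
    ∫ x, θ * potential γ N i x ∂ν = θ * (cumWeight γ i * meanLog N i (firstMarginal ν)) := by
  have := integral_first_letter ν fun b => θ * (cumWeight γ i * Real.log (N i b))
  simp only [potential, this, meanLog, Finset.mul_sum]
  exact Finset.sum_congr rfl fun b _ => by ring

lemma continuous_meanLog (i : ℕ) : Continuous (meanLog N i) := by
  unfold meanLog; fun_prop

lemma continuous_vecEntropy (i : ℕ) : Continuous (vecEntropy π γ m i) :=
  continuous_finsetSum _ fun _ _ =>
    continuous_const.mul (continuous_entropy.comp (continuous_push _))

variable {π γ m N} {i : ℕ} (hγ : ∀ j ≤ m, 0 < γ j) (hi : i ≤ m)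
include hγ

lemma cumWeight_pos (hi : i ≤ m) : 0 < cumWeight γ i :=
  Finset.sum_pos (fun j hj => hγ j (by simp at hj; omega)) ⟨0, by simp⟩

lemma gammaVec_pos {j : ℕ} (hi : i ≤ m) (hj : j ≤ m) : 0 < gammaVec γ i j := by
  unfold gammaVec
  split_ifs
  · exact cumWeight_pos hγ hi
  · exact hγ j hj

include hi

lemma weightedEntropy_le (ν : Measure (ℕ → 𝒜 i)) [IsProbabilityMeasure ν]
    (hν : MeasurePreserving shift ν ν) :
    weightedEntropy π m (gammaVec γ i) i ν ≤ vecEntropy π γ m i (firstMarginal ν) ∧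
      (weightedEntropy π m (gammaVec γ i) i ν = vecEntropy π γ m i (firstMarginal ν) →
        ν = bernoulli (firstMarginal ν)) := by
  have hle : ∀ j : Finset.Icc i m, gammaVec γ i j *
      shiftEntropy (ν.map (factorMap π (Finset.mem_Icc.1 j.2).1)) ≤
      gammaVec γ i j * entropy (push (letterMap π (Finset.mem_Icc.1 j.2).1) (firstMarginal ν)) :=
    fun j => mul_le_mul_of_nonneg_left (shiftEntropy_map_le ν hν _)
      (gammaVec_pos hγ hi (Finset.mem_Icc.1 j.2).2).le
  refine ⟨Finset.sum_le_sum fun j _ => hle j, fun h => ?_⟩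
  have h1 := (Finset.sum_eq_sum_iff_of_le fun j _ => hle j).1 h
    ⟨i, Finset.mem_Icc.2 ⟨le_rfl, hi⟩⟩ (Finset.mem_univ _)
  have h2 := mul_left_cancel₀ (gammaVec_pos hγ hi hi).ne' h1
  have h3 : factorMap π (le_refl i) = id := by
    funext x; unfold factorMap; rw [letterMap_refl]; rfl
  refine eq_bernoulli_of_shiftEntropy_eq ν hν ?_
  rw [letterMap_refl, push_id] at h2
  rw [← h2]
  congr 1
  exact (congrArg (Measure.map · ν) h3).symm ▸ Measure.map_id.symm

omit hγ hi in
lemma weightedEntropy_bernoulli {q : 𝒜 i → ℝ} (hq : q ∈ stdSimplex ℝ (𝒜 i)) :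
    weightedEntropy π m (gammaVec γ i) i (bernoulli q) = vecEntropy π γ m i q := by
  refine Finset.sum_congr rfl fun j _ => ?_
  congr 1
  have : (bernoulli q).map (factorMap π (Finset.mem_Icc.1 j.2).1) =
      bernoulli (push (letterMap π (Finset.mem_Icc.1 j.2).1) q) := map_bernoulli hq _
  rw [this, shiftEntropy_bernoulli (push_mem_stdSimplex _ hq)]

lemma vecEntropy_midpoint_lt {q q' : 𝒜 i → ℝ} (hq : ∀ a, 0 ≤ q a) (hq' : ∀ a, 0 ≤ q' a)
    (hne : q ≠ q') : (vecEntropy π γ m i q + vecEntropy π γ m i q') / 2 <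
      vecEntropy π γ m i ((1 / 2 : ℝ) • q + (1 / 2 : ℝ) • q') := by
  unfold vecEntropy
  rw [← Finset.sum_add_distrib, Finset.sum_div]
  refine Finset.sum_lt_sum (fun j _ => ?_)
    ⟨⟨i, Finset.mem_Icc.2 ⟨le_rfl, hi⟩⟩, Finset.mem_univ _, ?_⟩
  · have h1 := entropy_push_midpoint (letterMap π (Finset.mem_Icc.1 j.2).1) hq hq'
    have h2 := mul_le_mul_of_nonneg_left h1 (gammaVec_pos hγ hi (Finset.mem_Icc.1 j.2).2).le
    refine le_trans (le_of_eq ?_) h2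
    ring
  · have h1 := entropy_midpoint_lt hq hq' hne
    have h2 := mul_lt_mul_of_pos_left h1 (gammaVec_pos hγ hi hi)
    simp only [letterMap_refl, push_id]
    refine lt_of_le_of_lt (le_of_eq ?_) h2
    ring

/-- The pressure is a maximum over probability vectors, by strict concavity with a unique
maximiser. -/
theorem exists_pressure_maximizer (hS : (simplexOn (liveLetters N i)).Nonempty) :
    ∃ q : ℝ → 𝒜 i → ℝ, (∀ θ, q θ ∈ simplexOn (liveLetters N i)) ∧
      (∀ θ, pressure π γ m N i θ = objective π γ m N i θ (q θ)) ∧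
      (∀ θ, ∀ x ∈ simplexOn (liveLetters N i),
        objective π γ m N i θ x ≤ pressure π γ m N i θ) ∧
      (∀ θ, ∀ x ∈ simplexOn (liveLetters N i),
        objective π γ m N i θ x = pressure π γ m N i θ → x = q θ) ∧
      (∀ θ, HasDerivAt (pressure π γ m N i) (cumWeight γ i * meanLog N i (q θ)) θ) ∧
      (Continuous fun θ => cumWeight γ i * meanLog N i (q θ)) ∧
      ∀ θ ν, IsEquilibriumState π γ m N i θ ν ↔ ν = bernoulli (q θ) := by
  set S := liveLetters N i
  have : CompactSpace (simplexOn S) := isCompact_iff_compactSpace.1 (isCompact_simplexOn S)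
  have : Nonempty (simplexOn S) := hS.to_subtype
  set L : simplexOn S → ℝ := fun x => cumWeight γ i * meanLog N i x.1
  set G : simplexOn S → ℝ := fun x => vecEntropy π γ m i x.1
  have hL : Continuous L := continuous_const.mul ((continuous_meanLog N i).comp continuous_subtype_val)
  have hG : Continuous G := (continuous_vecEntropy π γ m i).comp continuous_subtype_val
  have hmax : ∀ θ : ℝ, ∃ x : simplexOn S, ∀ y, θ * L y + G y ≤ θ * L x + G x := by
    intro θ
    obtain ⟨x, -, hx⟩ := isCompact_univ.exists_isMaxOn (Set.univ_nonempty (α := simplexOn S))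
      (show Continuous fun x => θ * L x + G x by fun_prop).continuousOn
    exact ⟨x, fun y => hx (Set.mem_univ y)⟩
  choose q hq using hmax
  have huniq : ∀ θ x, θ * L x + G x = θ * L (q θ) + G (q θ) → x = q θ := by
    intro θ x hx
    by_contra hne
    have hne' : x.1 ≠ (q θ).1 := fun h => hne (Subtype.ext h)
    have h1 := vecEntropy_midpoint_lt (π := π) hγ hi x.2.1.1 (q θ).2.1.1 hne'
    have h2 := hq θ ⟨_, midpoint_mem_simplexOn x.2 (q θ).2⟩
    have h3 : meanLog N i ((1 / 2 : ℝ) • x.1 + (1 / 2 : ℝ) • (q θ).1) =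
        (meanLog N i x.1 + meanLog N i (q θ).1) / 2 := by
      unfold meanLog
      rw [← Finset.sum_add_distrib, Finset.sum_div]
      refine Finset.sum_congr rfl fun b _ => ?_
      simp only [Pi.add_apply, Pi.smul_apply, smul_eq_mul]; ring
    simp only [L, G, h3] at h2 hx
    nlinarith
  have hval : ∀ θ, IsGreatest {r | ∃ ν : Measure (ℕ → 𝒜 i), IsInvariantOn S ν ∧
      r = ∫ x, θ * potential γ N i x ∂ν + weightedEntropy π m (gammaVec γ i) i ν}
      (θ * L (q θ) + G (q θ)) := by
    intro θ
    constructor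
    · have := isProbabilityMeasure_bernoulli (q θ).2.1
      refine ⟨bernoulli (q θ).1, isInvariantOn_bernoulli (q θ).2.1 (q θ).2.2, ?_⟩
      rw [integral_potential, weightedEntropy_bernoulli (q θ).2.1,
        firstMarginal_bernoulli (q θ).2.1]
    · rintro _ ⟨ν, hν, rfl⟩
      have := hν.prob
      rw [integral_potential]
      refine le_trans ?_ (hq θ ⟨firstMarginal ν, hν.firstMarginal_mem⟩)
      exact add_le_add_right (weightedEntropy_le hγ hi ν hν.invariant).1 _
  have hp : ∀ θ, pressure π γ m N i θ = θ * L (q θ) + G (q θ) := fun θ => (hval θ).csSup_eq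
  have hder := hasDerivAt_of_unique_maximizer hL hG hq huniq
  have hp' : pressure π γ m N i = fun θ => θ * L (q θ) + G (q θ) := funext hp
  refine ⟨fun θ => (q θ).1, fun θ => (q θ).2, hp, ?_, ?_, ?_, hder.2, ?_⟩
  · intro θ x hx
    rw [hp]; exact hq θ ⟨x, hx⟩
  · intro θ x hx h
    rw [hp] at h
    exact congrArg Subtype.val (huniq θ ⟨x, hx⟩ h)
  · rw [hp']; exact hder.1
  · intro θ ν
    constructor
    · rintro ⟨h1, h2⟩
      have := h1.prob
      rw [integral_potential, hp] at h2
      have h3 := (weightedEntropy_le (π := π) hγ hi ν h1.invariant)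
      have h4 := hq θ ⟨firstMarginal ν, h1.firstMarginal_mem⟩
      have h5 : θ * L ⟨firstMarginal ν, h1.firstMarginal_mem⟩ +
        G ⟨firstMarginal ν, h1.firstMarginal_mem⟩ = θ * L (q θ) + G (q θ) := by
        refine le_antisymm h4 ?_
        rw [← h2]
        exact add_le_add_right h3.1 _
      have h6 := h3.2 (by rw [← h2] at h5; exact (add_left_cancel h5).symm)
      rw [h6]
      exact congrArg bernoulli (congrArg Subtype.val (huniq θ _ h5))
    · rintro rfl
      have := isProbabilityMeasure_bernoulli (q θ).2.1
      refine ⟨isInvariantOn_bernoulli (q θ).2.1 (q θ).2.2, ?_⟩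
      rw [integral_potential, weightedEntropy_bernoulli (q θ).2.1,
        firstMarginal_bernoulli (q θ).2.1, hp]

end Pressure

/-! ### Mean weights, and the comparison of the entropy of the weights with that of their means -/

section Counts

variable {α β : Type*} [Fintype α] {Ω : Type*} [MeasurableSpace Ω] {P : Measure Ω}
  [IsProbabilityMeasure P] {c : List α → Ω → α → Bool}

/-- The probability that the letter `a` survives. -/
def survival (P : Measure Ω) (c : List α → Ω → α → Bool) (a : α) : ℝ :=
  P.real {ω | c [] ω a = true}

lemma survival_nonneg (a : α) : 0 ≤ survival P c a := measureReal_nonneg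

lemma survival_le_one (a : α) : survival P c a ≤ 1 := measureReal_le_one

lemma measurableSet_survives (hc : ∀ u, Measurable (c u)) (u : List α) (a : α) :
    MeasurableSet {ω | c u ω a = true} :=
  ((measurable_pi_apply a).comp (hc u)) (measurableSet_singleton true)

lemma integral_ite_survives (hc : ∀ u, Measurable (c u)) (a : α) (x : ℝ) :
    Integrable (fun ω => if c [] ω a = true then x else 0) P ∧
      ∫ ω, (if c [] ω a = true then x else 0) ∂P = survival P c a * x := by
  have h : (fun ω => if c [] ω a = true then x else 0) =
      {ω | c [] ω a = true}.indicator fun _ => x := by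
    funext ω; simp [Set.indicator_apply]
  rw [h]
  refine ⟨(integrable_const x).indicator (measurableSet_survives hc [] a), ?_⟩
  rw [integral_indicator_const _ (measurableSet_survives hc [] a), smul_eq_mul]; rfl

lemma integral_card_survives (hc : ∀ u, Measurable (c u)) (p : α → Prop) :
    ∫ ω, (Nat.card {a : α // c [] ω a = true ∧ p a} : ℝ) ∂P =
      ∑ a, if p a then survival P c a else 0 := by
  have h : ∀ ω, (Nat.card {a : α // c [] ω a = true ∧ p a} : ℝ) =
      ∑ a, if p a then (if c [] ω a = true then (1 : ℝ) else 0) else 0 := by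
    intro ω
    rw [Nat.card_eq_fintype_card, Fintype.card_subtype, Finset.card_filter]
    push_cast
    refine Finset.sum_congr rfl fun a _ => ?_
    by_cases h1 : c [] ω a = true <;> by_cases h2 : p a <;> simp [h1, h2]
  simp only [h]
  rw [integral_finsetSum]
  · refine Finset.sum_congr rfl fun a _ => ?_
    split_ifs
    · rw [(integral_ite_survives hc a 1).2, mul_one]
    · simp
  · intro a _
    split_ifs
    · exact (integral_ite_survives hc a 1).1
    · exact integrable_zero _ _ _

lemma IsPercolation.one_lt_sum_survival (hc : IsPercolation P c) : 1 < ∑ a, survival P c a := by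
  have h1 := integral_card_survives (P := P) hc.measurable fun _ => True
  have h2 := hc.supercritical
  simp only [and_true, if_true] at h1
  rwa [h1] at h2

end Counts

section MeanCount

variable {𝒜 : ℕ → Type*} [∀ i, Fintype (𝒜 i)] (π : ∀ i, 𝒜 i → 𝒜 (i + 1))
  {Ω : Type*} [MeasurableSpace Ω] {P : Measure Ω} [IsProbabilityMeasure P]
  {c : List (𝒜 0) → Ω → 𝒜 0 → Bool}

lemma meanCount_eq_push (hc : ∀ u, Measurable (c u)) (i : ℕ) :
    meanCount π P c i = push (letterMap π (Nat.zero_le i)) (survival P c) := by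
  funext b
  exact integral_card_survives hc fun a => letterMap π (Nat.zero_le i) a = b

end MeanCount

section Comparison

variable {α β : Type*} [Fintype α] [Fintype β] {Ω : Type*} [MeasurableSpace Ω] {P : Measure Ω}
  [IsProbabilityMeasure P] {c : List α → Ω → α → Bool} {W : List α → Ω → α → ℝ≥0}

/-- The mean weights of the letters. -/
def meanWeight (P : Measure Ω) (W : List α → Ω → α → ℝ≥0) (a : α) : ℝ := ∫ ω, (W [] ω a : ℝ) ∂P

lemma IsMandelbrotOn.integrable_weight (h : IsMandelbrotOn P c W) (a : α) :
    Integrable (fun ω => (W [] ω a : ℝ)) P := by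
  have := h.isProbabilityMeasure
  have h1 := Sponge.integrable_weight (P.map (W [])) h.lintegral_sum a
  exact h1.comp_measurable (h.measurable [])

lemma meanWeight_nonneg (a : α) : 0 ≤ meanWeight P W a := integral_nonneg fun ω => by simp

lemma IsMandelbrotOn.marginal_eq_push (h : IsMandelbrotOn P c W) (f : α → β) :
    marginal (P.map (W [])) f = push f (meanWeight P W) := by
  have := h.isProbabilityMeasure
  funext b
  have hi := Sponge.integrable_weight (P.map (W [])) h.lintegral_sum
  rw [marginal, integral_finsetSum, push]
  · refine Finset.sum_congr rfl fun a _ => ?_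
    split_ifs
    · rw [meanWeight]
      exact integral_map (h.measurable []).aemeasurable (hi a).aestronglyMeasurable
    · simp
  · intro a _
    split_ifs
    · exact hi a
    · exact integrable_zero _ _ _

lemma IsMandelbrotOn.meanWeight_mem (h : IsMandelbrotOn P c W) :
    meanWeight P W ∈ stdSimplex ℝ α := by
  have := h.isProbabilityMeasure
  refine ⟨meanWeight_nonneg, ?_⟩
  have h1 := sum_marginal (P.map (W [])) h.lintegral_sum (id : α → α)
  rwa [h.marginal_eq_push, push_id] at h1

lemma IsMandelbrotOn.meanWeight_eq_zero (h : IsMandelbrotOn P c W) {a : α}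
    (ha : survival P c a = 0) : meanWeight P W a = 0 := by
  have h1 : ∀ᵐ ω ∂P, ¬ c [] ω a = true := by
    rw [ae_iff]
    simpa [survival, Measure.real, ENNReal.toReal_eq_zero_iff] using ha
  rw [meanWeight]
  refine integral_eq_zero_of_ae ?_
  filter_upwards [h1, h.supported a] with ω h1 h2
  by_contra h3
  exact h1 (h2 (pos_iff_ne_zero.2 fun h4 => h3 (by simp [h4])))

lemma IsMandelbrotOn.push_meanWeight_mem (h : IsMandelbrotOn P c W) (f : α → β) :
    push f (meanWeight P W) ∈ simplexOn {b | 0 < push f (survival P c) b} := by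
  refine ⟨push_mem_stdSimplex f h.meanWeight_mem, fun b hb => ?_⟩
  have hb' : push f (survival P c) b = 0 :=
    le_antisymm (not_lt.1 hb) (push_nonneg survival_nonneg b)
  rw [push, Finset.sum_eq_zero_iff_of_nonneg fun a _ => by split_ifs <;> simp [survival_nonneg]] at hb'
  refine Finset.sum_eq_zero fun a ha => ?_
  have := hb' a ha
  split_ifs at this ⊢
  · exact h.meanWeight_eq_zero this
  · rfl

/-- The entropy of the weights is at most that of the weights with the same projected means that
depend on the random set only, with equality if and only if the weights are of this form. -/
theorem IsMandelbrotOn.weightEntropy_le (h : IsMandelbrotOn P c W) (hc : ∀ u, Measurable (c u))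
    (hint : ∀ a, Integrable (fun w : α → ℝ≥0 => Real.negMulLog (w a)) (P.map (W []))) (f : α → β) :
    weightEntropy (P.map (W [])) ≤ entropy (push f (meanWeight P W)) +
        ∑ b, push f (meanWeight P W) b * Real.log (push f (survival P c) b) ∧
      (weightEntropy (P.map (W [])) = entropy (push f (meanWeight P W)) +
        ∑ b, push f (meanWeight P W) b * Real.log (push f (survival P c) b) ↔
      ∀ᵐ ω ∂P, ∀ a, (W [] ω a : ℝ) = if c [] ω a = true then
        push f (meanWeight P W) (f a) / push f (survival P c) (f a) else 0) := by
  set q := push f (meanWeight P W)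
  set N := push f (survival P c)
  have hq := h.push_meanWeight_mem f
  have hN0 : ∀ b, 0 ≤ N b := push_nonneg survival_nonneg
  set r : α → ℝ := fun a => q (f a) / N (f a) with hr
  have hr0 : ∀ a, 0 ≤ r a := fun a => div_nonneg (hq.1.1 _) (hN0 _)
  have hintP : ∀ a, Integrable (fun ω => Real.negMulLog (W [] ω a)) P := fun a =>
    (hint a).comp_measurable (h.measurable [])
  have hW := h.integrable_weight
  -- the upper bound of Gibbs' inequality for the weights `r` on the random set
  set R : α → Ω → ℝ := fun a ω =>
    -(W [] ω a * Real.log (r a)) + (if c [] ω a = true then r a else 0) - W [] ω a with hR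
  have hRint : ∀ a, Integrable (R a) P := fun a =>
    (((hW a).mul_const _).neg.add (integral_ite_survives hc a (r a)).1).sub (hW a)
  have hzero : ∀ᵐ ω ∂P, ∀ a, r a = 0 → W [] ω a = 0 := by
    refine ae_all_iff.2 fun a => ?_
    by_cases ha : r a = 0
    · have hqa : q (f a) = 0 := by
        rcases div_eq_zero_iff.1 ha with h1 | h1
        · exact h1
        · exact hq.2 _ (by simp only [Set.mem_ofPred_eq]; exact fun h2 => h2.ne' h1)
      have h1 : meanWeight P W a = 0 := by
        have := Finset.single_le_sum (f := fun a' => if f a' = f a then meanWeight P W a' else 0)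
          (fun a' _ => by split_ifs <;> simp [meanWeight_nonneg]) (Finset.mem_univ a)
        simp only [if_true] at this
        exact le_antisymm (this.trans hqa.le) (meanWeight_nonneg a)
      rw [meanWeight, integral_eq_zero_iff_of_nonneg (fun ω => by simp) (hW a)] at h1
      filter_upwards [h1] with ω h2 _
      simpa using h2
    · exact .of_forall fun ω h1 => absurd h1 ha
  have hsupp : ∀ᵐ ω ∂P, ∀ a, c [] ω a ≠ true → W [] ω a = 0 := by
    refine ae_all_iff.2 fun a => ?_
    filter_upwards [h.supported a] with ω h1 h2
    by_contra h3
    exact h2 (h1 (pos_iff_ne_zero.2 h3))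
  have hpt : ∀ᵐ ω ∂P, ∀ a, Real.negMulLog (W [] ω a) ≤ R a ω ∧
      (Real.negMulLog (W [] ω a) = R a ω ↔ (W [] ω a : ℝ) = if c [] ω a = true then r a else 0) := by
    filter_upwards [hzero, hsupp] with ω h1 h2 a
    by_cases hca : c [] ω a = true
    · simp only [hR, hca, if_true]
      rcases (hr0 a).eq_or_lt with h3 | h3
      · simp [h1 a h3.symm, ← h3]
      · refine ⟨negMulLog_le_of_pos (by simp) h3, eq_of_negMulLog_eq (by simp) h3, fun h4 => ?_⟩
        rw [h4, Real.negMulLog]; ring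
    · simp [hR, hca, h2 a hca]
  have hE : weightEntropy (P.map (W [])) = ∫ ω, ∑ a, Real.negMulLog (W [] ω a) ∂P := by
    rw [weightEntropy]
    exact integral_map (h.measurable []).aemeasurable
      (integrable_finsetSum _ fun a _ => hint a).aestronglyMeasurable
  have hsurv : ∑ a, survival P c a * r a = 1 := by
    rw [hr, ← push_mul_sum f (survival P c) fun b => q b / N b, ← hq.1.2]
    refine Finset.sum_congr rfl fun b _ => ?_
    by_cases hb : 0 < N b
    · exact mul_div_cancel₀ _ hb.ne'
    · have : q b = 0 := hq.2 b hb
      change _ * (q b / N b) = q b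
      rw [this]; simp
  have hRI : ∫ ω, ∑ a, R a ω ∂P = entropy q + ∑ b, q b * Real.log (N b) := by
    rw [integral_finsetSum _ fun a _ => hRint a]
    have h1 : ∀ a, ∫ ω, R a ω ∂P =
        -(meanWeight P W a * Real.log (r a)) + survival P c a * r a - meanWeight P W a := by
      intro a
      have e1 : Integrable (fun ω => -(W [] ω a * Real.log (r a))) P :=
        ((hW a).mul_const (Real.log (r a))).neg
      have e2 := integral_ite_survives (P := P) hc a (r a)
      simp only [hR]
      rw [integral_sub (e1.fun_add e2.1) (hW a), integral_add e1 e2.1, e2.2, integral_neg,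
        integral_mul_const]
      rfl
    simp only [h1]
    rw [Finset.sum_sub_distrib, Finset.sum_add_distrib, hsurv, h.meanWeight_mem.2,
      Finset.sum_neg_distrib, hr, ← push_mul_sum f (meanWeight P W) fun b => Real.log (q b / N b),
      entropy, ← Finset.sum_add_distrib]
    rw [add_sub_cancel_right, ← Finset.sum_neg_distrib]
    refine Finset.sum_congr rfl fun b _ => ?_
    change -(q b * Real.log (q b / N b)) = _
    rcases (hq.1.1 b).eq_or_lt with h2 | h2
    · change 0 = q b at h2
      rw [← h2]; simp
    · have hb : 0 < N b := by
        by_contra h3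
        exact h2.ne' (hq.2 b h3)
      change 0 < q b at h2
      rw [Real.log_div h2.ne' hb.ne', Real.negMulLog]; ring
  have hIN : Integrable (fun ω => ∑ a, Real.negMulLog (W [] ω a)) P :=
    integrable_finsetSum _ fun a _ => hintP a
  have hIR : Integrable (fun ω => ∑ a, R a ω) P := integrable_finsetSum _ fun a _ => hRint a
  have hle : (fun ω => ∑ a, Real.negMulLog (W [] ω a)) ≤ᵐ[P] fun ω => ∑ a, R a ω := by
    filter_upwards [hpt] with ω h1
    exact Finset.sum_le_sum fun a _ => (h1 a).1
  rw [hE, ← hRI]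
  refine ⟨integral_mono_ae hIN hIR hle, ?_⟩
  rw [integral_eq_iff_of_ae_le hIN hIR hle]
  constructor
  · intro h1
    filter_upwards [hpt, h1] with ω h2 h3 a
    exact (h2 a).2.1 ((Finset.sum_eq_sum_iff_of_le fun a _ => (h2 a).1).1 h3 a (Finset.mem_univ a))
  · intro h1
    filter_upwards [hpt, h1] with ω h2 h3
    exact Finset.sum_congr rfl fun a _ => (h2 a).2.2 (h3 a)

end Comparison

/-! ### Weighted entropy dimensions, and the weights given by a Bernoulli measure -/

section Dimension

variable {𝒜 : ℕ → Type*} [∀ i, Fintype (𝒜 i)] [∀ i, MeasurableSpace (𝒜 i)]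
  [∀ i, MeasurableSingletonClass (𝒜 i)] (π : ∀ i, 𝒜 i → 𝒜 (i + 1)) (γ : ℕ → ℝ) (m : ℕ)
  {Ω : Type*} [MeasurableSpace Ω] {P : Measure Ω} [IsProbabilityMeasure P]
  {c : List (𝒜 0) → Ω → 𝒜 0 → Bool} {W : List (𝒜 0) → Ω → 𝒜 0 → ℝ≥0}

/-- The weighted entropy dimension of the Mandelbrot measures generated by `W`. -/
def dimValue (P : Measure Ω) (W : List (𝒜 0) → Ω → 𝒜 0 → ℝ≥0) : ℝ :=
  ∑ j ∈ Finset.range (m + 1), γ j * min (weightEntropy (P.map (W [])))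
    (entropy (push (letterMap π (Nat.zero_le j)) (meanWeight P W)))

lemma IsMandelbrotOn.ae_hasWeightedEntropyDim (h : IsMandelbrotOn P c W) (hpos : IsPositive P W) :
    ∀ᵐ ω ∂P, randomMeasure W ω ≠ 0 →
      HasWeightedEntropyDim π γ m (randomMeasure W ω) (dimValue π γ m P W) := by
  have := h.isProbabilityMeasure
  have := h.nonempty
  have hall := fun j : ℕ => h.ae_of_treeLaw (ae_hasEntropyDim _ h.lintegral_sum
    (h.isPositive_iff.1 hpos) (letterMap π (Nat.zero_le j)))
  filter_upwards [ae_all_iff.2 hall, h.ae_of_treeLaw (ae_regular _ h.lintegral_sum)] with ω h1 h2 h3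
  refine ⟨fun j => min (weightEntropy (P.map (W [])))
    (entropy (push (letterMap π (Nat.zero_le j)) (meanWeight P W))), fun j _ => ?_, rfl⟩
  have h4 := h1 j (h2.mandelbrotMeasure_ne_zero_iff.1 h3)
  rw [h.marginal_eq_push] at h4
  exact h4

lemma HasWeightedEntropyDim.unique {μ : Measure (ℕ → 𝒜 0)} {D D' : ℝ}
    (h : HasWeightedEntropyDim π γ m μ D) (h' : HasWeightedEntropyDim π γ m μ D') : D = D' := by
  obtain ⟨d, hd, rfl⟩ := h
  obtain ⟨d', hd', rfl⟩ := h'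
  refine Finset.sum_congr rfl fun i hi => ?_
  have hi' : i ≤ m := by simp at hi; omega
  rw [tendsto_nhds_unique (hd i hi') (hd' i hi')]

lemma IsMandelbrotOn.eq_dimValue (h : IsMandelbrotOn P c W) (hpos : IsPositive P W) {D : ℝ}
    (hD : ∀ᵐ ω ∂P, randomMeasure W ω ≠ 0 → HasWeightedEntropyDim π γ m (randomMeasure W ω) D) :
    D = dimValue π γ m P W := by
  by_contra hne
  have h1 : ∀ᵐ ω ∂P, ¬ randomMeasure W ω ≠ 0 := by
    filter_upwards [hD, h.ae_hasWeightedEntropyDim π γ m hpos] with ω h1 h2 h3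
    exact hne ((h1 h3).unique π γ m (h2 h3))
  rw [ae_iff] at h1
  simp only [not_not] at h1
  exact hpos.ne' h1

lemma IsMandelbrotOn.integrable_negMulLog (h : IsMandelbrotOn P c W) (hpos : IsPositive P W)
    (a : 𝒜 0) : Integrable (fun w : 𝒜 0 → ℝ≥0 => Real.negMulLog (w a)) (P.map (W [])) := by
  have := h.isProbabilityMeasure
  exact Sponge.integrable_negMulLog _ h.lintegral_sum (h.isPositive_iff.1 hpos) a

lemma IsMandelbrotOn.isPositive (h : IsMandelbrotOn P c W)
    (hint : ∀ a, Integrable (fun w : 𝒜 0 → ℝ≥0 => Real.negMulLog (w a)) (P.map (W [])))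
    (hpos : 0 < weightEntropy (P.map (W []))) : IsPositive P W := by
  have := h.isProbabilityMeasure
  have := h.nonempty
  exact h.isPositive_iff.2 (treeLaw_Y_ne_zero _ h.lintegral_sum hint hpos)

/-- Families of weights that agree almost surely at the root and are functions of the random set there
generate almost surely equal measures. -/
lemma IsMandelbrotOn.ae_randomMeasure_eq (h : IsMandelbrotOn P c W) {g : (𝒜 0 → Bool) → 𝒜 0 → ℝ≥0}
    (hW : ∀ᵐ ω ∂P, W [] ω = g (c [] ω)) :
    ∀ᵐ ω ∂P, randomMeasure W ω = randomMeasure (fun u ω => g (c u ω)) ω := by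
  have h1 : ∀ u, ∀ᵐ ω ∂P, W u ω = g (c u ω) := by
    intro u
    have hm : MeasurableSet {p : (𝒜 0 → Bool) × (𝒜 0 → ℝ≥0) | p.2 = g p.1} :=
      measurableSet_eq_fun measurable_snd ((measurable_of_finite g).comp measurable_fst)
    exact (h.ident u).symm.ae_snd hm hW
  filter_upwards [ae_all_iff.2 h1] with ω hω
  unfold randomMeasure
  congr 1
  funext u
  exact hω u

end Dimension

section BernoulliWeights

variable {𝒜 : ℕ → Type*} [∀ i, Fintype (𝒜 i)] [∀ i, MeasurableSpace (𝒜 i)]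
  [∀ i, MeasurableSingletonClass (𝒜 i)] (π : ∀ i, 𝒜 i → 𝒜 (i + 1))
  {Ω : Type*} [MeasurableSpace Ω] {P : Measure Ω} [IsProbabilityMeasure P]
  {c : List (𝒜 0) → Ω → 𝒜 0 → Bool} (hc : IsPercolation P c) {i : ℕ} {q : 𝒜 i → ℝ}
  (hq : q ∈ simplexOn (liveLetters (meanCount π P c) i))
include hc hq

omit hc in
lemma bernoulliWeights_eq (u : List (𝒜 0)) (ω : Ω) :
    bernoulliWeights π (meanCount π P c) c i (bernoulli q) u ω = fun a =>
      if c u ω a = true then ((q (letterMap π (Nat.zero_le i) a)).toNNReal /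
        (meanCount π P c i (letterMap π (Nat.zero_le i) a)).toNNReal) else 0 := by
  have h1 : ∀ b, (bernoulli q (cyl [b])).toNNReal = (q b).toNNReal := by
    intro b
    have h2 := bernoulli_real_cyl hq.1 [b]
    simp only [List.map_cons, List.map_nil, List.prod_cons, List.prod_nil, mul_one] at h2
    rw [← h2]
    simp [Measure.real, ENNReal.toReal]
  funext a
  simp only [bernoulliWeights, h1]

omit hq in
lemma meanCount_nonneg (b : 𝒜 i) : 0 ≤ meanCount π P c i b := by
  rw [meanCount_eq_push π hc.measurable]; exact push_nonneg survival_nonneg b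

lemma coe_bernoulliWeights (u : List (𝒜 0)) (ω : Ω) (a : 𝒜 0) :
    (bernoulliWeights π (meanCount π P c) c i (bernoulli q) u ω a : ℝ) = if c u ω a = true then
      q (letterMap π (Nat.zero_le i) a) / meanCount π P c i (letterMap π (Nat.zero_le i) a)
      else 0 := by
  rw [bernoulliWeights_eq π hq]
  dsimp only
  split_ifs
  · rw [NNReal.coe_div, Real.coe_toNNReal _ (hq.1.1 _),
      Real.coe_toNNReal _ (meanCount_nonneg π hc _)]
  · rfl

lemma sum_survival_mul : ∑ a, survival P c a * (q (letterMap π (Nat.zero_le i) a) /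
    meanCount π P c i (letterMap π (Nat.zero_le i) a)) = 1 := by
  rw [← push_mul_sum (letterMap π (Nat.zero_le i)) (survival P c) fun b => q b / meanCount π P c i b,
    ← meanCount_eq_push π hc.measurable, ← hq.1.2]
  refine Finset.sum_congr rfl fun b _ => ?_
  by_cases hb : 0 < meanCount π P c i b
  · exact mul_div_cancel₀ _ hb.ne'
  · rw [hq.2 b hb]; simp

lemma isMandelbrotOn_bernoulliWeights :
    IsMandelbrotOn P c (bernoulliWeights π (meanCount π P c) c i (bernoulli q)) := by
  set g : (𝒜 0 → Bool) → 𝒜 0 → ℝ≥0 := fun s a => if s a = true then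
    ((q (letterMap π (Nat.zero_le i) a)).toNNReal /
      (meanCount π P c i (letterMap π (Nat.zero_le i) a)).toNNReal) else 0 with hg
  have hW : bernoulliWeights π (meanCount π P c) c i (bernoulli q) = fun u ω => g (c u ω) := by
    funext u ω; rw [bernoulliWeights_eq π hq]
  have hgm : Measurable g := measurable_of_finite g
  have hgm2 : Measurable fun s : 𝒜 0 → Bool => (s, g s) := measurable_id.prodMk hgm
  rw [hW]
  refine ⟨fun u => hgm.comp (hc.measurable u), hc.indep.comp (fun _ s => (s, g s)) fun _ => hgm2,
    fun u => (hc.ident u).comp hgm2, fun a => .of_forall fun ω h => ?_, ?_⟩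
  · by_contra h1
    simp [hg, h1] at h
  · have h1 : ∀ a ω, ((g (c [] ω) a : ℝ≥0) : ℝ≥0∞) = ENNReal.ofReal (if c [] ω a = true then
        q (letterMap π (Nat.zero_le i) a) / meanCount π P c i (letterMap π (Nat.zero_le i) a)
        else 0) := by
      intro a ω
      rw [← coe_bernoulliWeights π hc hq, hW]; simp
    have hnn : ∀ a ω, 0 ≤ (if c [] ω a = true then
        q (letterMap π (Nat.zero_le i) a) / meanCount π P c i (letterMap π (Nat.zero_le i) a)
        else 0) := by
      intro a ω; rw [← coe_bernoulliWeights π hc hq]; simp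
    simp only [h1]
    have h2 := fun a => integral_ite_survives (P := P) hc.measurable a
      (q (letterMap π (Nat.zero_le i) a) / meanCount π P c i (letterMap π (Nat.zero_le i) a))
    have h3 : ∀ ω, ∑ a, ENNReal.ofReal (if c [] ω a = true then
        q (letterMap π (Nat.zero_le i) a) / meanCount π P c i (letterMap π (Nat.zero_le i) a)
        else 0) = ENNReal.ofReal (∑ a, if c [] ω a = true then
        q (letterMap π (Nat.zero_le i) a) / meanCount π P c i (letterMap π (Nat.zero_le i) a)
        else 0) := fun ω => (ENNReal.ofReal_sum_of_nonneg fun a _ => hnn a ω).symm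
    simp only [h3]
    rw [← ofReal_integral_eq_lintegral_ofReal (integrable_finsetSum _ fun a _ => (h2 a).1)
      (.of_forall fun ω => Finset.sum_nonneg fun a _ => hnn a ω),
      integral_finsetSum _ fun a _ => (h2 a).1]
    simp only [fun a => (h2 a).2]
    rw [sum_survival_mul π hc hq, ENNReal.ofReal_one]

lemma meanWeight_bernoulliWeights (a : 𝒜 0) :
    meanWeight P (bernoulliWeights π (meanCount π P c) c i (bernoulli q)) a = survival P c a *
      (q (letterMap π (Nat.zero_le i) a) / meanCount π P c i (letterMap π (Nat.zero_le i) a)) := by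
  simp only [meanWeight, coe_bernoulliWeights π hc hq]
  exact (integral_ite_survives hc.measurable a _).2

/-- The projection to an intermediate alphabet of the mean weights. -/
lemma push_meanWeight_bernoulliWeights {k : ℕ} (hk : k ≤ i) (b : 𝒜 k) :
    push (letterMap π (Nat.zero_le k))
      (meanWeight P (bernoulliWeights π (meanCount π P c) c i (bernoulli q))) b =
      meanCount π P c k b * (q (letterMap π hk b) / meanCount π P c i (letterMap π hk b)) := by
  rw [meanCount_eq_push π hc.measurable k, push, push, Finset.sum_mul]
  refine Finset.sum_congr rfl fun a _ => ?_
  split_ifs with h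
  · rw [meanWeight_bernoulliWeights π hc hq, ← letterMap_comp π (Nat.zero_le k) hk,
      Function.comp_apply, h]
  · rw [zero_mul]

lemma push_meanWeight_bernoulliWeights_self :
    push (letterMap π (Nat.zero_le i))
      (meanWeight P (bernoulliWeights π (meanCount π P c) c i (bernoulli q))) = q := by
  funext b
  rw [push_meanWeight_bernoulliWeights π hc hq le_rfl, letterMap_refl, id]
  by_cases hb : 0 < meanCount π P c i b
  · exact mul_div_cancel₀ _ hb.ne'
  · rw [hq.2 b hb]; simp

lemma integrable_negMulLog_bernoulliWeights (a : 𝒜 0) :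
    Integrable (fun w : 𝒜 0 → ℝ≥0 => Real.negMulLog (w a))
      (P.map (bernoulliWeights π (meanCount π P c) c i (bernoulli q) [])) := by
  have hm := (isMandelbrotOn_bernoulliWeights π hc hq).measurable []
  have hm2 : Measurable fun w : 𝒜 0 → ℝ≥0 => Real.negMulLog (w a) :=
    Real.continuous_negMulLog.measurable.comp (by fun_prop)
  rw [integrable_map_measure hm2.aestronglyMeasurable hm.aemeasurable]
  have : (fun w : 𝒜 0 → ℝ≥0 => Real.negMulLog (w a)) ∘
      bernoulliWeights π (meanCount π P c) c i (bernoulli q) [] = fun ω => if c [] ω a = true then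
      Real.negMulLog (q (letterMap π (Nat.zero_le i) a) /
        meanCount π P c i (letterMap π (Nat.zero_le i) a)) else 0 := by
    funext ω
    simp only [Function.comp_apply, coe_bernoulliWeights π hc hq]
    split_ifs <;> simp
  rw [this]
  exact (integral_ite_survives hc.measurable a _).1

lemma weightEntropy_bernoulliWeights :
    weightEntropy (P.map (bernoulliWeights π (meanCount π P c) c i (bernoulli q) [])) =
      entropy q + meanLog (meanCount π P c) i q := by
  have h1 := ((isMandelbrotOn_bernoulliWeights π hc hq).weightEntropy_le hc.measurable
    (integrable_negMulLog_bernoulliWeights π hc hq) (letterMap π (Nat.zero_le i))).2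
  rw [push_meanWeight_bernoulliWeights_self π hc hq, ← meanCount_eq_push π hc.measurable] at h1
  exact h1.2 (.of_forall fun ω a => coe_bernoulliWeights π hc hq [] ω a)

end BernoulliWeights

/-! ### The optimisation problem -/

section Reals

variable {γ h : ℕ → ℝ} {m i : ℕ} {E L θ : ℝ}

lemma sum_range_split (hi : i ≤ m) (f : ℕ → ℝ) : ∑ j ∈ Finset.range (m + 1), f j =
    ∑ j ∈ Finset.range i, f j + f i + ∑ j ∈ Finset.Ico (i + 1) (m + 1), f j := by
  rw [← Finset.sum_range_succ, Finset.sum_range_add_sum_Ico _ (by omega)]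

lemma cumWeight_eq : cumWeight γ i = ∑ j ∈ Finset.range i, γ j + γ i := Finset.sum_range_succ _ _

lemma thetaTilde_mul (hΓ : 0 < cumWeight γ i) :
    thetaTilde γ i * cumWeight γ i = ∑ j ∈ Finset.range i, γ j := div_mul_cancel₀ _ hΓ.ne'

lemma thetaTilde_pos (hγ : ∀ j ≤ m, 0 < γ j) (h1 : 1 ≤ i) (hi : i ≤ m) : 0 < thetaTilde γ i :=
  div_pos (Finset.sum_pos (fun j hj => hγ j (by simp at hj; omega)) ⟨0, by simp; omega⟩)
    (cumWeight_pos hγ hi)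

lemma thetaTilde_le_one (hγ : ∀ j ≤ m, 0 < γ j) (hi : i ≤ m) : thetaTilde γ i ≤ 1 := by
  rw [thetaTilde, div_le_one (cumWeight_pos hγ hi), cumWeight_eq]
  linarith [hγ i hi]

/-- The upper bound for a weighted sum of minima, obtained by bounding the minima by `E` below the level
`i`, by `h j` above it, and by a convex combination of both at this level. -/
lemma sum_mul_min_le (hγ : ∀ j ≤ m, 0 < γ j) (hi : i ≤ m) (hθ : thetaTilde γ i ≤ θ) (hθ1 : θ ≤ 1)
    (hE : E ≤ h i + L) :
    ∑ j ∈ Finset.range (m + 1), γ j * min E (h j) ≤ θ * (cumWeight γ i * L) +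
        (cumWeight γ i * h i + ∑ j ∈ Finset.Ico (i + 1) (m + 1), γ j * h j) ∧
      (∑ j ∈ Finset.range (m + 1), γ j * min E (h j) = θ * (cumWeight γ i * L) +
        (cumWeight γ i * h i + ∑ j ∈ Finset.Ico (i + 1) (m + 1), γ j * h j) →
        0 < θ → E = h i + L) := by
  have hΓ := cumWeight_pos hγ hi
  set Γ := cumWeight γ i with hΓdef
  have hG := thetaTilde_mul hΓ
  have hΓ' : Γ = ∑ j ∈ Finset.range i, γ j + γ i := cumWeight_eq
  have h1 : ∑ j ∈ Finset.range i, γ j * min E (h j) ≤ (∑ j ∈ Finset.range i, γ j) * E := by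
    rw [Finset.sum_mul]
    exact Finset.sum_le_sum fun j hj => mul_le_mul_of_nonneg_left (min_le_left _ _)
      (hγ j (by simp at hj; omega)).le
  have h2 : ∑ j ∈ Finset.Ico (i + 1) (m + 1), γ j * min E (h j) ≤
      ∑ j ∈ Finset.Ico (i + 1) (m + 1), γ j * h j :=
    Finset.sum_le_sum fun j hj => mul_le_mul_of_nonneg_left (min_le_right _ _)
      (hγ j (by simp at hj; omega)).le
  set G := ∑ j ∈ Finset.range i, γ j
  have hGθ : G ≤ θ * Γ := hG ▸ mul_le_mul_of_nonneg_right hθ hΓ.le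
  have h3 : γ i * min E (h i) ≤ (θ * Γ - G) * E + (1 - θ) * Γ * h i := by
    have e1 : γ i = (θ * Γ - G) + (1 - θ) * Γ := by linarith
    rw [e1, add_mul]
    exact add_le_add (mul_le_mul_of_nonneg_left (min_le_left _ _) (by linarith))
      (mul_le_mul_of_nonneg_left (min_le_right _ _) (mul_nonneg (by linarith) hΓ.le))
  rw [sum_range_split hi]
  have h4 : ∑ j ∈ Finset.range i, γ j * min E (h j) + γ i * min E (h i) +
      ∑ j ∈ Finset.Ico (i + 1) (m + 1), γ j * min E (h j) ≤
      θ * Γ * E + (1 - θ) * Γ * h i + ∑ j ∈ Finset.Ico (i + 1) (m + 1), γ j * h j := by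
    linarith
  constructor
  · have hθ0 : 0 ≤ θ * Γ := le_trans
      (Finset.sum_nonneg fun j hj => (hγ j (by simp at hj; omega)).le) hGθ
    have := mul_le_mul_of_nonneg_left hE hθ0
    linarith
  · intro h5 hθ0
    refine le_antisymm hE ?_
    rw [h5] at h4
    have h6 : θ * Γ * (h i + L) ≤ θ * Γ * E := by linarith
    exact le_of_mul_le_mul_left h6 (mul_pos hθ0 hΓ)

lemma sum_mul_min_eq (hi : i ≤ m) (h1 : ∀ j < i, E ≤ h j) (h2 : ∀ j, i < j → j ≤ m → h j ≤ E) :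
    ∑ j ∈ Finset.range (m + 1), γ j * min E (h j) = (∑ j ∈ Finset.range i, γ j) * E +
      γ i * min E (h i) + ∑ j ∈ Finset.Ico (i + 1) (m + 1), γ j * h j := by
  rw [sum_range_split hi, Finset.sum_mul]
  congr 1
  · congr 1
    exact Finset.sum_congr rfl fun j hj => by rw [min_eq_left (h1 j (Finset.mem_range.1 hj))]
  · exact Finset.sum_congr rfl fun j hj => by
      rw [min_eq_right (h2 j (by simp at hj; omega) (by simp at hj; omega))]

end Reals

section Optimisation

variable {𝒜 : ℕ → Type*} [∀ i, Fintype (𝒜 i)] [∀ i, MeasurableSpace (𝒜 i)]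
  [∀ i, MeasurableSingletonClass (𝒜 i)] (π : ∀ i, 𝒜 i → 𝒜 (i + 1)) (γ : ℕ → ℝ) (m : ℕ)

/-- The entropy of the projection of `r` to the level `j`. -/
def levelEntropy {k : ℕ} (r : 𝒜 k → ℝ) (j : ℕ) : ℝ :=
  if h : k ≤ j then entropy (push (letterMap π h) r) else 0

lemma levelEntropy_of_le {k j : ℕ} (r : 𝒜 k → ℝ) (h : k ≤ j) :
    levelEntropy π r j = entropy (push (letterMap π h) r) := dif_pos h

lemma vecEntropy_push {k l : ℕ} (hkl : k ≤ l) (hl : l ≤ m) (r : 𝒜 k → ℝ) :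
    vecEntropy π γ m l (push (letterMap π hkl) r) = cumWeight γ l * levelEntropy π r l +
      ∑ j ∈ Finset.Ico (l + 1) (m + 1), γ j * levelEntropy π r j := by
  have h1 : vecEntropy π γ m l (push (letterMap π hkl) r) =
      ∑ j : Finset.Icc l m, gammaVec γ l j * levelEntropy π r j := by
    refine Finset.sum_congr rfl fun j _ => ?_
    have := (Finset.mem_Icc.1 j.2).1
    rw [levelEntropy_of_le π r (hkl.trans this), push_push, letterMap_comp]
  rw [h1, Finset.sum_coe_sort (Finset.Icc l m) fun j => gammaVec γ l j * levelEntropy π r j,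
    show Finset.Icc l m = Finset.Ico l (m + 1) by ext; simp,
    Finset.sum_eq_sum_Ico_succ_bot (by omega)]
  congr 1
  · simp [gammaVec]
  · refine Finset.sum_congr rfl fun j hj => ?_
    rw [gammaVec, if_neg (by simp at hj; omega)]

lemma levelEntropy_anti {k j l : ℕ} {r : 𝒜 k → ℝ} (hr : ∀ a, 0 ≤ r a) (hkj : k ≤ j) (hjl : j ≤ l) :
    levelEntropy π r l ≤ levelEntropy π r j := by
  rw [levelEntropy_of_le π r hkj, levelEntropy_of_le π r (hkj.trans hjl), ← letterMap_comp π hkj hjl,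
    ← push_push]
  exact entropy_push_le _ (push_nonneg hr)

lemma levelEntropy_nonneg {k : ℕ} {r : 𝒜 k → ℝ} (hr : r ∈ stdSimplex ℝ (𝒜 k)) (j : ℕ) :
    0 ≤ levelEntropy π r j := by
  unfold levelEntropy
  split_ifs
  · exact entropy_nonneg (push_mem_stdSimplex _ hr)
  · rfl

variable {π γ m} {Ω : Type*} [MeasurableSpace Ω] {P : Measure Ω} [IsProbabilityMeasure P]
  {c : List (𝒜 0) → Ω → 𝒜 0 → Bool} (hc : IsPercolation P c)
  {W : List (𝒜 0) → Ω → 𝒜 0 → ℝ≥0}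

lemma dimValue_eq : dimValue π γ m P W = ∑ j ∈ Finset.range (m + 1), γ j *
    min (weightEntropy (P.map (W []))) (levelEntropy π (meanWeight P W) j) :=
  Finset.sum_congr rfl fun j _ => by rw [levelEntropy_of_le π _ (Nat.zero_le j)]

include hc

lemma IsMandelbrotOn.push_meanWeight_mem_live (h : IsMandelbrotOn P c W) (i : ℕ) :
    push (letterMap π (Nat.zero_le i)) (meanWeight P W) ∈
      simplexOn (liveLetters (meanCount π P c) i) := by
  rw [liveLetters, meanCount_eq_push π hc.measurable]
  exact h.push_meanWeight_mem _

lemma IsMandelbrotOn.weightEntropy_le_level (h : IsMandelbrotOn P c W)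
    (hint : ∀ a, Integrable (fun w : 𝒜 0 → ℝ≥0 => Real.negMulLog (w a)) (P.map (W []))) (i : ℕ) :
    weightEntropy (P.map (W [])) ≤ levelEntropy π (meanWeight P W) i +
      meanLog (meanCount π P c) i (push (letterMap π (Nat.zero_le i)) (meanWeight P W)) := by
  rw [levelEntropy_of_le π _ (Nat.zero_le i), meanLog, meanCount_eq_push π hc.measurable]
  exact (h.weightEntropy_le hc.measurable hint _).1

lemma IsMandelbrotOn.weightEntropy_le_zero_level (h : IsMandelbrotOn P c W)
    (hint : ∀ a, Integrable (fun w : 𝒜 0 → ℝ≥0 => Real.negMulLog (w a)) (P.map (W []))) :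
    weightEntropy (P.map (W [])) ≤ levelEntropy π (meanWeight P W) 0 := by
  refine (h.weightEntropy_le_level (π := π) hc hint 0).trans (add_le_of_nonpos_right ?_)
  rw [meanLog, letterMap_refl, push_id, meanCount_eq_push π hc.measurable, letterMap_refl, push_id]
  exact Finset.sum_nonpos fun a _ => mul_nonpos_of_nonneg_of_nonpos (meanWeight_nonneg a)
    (Real.log_nonpos (survival_nonneg a) (survival_le_one a))

/-- The free energy `H(q) + ∑ q log N` does not decrease under projection. -/
lemma entropy_add_meanLog_le {k l : ℕ} (hkl : k ≤ l) {r : 𝒜 k → ℝ}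
    (hr : r ∈ simplexOn (liveLetters (meanCount π P c) k)) :
    entropy r + meanLog (meanCount π P c) k r ≤ entropy (push (letterMap π hkl) r) +
      meanLog (meanCount π P c) l (push (letterMap π hkl) r) := by
  have h1 := (isMandelbrotOn_bernoulliWeights π hc hr).weightEntropy_le_level (π := π) hc
    (integrable_negMulLog_bernoulliWeights π hc hr) l
  rw [weightEntropy_bernoulliWeights π hc hr, levelEntropy_of_le π _ (Nat.zero_le l)] at h1
  have h2 : push (letterMap π (Nat.zero_le l)) (meanWeight P
      (bernoulliWeights π (meanCount π P c) c k (bernoulli r))) = push (letterMap π hkl) r := by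
    rw [← letterMap_comp π (Nat.zero_le k) hkl, ← push_push,
      push_meanWeight_bernoulliWeights_self π hc hr]
  rwa [h2] at h1

/-- The normalised mean counts. -/
lemma exists_mem_simplexOn (i : ℕ) : ∃ q ∈ simplexOn (liveLetters (meanCount π P c) i),
    0 < entropy q + meanLog (meanCount π P c) i q := by
  set N := meanCount π P c i
  have hN0 : ∀ b, 0 ≤ N b := meanCount_nonneg π hc
  have hT : 1 < ∑ b, N b := by
    have := push_mul_sum (letterMap π (Nat.zero_le i)) (survival P c) fun _ => 1
    simp only [mul_one, ← meanCount_eq_push π hc.measurable] at this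
    rw [this]; exact hc.one_lt_sum_survival
  set T := ∑ b, N b
  have hT0 : 0 < T := by linarith
  refine ⟨fun b => N b / T, ⟨⟨fun b => div_nonneg (hN0 b) hT0.le, ?_⟩, fun b hb => ?_⟩, ?_⟩
  · rw [← Finset.sum_div, div_self hT0.ne']
  · have : N b = 0 := le_antisymm (not_lt.1 hb) (hN0 b)
    dsimp only
    rw [this, zero_div]
  · have : entropy (fun b => N b / T) + meanLog (meanCount π P c) i (fun b => N b / T) =
        Real.log T := by
      rw [entropy, meanLog, ← Finset.sum_add_distrib]
      calc _ = ∑ b, N b / T * Real.log T := by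
            refine Finset.sum_congr rfl fun b _ => ?_
            change Real.negMulLog (N b / T) + N b / T * Real.log (N b) = _
            rcases (hN0 b).eq_or_lt with h | h
            · rw [← h]; simp
            · rw [Real.negMulLog, Real.log_div h.ne' hT0.ne']; ring
        _ = _ := by rw [← Finset.sum_mul, ← Finset.sum_div, div_self hT0.ne', one_mul]
    rw [this]
    exact Real.log_pos hT

variable (hγ : ∀ j ≤ m, 0 < γ j)
include hγ

lemma pressure_pos {i : ℕ} (hi : i ≤ m) {θ : ℝ} (hθ : 0 < θ) (hθ1 : θ ≤ 1) :
    0 < pressure π γ m (meanCount π P c) i θ := by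
  obtain ⟨q, hq, hpos⟩ := exists_mem_simplexOn (π := π) hc i
  obtain ⟨-, -, -, hle, -⟩ := exists_pressure_maximizer (π := π) hγ hi ⟨q, hq⟩
  refine lt_of_lt_of_le ?_ (hle θ q hq)
  have hΓ := cumWeight_pos hγ hi
  have h1 := vecEntropy_push π γ m le_rfl hi q
  rw [letterMap_refl, push_id, levelEntropy_of_le π q le_rfl, letterMap_refl, push_id] at h1
  have h2 : 0 ≤ ∑ j ∈ Finset.Ico (i + 1) (m + 1), γ j * levelEntropy π q j :=
    Finset.sum_nonneg fun j hj => mul_nonneg (hγ j (by simp at hj; omega)).le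
      (levelEntropy_nonneg π hq.1 j)
  rw [objective, h1]
  have h3 : 0 < θ * cumWeight γ i * (entropy q + meanLog (meanCount π P c) i q) :=
    mul_pos (mul_pos hθ hΓ) hpos
  have h4 : 0 ≤ (1 - θ) * (cumWeight γ i * entropy q) :=
    mul_nonneg (by linarith) (mul_nonneg hΓ.le (entropy_nonneg hq.1))
  linarith

/-- The upper bound for the weighted entropy dimension in terms of the pressures. -/
lemma IsMandelbrotOn.dimValue_le_objective (h : IsMandelbrotOn P c W)
    (hint : ∀ a, Integrable (fun w : 𝒜 0 → ℝ≥0 => Real.negMulLog (w a)) (P.map (W [])))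
    {i : ℕ} (hi : i ≤ m) {θ : ℝ} (hθ : thetaTilde γ i ≤ θ) (hθ1 : θ ≤ 1) :
    dimValue π γ m P W ≤ objective π γ m (meanCount π P c) i θ
        (push (letterMap π (Nat.zero_le i)) (meanWeight P W)) ∧
      (dimValue π γ m P W = objective π γ m (meanCount π P c) i θ
        (push (letterMap π (Nat.zero_le i)) (meanWeight P W)) → 0 < θ →
      weightEntropy (P.map (W [])) = levelEntropy π (meanWeight P W) i +
        meanLog (meanCount π P c) i (push (letterMap π (Nat.zero_le i)) (meanWeight P W))) := by
  rw [objective, vecEntropy_push π γ m (Nat.zero_le i) hi, dimValue_eq]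
  exact sum_mul_min_le hγ hi hθ hθ1 (h.weightEntropy_le_level hc hint i)

/-- If `P_k'(1) < 0`, then for the weights given by the maximiser `q` of `P_{k+1}` at `thetaTilde` the
entropy of the weights is at most that of their projected means at the level `k`: these means
form the maximiser of `P_k` at `1`. -/
lemma weightEntropy_le_of_deriv_neg {k : ℕ} (hk : k + 1 ≤ m) {q : 𝒜 (k + 1) → ℝ}
    (hq : q ∈ simplexOn (liveLetters (meanCount π P c) (k + 1)))
    (hmax : pressure π γ m (meanCount π P c) (k + 1) (thetaTilde γ (k + 1)) =
      objective π γ m (meanCount π P c) (k + 1) (thetaTilde γ (k + 1)) q)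
    (hneg : deriv (pressure π γ m (meanCount π P c) k) 1 < 0) :
    entropy q + meanLog (meanCount π P c) (k + 1) q ≤ levelEntropy π (meanWeight P
      (bernoulliWeights π (meanCount π P c) c (k + 1) (bernoulli q))) k := by
  set N := meanCount π P c
  set W := bernoulliWeights π N c (k + 1) (bernoulli q)
  have hW : IsMandelbrotOn P c W := isMandelbrotOn_bernoulliWeights π hc hq
  have hint := integrable_negMulLog_bernoulliWeights π hc hq
  set r := push (letterMap π (Nat.zero_le k)) (meanWeight P W) with hr
  have hrmem : r ∈ simplexOn (liveLetters N k) := hW.push_meanWeight_mem_live hc k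
  have hkk : k ≤ k + 1 := Nat.le_succ k
  have hrq : push (letterMap π hkk) r = q := by
    rw [hr, push_push, letterMap_comp]
    exact push_meanWeight_bernoulliWeights_self π hc hq
  obtain ⟨qk, hqk, hpk, hlek, huk, hdk, -, -⟩ :=
    exists_pressure_maximizer (π := π) (N := N) hγ (by omega : k ≤ m) ⟨r, hrmem⟩
  obtain ⟨-, -, -, hle1, -⟩ := exists_pressure_maximizer (π := π) (N := N) hγ hk ⟨q, hq⟩
  have hΓ := cumWeight_pos hγ hk
  have hΓk := cumWeight_pos hγ (by omega : k ≤ m)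
  have hG : thetaTilde γ (k + 1) * cumWeight γ (k + 1) = cumWeight γ k := thetaTilde_mul hΓ
  have hΓ1 : cumWeight γ (k + 1) = cumWeight γ k + γ (k + 1) := cumWeight_eq
  -- the objective of `P_k` at `1` is that of `P_{k+1}` at `thetaTilde`, minus a multiple of the gain of free
  -- energy under projection, which is nonnegative and vanishes at `r`
  have hobj : ∀ x : 𝒜 k → ℝ, objective π γ m N k 1 x =
      objective π γ m N (k + 1) (thetaTilde γ (k + 1)) (push (letterMap π hkk) x) +
      cumWeight γ k * ((entropy x + meanLog N k x) - (entropy (push (letterMap π hkk) x) +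
        meanLog N (k + 1) (push (letterMap π hkk) x))) := by
    intro x
    have e1 := vecEntropy_push π γ m le_rfl (by omega : k ≤ m) x
    have e2 := vecEntropy_push π γ m hkk hk x
    rw [letterMap_refl, push_id, Finset.sum_eq_sum_Ico_succ_bot (by omega)] at e1
    rw [objective, objective, e1, e2, levelEntropy_of_le π x le_rfl, levelEntropy_of_le π x hkk,
      letterMap_refl, push_id, ← mul_assoc (thetaTilde γ (k + 1)), hG, hΓ1]
    ring
  -- `r` is the mean of weights whose entropy is the free energy of `q`, so its projection gains no free
  -- energy
  have hfree : entropy q + meanLog N (k + 1) q ≤ entropy r + meanLog N k r := by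
    have := hW.weightEntropy_le_level (π := π) hc hint k
    rwa [weightEntropy_bernoulliWeights π hc hq, levelEntropy_of_le π _ (Nat.zero_le k)] at this
  have h1 : pressure π γ m N k 1 ≤ objective π γ m N k 1 r := by
    have e1 := hobj (qk 1)
    have e2 := hobj r
    have e3 := entropy_add_meanLog_le (π := π) hc hkk (hqk 1)
    have e4 := hle1 (thetaTilde γ (k + 1)) (push (letterMap π hkk) (qk 1)) (by
      have h2 := (isMandelbrotOn_bernoulliWeights π hc (hqk 1)).push_meanWeight_mem_live (π := π) hc
        (k + 1)
      rwa [← letterMap_comp π (Nat.zero_le k) hkk, ← push_push,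
        push_meanWeight_bernoulliWeights_self π hc (hqk 1)] at h2)
    rw [hmax] at e4
    rw [hrq] at e2
    rw [hpk, e1, e2]
    have e5 := mul_nonneg hΓk.le (sub_nonneg.2 hfree)
    have e6 := mul_nonneg hΓk.le (sub_nonneg.2 e3)
    linarith
  have h2 : r = qk 1 := huk 1 r hrmem (le_antisymm (hlek 1 r hrmem) h1)
  rw [(hdk 1).deriv, ← h2] at hneg
  have h3 : meanLog N k r < 0 := by
    by_contra h
    exact absurd hneg (not_lt.2 (mul_nonneg hΓk.le (not_lt.1 h)))
  refine hfree.trans ?_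
  rw [levelEntropy_of_le π _ (Nat.zero_le k)]
  linarith

/-- The optimality of the weights given by the maximiser of `P_i` at `θ`. -/
lemma dimValue_bernoulliWeights {i : ℕ} (h1i : 1 ≤ i) (hi : i ≤ m) {θ : ℝ} {q : 𝒜 i → ℝ}
    (hq : q ∈ simplexOn (liveLetters (meanCount π P c) i))
    (hmax : pressure π γ m (meanCount π P c) i θ = objective π γ m (meanCount π P c) i θ q)
    (hcase : meanLog (meanCount π P c) i q = 0 ∨
      (0 ≤ meanLog (meanCount π P c) i q ∧ θ = thetaTilde γ i ∧
        ∀ j, 1 ≤ j → j < i → deriv (pressure π γ m (meanCount π P c) j) 1 < 0) ∨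
      (meanLog (meanCount π P c) i q ≤ 0 ∧ θ = 1 ∧ i = m)) :
    dimValue π γ m P (bernoulliWeights π (meanCount π P c) c i (bernoulli q)) =
      pressure π γ m (meanCount π P c) i θ := by
  set N := meanCount π P c
  set W := bernoulliWeights π N c i (bernoulli q) with hWdef
  have hW : IsMandelbrotOn P c W := isMandelbrotOn_bernoulliWeights π hc hq
  have hint := integrable_negMulLog_bernoulliWeights π hc hq
  have hself : push (letterMap π (Nat.zero_le i)) (meanWeight P W) = q :=
    push_meanWeight_bernoulliWeights_self π hc hq
  set h := levelEntropy π (meanWeight P W)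
  have hanti : ∀ {j l : ℕ}, j ≤ l → h l ≤ h j := fun {j l} hjl =>
    levelEntropy_anti π (fun a => meanWeight_nonneg a) (Nat.zero_le j) hjl
  have hhi : h i = entropy q := by
    change levelEntropy π (meanWeight P W) i = _
    rw [levelEntropy_of_le π _ (Nat.zero_le i), hself]
  have hE : weightEntropy (P.map (W [])) = h i + meanLog N i q := by
    rw [hhi]; exact weightEntropy_bernoulliWeights π hc hq
  have hval : pressure π γ m N i θ = θ * (cumWeight γ i * meanLog N i q) +
      (cumWeight γ i * h i + ∑ j ∈ Finset.Ico (i + 1) (m + 1), γ j * h j) := by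
    rw [hmax, objective]
    congr 1
    rw [← vecEntropy_push π γ m (Nat.zero_le i) hi (meanWeight P W), hself]
  have hΓ := cumWeight_pos hγ hi
  have hΓ' : cumWeight γ i = ∑ j ∈ Finset.range i, γ j + γ i := cumWeight_eq
  rw [dimValue_eq, hval]
  rcases hcase with hL | ⟨hL, hθ, hder⟩ | ⟨hL, hθ, him⟩
  · rw [hL, add_zero] at hE
    rw [hE, sum_mul_min_eq hi (fun j hj => hanti hj.le) fun j hj _ => hanti hj.le, min_self, hL, hΓ']
    ring
  · have hlow : ∀ j < i, weightEntropy (P.map (W [])) ≤ h j := by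
      obtain ⟨k, rfl⟩ : ∃ k, i = k + 1 := ⟨i - 1, by omega⟩
      have hk : weightEntropy (P.map (W [])) ≤ h k := by
        rcases Nat.eq_zero_or_pos k with rfl | hk0
        · exact hW.weightEntropy_le_zero_level hc hint
        · rw [hE, hhi]
          exact weightEntropy_le_of_deriv_neg hc hγ hi hq (hθ ▸ hmax) (hder k hk0 (by omega))
      exact fun j hj => hk.trans (hanti (by omega))
    have hup : h i ≤ weightEntropy (P.map (W [])) := by linarith
    rw [sum_mul_min_eq hi hlow fun j hj _ => (hanti hj.le).trans hup, min_eq_right hup, hE,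
      ← mul_assoc θ, hθ, thetaTilde_mul hΓ, hΓ']
    ring
  · subst him
    have hle : weightEntropy (P.map (W [])) ≤ h i := by linarith
    rw [sum_mul_min_eq hi (fun j hj => hle.trans (hanti hj.le)) fun j hj hj' => by omega,
      min_eq_left hle, hE, hθ, hΓ']
    ring

end Optimisation

/-! ### Critical parameters and the maximum -/

section Main

variable {𝒜 : ℕ → Type*} [∀ i, Fintype (𝒜 i)] [∀ i, MeasurableSpace (𝒜 i)]
  [∀ i, MeasurableSingletonClass (𝒜 i)] (π : ∀ i, 𝒜 i → 𝒜 (i + 1)) (γ : ℕ → ℝ) (m : ℕ)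
  (N : ∀ i, 𝒜 i → ℝ)

/-- The three ways in which `θ` can be critical for the level `i`: a critical point of `P_i`,
the left end point `thetaTilde i`, or the right end point `1` at the last level. -/
def IsCritical (i : ℕ) (θ : ℝ) : Prop :=
  deriv (pressure π γ m N i) θ = 0 ∨
    (0 ≤ deriv (pressure π γ m N i) θ ∧ θ = thetaTilde γ i ∧
      ∀ j, 1 ≤ j → j < i → deriv (pressure π γ m N j) 1 < 0) ∨
    (deriv (pressure π γ m N i) θ ≤ 0 ∧ θ = 1 ∧ i = m)

variable {π γ m N}

/-- The pair `(i₀, θ₀)`, with `i₀` replaced by `m` when it is `m + 1`, is critical. -/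
lemma isCritical_criticalTheta (hm : 1 ≤ m) (hγ : ∀ j ≤ m, 0 < γ j)
    (hcont : ∀ i, 1 ≤ i → i ≤ m → Continuous (deriv (pressure π γ m N i))) :
    1 ≤ min (criticalIndex π γ m N) m ∧
    thetaTilde γ (min (criticalIndex π γ m N) m) ≤ criticalTheta π γ m N ∧
    criticalTheta π γ m N ≤ 1 ∧
    IsCritical π γ m N (min (criticalIndex π γ m N) m) (criticalTheta π γ m N) ∧
    (if criticalIndex π γ m N ≤ m then
      pressure π γ m N (criticalIndex π γ m N) (criticalTheta π γ m N) else pressure π γ m N m 1) =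
      pressure π γ m N (min (criticalIndex π γ m N) m) (criticalTheta π γ m N) := by
  set T : Set ℕ := {i | 1 ≤ i ∧ i ≤ m ∧ 0 ≤ deriv (pressure π γ m N i) 1} ∪ {m + 1} with hT
  have hmem : criticalIndex π γ m N ∈ T := Nat.sInf_mem ⟨m + 1, Or.inr rfl⟩
  have hlt : ∀ j, 1 ≤ j → j ≤ m → j < criticalIndex π γ m N →
      deriv (pressure π γ m N j) 1 < 0 := by
    intro j h1 hj hjlt
    by_contra hneg
    exact Nat.notMem_of_lt_sInf hjlt (Or.inl ⟨h1, hj, not_lt.1 hneg⟩)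
  have hθdef : criticalTheta π γ m N = if criticalIndex π γ m N ≤ m then
      sInf {θ | θ ∈ Set.Icc (thetaTilde γ (criticalIndex π γ m N)) 1 ∧
        0 ≤ deriv (pressure π γ m N (criticalIndex π γ m N)) θ} else 1 := rfl
  generalize criticalIndex π γ m N = i₀ at *
  generalize criticalTheta π γ m N = θ₀ at *
  rcases hmem with ⟨h1, him, hder⟩ | h
  · rw [min_eq_left him, if_pos him]
    rw [if_pos him] at hθdef
    have htt := thetaTilde_le_one hγ him
    have hc := hcont i₀ h1 him
    have hclosed : IsClosed {θ | θ ∈ Set.Icc (thetaTilde γ i₀) 1 ∧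
        0 ≤ deriv (pressure π γ m N i₀) θ} :=
      isClosed_Icc.inter (isClosed_le continuous_const hc)
    have hbdd : BddBelow {θ | θ ∈ Set.Icc (thetaTilde γ i₀) 1 ∧
        0 ≤ deriv (pressure π γ m N i₀) θ} := ⟨thetaTilde γ i₀, fun θ hθ => hθ.1.1⟩
    have hin := hclosed.csInf_mem ⟨1, ⟨htt, le_rfl⟩, hder⟩ hbdd
    rw [← hθdef] at hin
    refine ⟨h1, hin.1.1, hin.1.2, ?_, rfl⟩
    rcases hin.2.eq_or_lt with h0 | h0
    · exact Or.inl h0.symm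
    refine Or.inr (Or.inl ⟨h0.le, ?_, fun j hj hj' => hlt j hj (by omega) hj'⟩)
    -- otherwise the derivative is still positive slightly to the left
    by_contra hne
    have hgt : thetaTilde γ i₀ < θ₀ := lt_of_le_of_ne hin.1.1 (Ne.symm hne)
    have hev : ∀ᶠ θ in 𝓝[<] θ₀, 0 < deriv (pressure π γ m N i₀) θ :=
      nhdsWithin_le_nhds ((hc.tendsto θ₀).eventually (lt_mem_nhds h0))
    have hev2 : ∀ᶠ θ in 𝓝[<] θ₀, θ ∈ Set.Ioo (thetaTilde γ i₀) θ₀ := Ioo_mem_nhdsLT hgt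
    obtain ⟨θ, hθ1, hθ2⟩ := (hev.and hev2).exists
    have := csInf_le hbdd (show θ ∈ {θ | θ ∈ Set.Icc (thetaTilde γ i₀) 1 ∧
        0 ≤ deriv (pressure π γ m N i₀) θ} from ⟨⟨hθ2.1.le, hθ2.2.le.trans hin.1.2⟩, hθ1.le⟩)
    rw [← hθdef] at this
    exact absurd hθ2.2 (not_lt.2 this)
  · have h : i₀ = m + 1 := h
    subst h
    rw [if_neg (by omega)] at hθdef ⊢
    subst hθdef
    rw [min_eq_right (by omega)]
    exact ⟨hm, thetaTilde_le_one hγ le_rfl, le_rfl,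
      Or.inr (Or.inr ⟨(hlt m hm le_rfl (by omega)).le, rfl, rfl⟩), rfl⟩

variable {Ω : Type*} [MeasurableSpace Ω] {P : Measure Ω} [IsProbabilityMeasure P]
  {c : List (𝒜 0) → Ω → 𝒜 0 → Bool}

/-- At a critical point, the weights of the equilibrium state are optimal, and they are the only
ones. -/
theorem maximum_of_isCritical (hc : IsPercolation P c) (hγ : ∀ j ≤ m, 0 < γ j) {i : ℕ}
    (h1i : 1 ≤ i) (hi : i ≤ m) {θ : ℝ} (hθ : thetaTilde γ i ≤ θ) (hθ1 : θ ≤ 1)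
    (hcrit : IsCritical π γ m (meanCount π P c) i θ) :
    IsGreatest {D : ℝ | ∃ W : List (𝒜 0) → Ω → 𝒜 0 → ℝ≥0, IsMandelbrotOn P c W ∧ IsPositive P W ∧
        ∀ᵐ ω ∂P, randomMeasure W ω ≠ 0 → HasWeightedEntropyDim π γ m (randomMeasure W ω) D}
      (pressure π γ m (meanCount π P c) i θ) ∧
    ∃ ν : Measure (ℕ → 𝒜 i),
      (∀ ν', IsEquilibriumState π γ m (meanCount π P c) i θ ν' ↔ ν' = ν) ∧ IsBernoulli ν ∧
      IsMandelbrotOn P c (bernoulliWeights π (meanCount π P c) c i ν) ∧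
      IsPositive P (bernoulliWeights π (meanCount π P c) c i ν) ∧
      (∀ᵐ ω ∂P, randomMeasure (bernoulliWeights π (meanCount π P c) c i ν) ω ≠ 0 →
        HasWeightedEntropyDim π γ m (randomMeasure (bernoulliWeights π (meanCount π P c) c i ν) ω)
          (pressure π γ m (meanCount π P c) i θ)) ∧
      ∀ W : List (𝒜 0) → Ω → 𝒜 0 → ℝ≥0, IsMandelbrotOn P c W → IsPositive P W →
        (∀ᵐ ω ∂P, randomMeasure W ω ≠ 0 → HasWeightedEntropyDim π γ m (randomMeasure W ω)
          (pressure π γ m (meanCount π P c) i θ)) →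
        ∀ᵐ ω ∂P, randomMeasure W ω =
          randomMeasure (bernoulliWeights π (meanCount π P c) c i ν) ω := by
  obtain ⟨q₁, hq₁, -⟩ := exists_mem_simplexOn (π := π) hc i
  obtain ⟨q, hq, hp, hle, huniq, hder, -, heq⟩ :=
    exists_pressure_maximizer (π := π) hγ hi ⟨q₁, hq₁⟩
  have hΓ := cumWeight_pos hγ hi
  have hθ0 : 0 < θ := (thetaTilde_pos hγ h1i hi).trans_le hθ
  have hcase : meanLog (meanCount π P c) i (q θ) = 0 ∨
      (0 ≤ meanLog (meanCount π P c) i (q θ) ∧ θ = thetaTilde γ i ∧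
        ∀ j, 1 ≤ j → j < i → deriv (pressure π γ m (meanCount π P c) j) 1 < 0) ∨
      (meanLog (meanCount π P c) i (q θ) ≤ 0 ∧ θ = 1 ∧ i = m) := by
    rw [IsCritical, (hder θ).deriv] at hcrit
    rcases hcrit with h | ⟨h, h'⟩ | ⟨h, h'⟩
    · exact Or.inl ((mul_eq_zero.1 h).resolve_left hΓ.ne')
    · exact Or.inr (Or.inl ⟨nonneg_of_mul_nonneg_right h hΓ, h'⟩)
    · exact Or.inr (Or.inr ⟨nonpos_of_mul_nonpos_right h hΓ, h'⟩)
  have hdim := dimValue_bernoulliWeights hc hγ h1i hi (hq θ) (hp θ) hcase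
  set W₀ := bernoulliWeights π (meanCount π P c) c i (bernoulli (q θ)) with hW₀
  have hM₀ : IsMandelbrotOn P c W₀ := isMandelbrotOn_bernoulliWeights π hc (hq θ)
  -- otherwise the weighted dimension, which is the pressure, would not be positive
  have hent : 0 < weightEntropy (P.map (W₀ [])) := by
    by_contra hneg
    have h1 := pressure_pos (π := π) hc hγ hi hθ0 hθ1
    rw [← hdim] at h1
    refine absurd h1 (not_lt.2 (Finset.sum_nonpos fun j hj => ?_))
    exact mul_nonpos_of_nonneg_of_nonpos (hγ j (by simp at hj; omega)).le
      ((min_le_left _ _).trans (not_lt.1 hneg))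
  have hpos₀ : IsPositive P W₀ :=
    hM₀.isPositive (integrable_negMulLog_bernoulliWeights π hc (hq θ)) hent
  have hdim₀ := hM₀.ae_hasWeightedEntropyDim π γ m hpos₀
  rw [hdim] at hdim₀
  refine ⟨⟨⟨W₀, hM₀, hpos₀, hdim₀⟩, ?_⟩, bernoulli (q θ), heq θ, ?_, hM₀, hpos₀, hdim₀, ?_⟩
  · rintro D ⟨W, hW, hpos, hD⟩
    rw [hW.eq_dimValue π γ m hpos hD]
    exact (hW.dimValue_le_objective hc hγ (hW.integrable_negMulLog hpos) hi hθ hθ1).1.trans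
      (hle θ _ (hW.push_meanWeight_mem_live hc i))
  · exact ⟨letterLaw (q θ), isProbabilityMeasure_letterLaw (hq θ).1, rfl⟩
  · intro W hW hpos hD
    have hint := hW.integrable_negMulLog hpos
    obtain ⟨h1, h2⟩ := hW.dimValue_le_objective (π := π) hc hγ hint hi hθ hθ1
    have h3 := hle θ _ (hW.push_meanWeight_mem_live hc i)
    have h4 := hW.eq_dimValue π γ m hpos hD
    have h5 := huniq θ _ (hW.push_meanWeight_mem_live hc i) (le_antisymm h3 (h4 ▸ h1))
    have h6 := h2 (le_antisymm h1 (h4 ▸ h3)) hθ0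
    have h7 := (hW.weightEntropy_le hc.measurable hint (letterMap π (Nat.zero_le i))).2.1 (by
      rw [h6, levelEntropy_of_le π _ (Nat.zero_le i), meanLog, meanCount_eq_push π hc.measurable])
    rw [h5, ← meanCount_eq_push π hc.measurable] at h7
    obtain ⟨g, hg⟩ : ∃ g : (𝒜 0 → Bool) → 𝒜 0 → ℝ≥0, W₀ = fun u ω => g (c u ω) :=
      ⟨fun s a => if s a = true then
        ((q θ (letterMap π (Nat.zero_le i) a)).toNNReal /
          (meanCount π P c i (letterMap π (Nat.zero_le i) a)).toNNReal) else 0, by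
        funext u ω; rw [hW₀, bernoulliWeights_eq π (hq θ)]⟩
    rw [← hW₀, hg]
    refine hW.ae_randomMeasure_eq ?_
    filter_upwards [h7] with ω h9
    funext a
    have h10 := congr_fun (congr_fun (congr_fun hg []) ω) a
    rw [← h10]
    refine NNReal.coe_injective ?_
    rw [h9 a, hW₀, coe_bernoulliWeights π hc (hq θ)]

end Main

end Sponge

end

theorem theorem4p1
    {𝒜 : ℕ → Type*} [∀ i, Fintype (𝒜 i)] [∀ i, MeasurableSpace (𝒜 i)]
    [∀ i, MeasurableSingletonClass (𝒜 i)]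
    (π : ∀ i, 𝒜 i → 𝒜 (i + 1)) (m : ℕ) (hm : 1 ≤ m)
    (γ : ℕ → ℝ) (hγ : ∀ i ≤ m, 0 < γ i)
    {Ω : Type*} [MeasurableSpace Ω] (P : Measure Ω) [IsProbabilityMeasure P]
    (c : List (𝒜 0) → Ω → 𝒜 0 → Bool) (hc : Sponge.IsPercolation P c)
    (N : ∀ i, 𝒜 i → ℝ) (hN : N = Sponge.meanCount π P c)
    (i₀ : ℕ) (hi₀ : i₀ = Sponge.criticalIndex π γ m N)
    (θ₀ : ℝ) (hθ₀ : θ₀ = Sponge.criticalTheta π γ m N)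
    (M : ℝ) (hM : M = if i₀ ≤ m then Sponge.pressure π γ m N i₀ θ₀
      else Sponge.pressure π γ m N m 1) :
    -- the functions `P_i` are differentiable, so that `i₀` and `θ₀` are meaningful
    (∀ i, 1 ≤ i → i ≤ m → Differentiable ℝ (Sponge.pressure π γ m N i)) ∧
    -- every positive Mandelbrot measure on `K` has a well-defined weighted entropy dimension
    (∀ W : List (𝒜 0) → Ω → 𝒜 0 → ℝ≥0, Sponge.IsMandelbrotOn P c W → Sponge.IsPositive P W →
      ∃ D : ℝ, ∀ᵐ ω ∂P, Sponge.randomMeasure W ω ≠ 0 →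
        Sponge.HasWeightedEntropyDim π γ m (Sponge.randomMeasure W ω) D) ∧
    -- the maximum of the weighted entropy dimensions is `M`
    IsGreatest {D : ℝ | ∃ W : List (𝒜 0) → Ω → 𝒜 0 → ℝ≥0,
      Sponge.IsMandelbrotOn P c W ∧ Sponge.IsPositive P W ∧
      ∀ᵐ ω ∂P, Sponge.randomMeasure W ω ≠ 0 →
        Sponge.HasWeightedEntropyDim π γ m (Sponge.randomMeasure W ω) D} M ∧
    -- it is attained at the Mandelbrot measure `μ_ν` of the equilibrium state `ν`, and nowhere else
    ∃ ν : Measure (ℕ → 𝒜 (min i₀ m)),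
      (∀ ν' : Measure (ℕ → 𝒜 (min i₀ m)),
        Sponge.IsEquilibriumState π γ m N (min i₀ m) θ₀ ν' ↔ ν' = ν) ∧
      Sponge.IsBernoulli ν ∧
      Sponge.IsMandelbrotOn P c (Sponge.bernoulliWeights π N c (min i₀ m) ν) ∧
      Sponge.IsPositive P (Sponge.bernoulliWeights π N c (min i₀ m) ν) ∧
      (∀ᵐ ω ∂P,
        Sponge.randomMeasure (Sponge.bernoulliWeights π N c (min i₀ m) ν) ω ≠ 0 →
        Sponge.HasWeightedEntropyDim π γ m
          (Sponge.randomMeasure (Sponge.bernoulliWeights π N c (min i₀ m) ν) ω) M) ∧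
      ∀ W : List (𝒜 0) → Ω → 𝒜 0 → ℝ≥0, Sponge.IsMandelbrotOn P c W → Sponge.IsPositive P W →
        (∀ᵐ ω ∂P, Sponge.randomMeasure W ω ≠ 0 →
          Sponge.HasWeightedEntropyDim π γ m (Sponge.randomMeasure W ω) M) →
        ∀ᵐ ω ∂P, Sponge.randomMeasure W ω =
          Sponge.randomMeasure (Sponge.bernoulliWeights π N c (min i₀ m) ν) ω := by
  subst hN
  have hmax := fun i (hi : i ≤ m) => Sponge.exists_pressure_maximizer (π := π) hγ hi
    ((Sponge.exists_mem_simplexOn (π := π) hc i).imp fun _ h => h.1)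
  have hcont : ∀ i, 1 ≤ i → i ≤ m →
      Continuous (deriv (Sponge.pressure π γ m (Sponge.meanCount π P c) i)) := by
    intro i _ hi
    obtain ⟨q, -, -, -, -, hder, hq, -⟩ := hmax i hi
    rwa [show deriv (Sponge.pressure π γ m (Sponge.meanCount π P c) i) = _ from
      funext fun θ => (hder θ).deriv]
  obtain ⟨h1, h2, h3, h4, h5⟩ := Sponge.isCritical_criticalTheta hm hγ hcont
  subst hi₀ hθ₀
  rw [h5] at hM
  subst hM
  refine ⟨fun i _ hi => ?_, fun W hW hpos => ⟨_, hW.ae_hasWeightedEntropyDim π γ m hpos⟩,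
    Sponge.maximum_of_isCritical hc hγ h1 (min_le_right _ _) h2 h3 h4⟩
  obtain ⟨q, -, -, -, -, hder, -⟩ := hmax i hi
  exact fun θ => (hder θ).differentiableAt
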